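/- **Graphs.** A discrete graph $G$ is a finite set of flags $F(G)$ with an idempotent root map $r$ and an involution $\iota$ such that $\iota\circ r=r$. Its vertices are $V(G)=\operatorname{im} r$, the other flags are half-edges; an edge (leg) is a $\iota$-orbit of half-edges of size two (one). The genus is $\#E(G)-\#V(G)+1$, a tree is a connected graph of genus $0$, and the valency of a vertex is the number of half-edges rooted at it. A contraction $G'\to G$ is a map of flags commuting with $r$ and $\iota$ such that the preimage of every vertex is a legless tree and the preimage of every edge or leg is a single edge or leg. For a finite set $A$, let $\mathbb G_{g,A}$ be the category of connected genus-$g$ graphs with legs marked bijectively by $A$ and all vertices at least $3$-valent; its morphisms are the contractions compatible with the markings. **Poics.** A poic is a free abelian group $N$ of finite rank with a full-dimensional non-empty subset of $N_{\mathbb R}=N\otimes\mathbb R$ that is a finite intersection of half-spaces $\{f\ge 0\}$ and $\{f>0\}$, $f\in N^\vee$. A face of $\sigma$ is a non-empty set $\sigma\cap\{f=0\}$ with $f\in N^\vee$, $f\le0$ on $\sigma$; it carries the lattice $N\cap\operatorname{Lin}$. A morphism is an integral linear map that maps cone to cone; it is a face-embedding if it identifies its source with a face of its target. A *poic-space* is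 a functor $\mathcal X\colon C_{\mathcal X}\to\mathrm{POIC}$ from an essentially finite category with finite hom-sets that maps morphisms to face-embeddings and such that every face of every $\mathcal X(x)$ is the image of a morphism $w\to x$, unique up to isomorphism over $x$. It is a *poic-complex* if $C_{\mathcal X}$ is thin. A morphism is a functor $F$ with a natural transformation $\eta_F\colon \mathcal X\Rightarrow\mathcal Y\circ F$ such that no $\eta_{F,x}(\mathcal X(x))$ lies in a proper face of $\mathcal Y(F(x))$. A *linear poic-complex* is a poic-complex $\Phi$ with a morphism to the one-object poic-complex $(N_{\mathbb R},N)$ of a free abelian group $N$ of finite rank. A morphism $\pi$ from a poic-complex $\Phi$ to a poic-space $\mathcal X$ is a *poic-fibration* if (1) $\pi$ is essentially surjective; (2) each $\eta_{\pi,p}\colon\Phi(p)\to\mathcal X(\pi(p))$ induces an isomorphism of relative interiors; (3) for every $p$ and every $f\colon\pi(p)\to x$ there are a morphism $h\colon p\to q$ and an isomorphism $k\colon\pi(q)\to x$ with $f=k\circ\pi(h)$, and for any other such $(q',h',k')$ there is an isomorphism $i\colon q\to q'$ with $i\circ h=h'$ and $k'\circ\pi(i)=k$. It is a *linear poic-fibration*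 if moreover $\Phi$ is a linear poic-complex. **Moduli.** For $G$ in $\mathbb G_{g,A}$ let $\sigma_G\subset\mathbb R^{E(G)}_{\ge0}$ (with lattice $\mathbb Z^{E(G)}$) consist of the points whose set of zero coordinates is the edge set of a forest in $G$. Let $\mathrm M^{\rm trop}_{g,A}\colon\mathbb G_{g,A}^{\rm op}\to\mathrm{POIC}$ be the functor $G\mapsto\sigma_G$ that maps a contraction $G'\to G$ to the map $\sigma_G\to\sigma_{G'}$ given by extension by zero on the contracted edges. **Spanning trees.** Let $g\ge 0$ be an integer and $A$ a finite set with $2g+\#A-2>0$, and put $\mathbb g=\{1,\dots,g,1^*,\dots,g^*\}$. For a tree $T$ in $\mathbb G_{0,A\sqcup\mathbb g}$ let $\operatorname{st}_{g,A}(T)$ be the $A$-marked graph obtained by letting the involution exchange the $i$-leg and the $i^*$-leg, which form an edge $e_i$ $(1\le i\le g)$; a contraction of trees is sent to the same map of flags. Let $\operatorname{ST}_{g,A}\colon\mathbb G_{0,A\sqcup\mathbb g}^{\rm op}\to\mathrm{POIC}$ be the functor $T\mapsto\sigma_T\times\mathbb R^g_{>0}$. Let $\eta_T\colon\sigma_T\times\mathbb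 R^g_{>0}\to\sigma_{\operatorname{st}_{g,A}(T)}$ be the map that keeps the coordinates of the edges of $T$ and uses the $i$-th coordinate of $\mathbb R^g_{>0}$ as the $e_i$-coordinate. For $B=A\sqcup\mathbb g$ let $Q_B$ be the cokernel of $\mathbb R^B\to\mathbb R^{\binom B2}$, $x\mapsto(x_i+x_j)_{\{i,j\}}$. For $I\subset B$ let $v_I\in Q_B$ be the class of the vector with $\{i,j\}$-coordinate $1$ if exactly one of $i,j$ lies in $I$ and $0$ otherwise, and let $N_{\rm dist}\subset Q_B$ be the lattice generated by the $v_I$ with $1<\#I<\#B-1$. Let $D_{g,A}\colon\operatorname{ST}_{g,A}\to(N_{\rm dist})_{\mathbb R}$ be given at $T$ by the projection to $\sigma_T$ followed by the map that sends a metric on $T$ to the vector of distances between its legs. **Proposition.** The construction $\operatorname{st}_{g,A}\colon\mathbb G_{0,A\sqcup\mathbb g}\to\mathbb G_{g,A}$ is an essentially surjective functor. The maps $\eta_T$ form a natural transformation $\operatorname{ST}_{g,A}\Rightarrow\mathrm M^{\rm trop}_{g,A}\circ\operatorname{st}_{g,A}$ which, together with $\operatorname{st}_{g,A}$, is a linear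 poic-fibration from $\operatorname{ST}_{g,A}$, with the linear structure $D_{g,A}$, to $\mathrm M^{\rm trop}_{g,A}$. In particular, $(\operatorname{ST}_{g,A},D_{g,A})$ is a linear poic-complex and $\mathrm M^{\rm trop}_{g,A}$ is a poic-space. -/

import Mathlib

universe u v w

namespace TropicalModuli

open CategoryTheory TensorProduct

/-! ### Partially open integral cones -/

section Cones

variable {N : Type u} [AddCommGroup N] {M : Type v} [AddCommGroup M]

/-- The linear functional on `N_ℝ = ℝ ⊗ N` induced by an element of the dual of `N`. -/
noncomputable def realFunctional (φ : N →ₗ[ℤ] ℤ) : (ℝ ⊗[ℤ] N) →ₗ[ℝ] ℝ :=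
  (TensorProduct.AlgebraTensorModule.rid ℤ ℝ ℝ).toLinearMap ∘ₗ φ.baseChange ℝ

/-- A partially open integral cone of `N_ℝ`: a non-empty finite intersection of closed half-spaces
`{f ≥ 0}` and open half-spaces `{f > 0}` with `f` in the dual of `N`. -/
def IsPartiallyOpenCone (σ : Set (ℝ ⊗[ℤ] N)) : Prop :=
  σ.Nonempty ∧ ∃ s t : Set (N →ₗ[ℤ] ℤ), s.Finite ∧ t.Finite ∧
    σ = {x | (∀ f ∈ s, 0 ≤ realFunctional f x) ∧ ∀ f ∈ t, 0 < realFunctional f x}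

/-- `τ` is a face of `σ`: a non-empty set `σ ∩ {f ≥ 0}`, where `f` is in the dual of `N` and
`f ≤ 0` on `σ`. -/
def IsFace (τ σ : Set (ℝ ⊗[ℤ] N)) : Prop :=
  τ.Nonempty ∧ ∃ f : N →ₗ[ℤ] ℤ, (∀ x ∈ σ, realFunctional f x ≤ 0) ∧
    τ = {x | x ∈ σ ∧ 0 ≤ realFunctional f x}

/-- The relative interior of a partially open integral cone: the points at which every integral
functional that is non-negative on `σ` and not identically zero on `σ` is positive. -/
def relInterior (σ : Set (ℝ ⊗[ℤ] N)) : Set (ℝ ⊗[ℤ] N) :=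
  {x | x ∈ σ ∧ ∀ f : N →ₗ[ℤ] ℤ, (∀ y ∈ σ, 0 ≤ realFunctional f y) →
    (∃ y ∈ σ, realFunctional f y ≠ 0) → 0 < realFunctional f x}

@[simp]
theorem realFunctional_tmul (φ : N →ₗ[ℤ] ℤ) (a : ℝ) (n : N) :
    realFunctional φ (a ⊗ₜ n) = φ n * a := by
  simp [realFunctional]

theorem realFunctional_baseChange (φ : M →ₗ[ℤ] ℤ) (f : N →ₗ[ℤ] M) (x : ℝ ⊗[ℤ] N) :
    realFunctional φ (f.baseChange ℝ x) = realFunctional (φ ∘ₗ f) x := by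
  simp [realFunctional, LinearMap.baseChange_comp]

theorem realFunctional_zero (x : ℝ ⊗[ℤ] N) : realFunctional (0 : N →ₗ[ℤ] ℤ) x = 0 := by
  simp [realFunctional]

theorem realFunctional_add (φ ψ : N →ₗ[ℤ] ℤ) (x : ℝ ⊗[ℤ] N) :
    realFunctional (φ + ψ) x = realFunctional φ x + realFunctional ψ x := by
  simp [realFunctional, LinearMap.baseChange_add]

theorem realFunctional_sum {ι : Type w} (s : Finset ι) (φ : ι → N →ₗ[ℤ] ℤ) (x : ℝ ⊗[ℤ] N) :
    realFunctional (∑ i ∈ s, φ i) x = ∑ i ∈ s, realFunctional (φ i) x := by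
  classical
  induction s using Finset.induction_on with
  | empty => simp [realFunctional_zero]
  | insert a s ha ih => rw [Finset.sum_insert ha, Finset.sum_insert ha, realFunctional_add, ih]

theorem span_eq_top_of_sub {σ : Set (ℝ ⊗[ℤ] N)}
    (h : ∀ n : N, ∃ a b : N, n = a - b ∧ (1 : ℝ) ⊗ₜ[ℤ] a ∈ σ ∧ (1 : ℝ) ⊗ₜ[ℤ] b ∈ σ) :
    Submodule.span ℝ σ = ⊤ := by
  rw [eq_top_iff]
  rintro x -
  induction x using TensorProduct.induction_on with
  | zero => exact Submodule.zero_mem _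
  | tmul r n =>
    obtain ⟨a, b, rfl, ha, hb⟩ := h n
    have : r ⊗ₜ[ℤ] (a - b) = r • ((1 : ℝ) ⊗ₜ[ℤ] a - (1 : ℝ) ⊗ₜ[ℤ] b) := by
      rw [← TensorProduct.tmul_sub, TensorProduct.smul_tmul', smul_eq_mul, mul_one]
    rw [this]
    exact Submodule.smul_mem _ _
      (Submodule.sub_mem _ (Submodule.subset_span ha) (Submodule.subset_span hb))
  | add x y hx hy => exact Submodule.add_mem _ hx hy

end Cones

/-- A poic: a free abelian group `N` of finite rank together with a full-dimensional partially open
integral cone of `N_ℝ`. -/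
structure Poic where
  N : Type u
  [addCommGroup : AddCommGroup N]
  [free : Module.Free ℤ N]
  [fin : Module.Finite ℤ N]
  cone : Set (ℝ ⊗[ℤ] N)
  isCone : IsPartiallyOpenCone cone
  full : Submodule.span ℝ cone = ⊤

namespace Poic

attribute [instance] Poic.addCommGroup Poic.free Poic.fin

/-- A morphism of poics: an integral linear map whose real extension maps the first cone to the
second one. -/
@[ext]
structure Hom (P Q : Poic.{u}) where
  lin : P.N →ₗ[ℤ] Q.N
  mapsTo : Set.MapsTo (lin.baseChange ℝ) P.cone Q.cone

noncomputable instance : Category.{u} Poic.{u} where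
  Hom := Hom
  id P := ⟨LinearMap.id, fun x hx => by simpa using hx⟩
  comp f g := ⟨g.lin ∘ₗ f.lin, fun x hx => by
    rw [LinearMap.baseChange_comp]; exact g.mapsTo (f.mapsTo hx)⟩

/-- A morphism `f : P ⟶ Q` is a face-embedding if it identifies `P` with a face of `Q`: its real
extension is injective, the image of the cone of `P` is a face `τ` of the cone of `Q`, and the
image of the lattice of `P` is the lattice `N ∩ Lin(τ)` of that face. -/
def IsFaceEmbedding {P Q : Poic.{u}} (f : P ⟶ Q) : Prop :=
  Function.Injective (f.lin.baseChange ℝ) ∧ IsFace (f.lin.baseChange ℝ '' P.cone) Q.cone ∧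
    ∀ n : Q.N, (1 : ℝ) ⊗ₜ[ℤ] n ∈ Submodule.span ℝ (f.lin.baseChange ℝ '' P.cone) →
      n ∈ LinearMap.range f.lin

/-- The morphism `f : P ⟶ Q` induces an isomorphism between the relative interiors (as poics with
the lattices of `P` and `Q`). -/
def IsIsoOnInterior {P Q : Poic.{u}} (f : P ⟶ Q) : Prop :=
  Function.Bijective f.lin ∧ f.lin.baseChange ℝ '' relInterior P.cone = relInterior Q.cone

/-- The product of two poics. -/
noncomputable def prod (P : Poic.{u}) (Q : Poic.{v}) : Poic.{max u v} where
  N := P.N × Q.N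
  cone := {x | (LinearMap.fst ℤ P.N Q.N).baseChange ℝ x ∈ P.cone ∧
    (LinearMap.snd ℤ P.N Q.N).baseChange ℝ x ∈ Q.cone}
  isCone := by
    obtain ⟨⟨p, hp⟩, s, t, hs, ht, h1⟩ := P.isCone
    obtain ⟨⟨q, hq⟩, s', t', hs', ht', h2⟩ := Q.isCone
    refine ⟨⟨(LinearMap.inl ℤ P.N Q.N).baseChange ℝ p + (LinearMap.inr ℤ P.N Q.N).baseChange ℝ q,
      ?_, ?_⟩, (fun f => f ∘ₗ LinearMap.fst ℤ P.N Q.N) '' s ∪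
        (fun f => f ∘ₗ LinearMap.snd ℤ P.N Q.N) '' s',
      (fun f => f ∘ₗ LinearMap.fst ℤ P.N Q.N) '' t ∪
        (fun f => f ∘ₗ LinearMap.snd ℤ P.N Q.N) '' t',
      (hs.image _).union (hs'.image _), (ht.image _).union (ht'.image _), ?_⟩
    · rw [map_add, ← LinearMap.comp_apply, ← LinearMap.comp_apply, ← LinearMap.baseChange_comp,
        ← LinearMap.baseChange_comp, LinearMap.fst_comp_inl, LinearMap.fst_comp_inr]
      simpa using hp
    · rw [map_add, ← LinearMap.comp_apply, ← LinearMap.comp_apply, ← LinearMap.baseChange_comp,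
        ← LinearMap.baseChange_comp, LinearMap.snd_comp_inl, LinearMap.snd_comp_inr]
      simpa using hq
    · ext x
      rw [h1, h2]
      simp only [Set.mem_ofPred_eq, Set.mem_union, Set.mem_image, or_imp, forall_and,
        forall_exists_index, and_imp, forall_apply_eq_imp_iff₂, realFunctional_baseChange]
      tauto
  full := by
    have hscale : ∀ {N : Type u} [AddCommGroup N] {σ : Set (ℝ ⊗[ℤ] N)},
        IsPartiallyOpenCone σ → ∀ x ∈ σ, (2 : ℝ) • x ∈ σ := by
      rintro N _ σ ⟨-, s, t, -, -, rfl⟩ x ⟨h1, h2⟩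
      refine ⟨fun f hf => ?_, fun f hf => ?_⟩
      · rw [map_smul, smul_eq_mul]; have := h1 f hf; positivity
      · rw [map_smul, smul_eq_mul]; have := h2 f hf; positivity
    have hscale' : ∀ {N : Type v} [AddCommGroup N] {σ : Set (ℝ ⊗[ℤ] N)},
        IsPartiallyOpenCone σ → ∀ x ∈ σ, (2 : ℝ) • x ∈ σ := by
      rintro N _ σ ⟨-, s, t, -, -, rfl⟩ x ⟨h1, h2⟩
      refine ⟨fun f hf => ?_, fun f hf => ?_⟩
      · rw [map_smul, smul_eq_mul]; have := h1 f hf; positivity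
      · rw [map_smul, smul_eq_mul]; have := h2 f hf; positivity
    set inl := (LinearMap.inl ℤ P.N Q.N).baseChange ℝ with hinl
    set inr := (LinearMap.inr ℤ P.N Q.N).baseChange ℝ with hinr
    set fst := (LinearMap.fst ℤ P.N Q.N).baseChange ℝ with hfst
    set snd := (LinearMap.snd ℤ P.N Q.N).baseChange ℝ with hsnd
    have e1 : ∀ x, fst (inl x) = x := fun x => by
      rw [hfst, hinl, ← LinearMap.comp_apply, ← LinearMap.baseChange_comp, LinearMap.fst_comp_inl]
      simp
    have e2 : ∀ x, snd (inl x) = 0 := fun x => by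
      rw [hsnd, hinl, ← LinearMap.comp_apply, ← LinearMap.baseChange_comp, LinearMap.snd_comp_inl]
      simp
    have e3 : ∀ x, fst (inr x) = 0 := fun x => by
      rw [hfst, hinr, ← LinearMap.comp_apply, ← LinearMap.baseChange_comp, LinearMap.fst_comp_inr]
      simp
    have e4 : ∀ x, snd (inr x) = x := fun x => by
      rw [hsnd, hinr, ← LinearMap.comp_apply, ← LinearMap.baseChange_comp, LinearMap.snd_comp_inr]
      simp
    have e5 : ∀ x, inl (fst x) + inr (snd x) = x := fun x => by
      rw [hfst, hinr, hsnd, hinl, ← LinearMap.comp_apply, ← LinearMap.comp_apply,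
        ← LinearMap.baseChange_comp, ← LinearMap.baseChange_comp, ← LinearMap.add_apply,
        ← LinearMap.baseChange_add]
      have : LinearMap.inl ℤ P.N Q.N ∘ₗ LinearMap.fst ℤ P.N Q.N +
          LinearMap.inr ℤ P.N Q.N ∘ₗ LinearMap.snd ℤ P.N Q.N = LinearMap.id := by
        ext <;> simp
      rw [this]; simp
    set σ : Set (ℝ ⊗[ℤ] (P.N × Q.N)) := {x | fst x ∈ P.cone ∧ snd x ∈ Q.cone} with hσ
    have hmem : ∀ p ∈ P.cone, ∀ q ∈ Q.cone, inl p + inr q ∈ Submodule.span ℝ σ := by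
      intro p hp q hq
      refine Submodule.subset_span ⟨?_, ?_⟩
      · rw [map_add, e1, e3, add_zero]; exact hp
      · rw [map_add, e2, e4, zero_add]; exact hq
    obtain ⟨p₀, hp₀⟩ := P.isCone.1
    obtain ⟨q₀, hq₀⟩ := Q.isCone.1
    have hl : ∀ x, inl x ∈ Submodule.span ℝ σ := by
      intro x
      have hx : x ∈ Submodule.span ℝ P.cone := by rw [P.full]; trivial
      refine Submodule.span_induction (fun p hp => ?_) ?_ ?_ ?_ hx
      · have := Submodule.sub_mem _ (hmem _ (hscale P.isCone p hp) q₀ hq₀) (hmem p hp q₀ hq₀)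
        rw [map_smul, two_smul] at this
        simpa using this
      · rw [map_zero]; exact Submodule.zero_mem _
      · intro a b _ _ ha hb; rw [map_add]; exact Submodule.add_mem _ ha hb
      · intro c a _ ha; rw [map_smul]; exact Submodule.smul_mem _ _ ha
    have hr : ∀ x, inr x ∈ Submodule.span ℝ σ := by
      intro x
      have hx : x ∈ Submodule.span ℝ Q.cone := by rw [Q.full]; trivial
      refine Submodule.span_induction (fun q hq => ?_) ?_ ?_ ?_ hx
      · have := Submodule.sub_mem _ (hmem p₀ hp₀ _ (hscale' Q.isCone q hq)) (hmem p₀ hp₀ q hq)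
        rw [map_smul, two_smul] at this
        simpa using this
      · rw [map_zero]; exact Submodule.zero_mem _
      · intro a b _ _ ha hb; rw [map_add]; exact Submodule.add_mem _ ha hb
      · intro c a _ ha; rw [map_smul]; exact Submodule.smul_mem _ _ ha
    rw [eq_top_iff]
    rintro x -
    rw [← e5 x]
    exact Submodule.add_mem _ (hl _) (hr _)

/-- The positive orthant `ℝ_{>0}^I` with the lattice `ℤ^I`. -/
noncomputable def posOrthant (I : Type u) [Finite I] : Poic.{u} where
  N := I → ℤ
  cone := {x | ∀ i, 0 < realFunctional (LinearMap.proj i) x}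
  isCone := by
    refine ⟨⟨1 ⊗ₜ 1, fun i => by simp⟩, ∅, Set.range fun i => LinearMap.proj i, Set.finite_empty,
      Set.finite_range _, ?_⟩
    ext x; simp
  full := by
    refine span_eq_top_of_sub fun n => ?_
    refine ⟨fun i => |n i| + 1 + n i, fun i => |n i| + 1, by ext i; simp, fun i => ?_, fun i => ?_⟩
    · rw [realFunctional_tmul, mul_one]
      have := neg_abs_le (n i)
      exact_mod_cast (show 0 < |n i| + 1 + n i by omega)
    · rw [realFunctional_tmul, mul_one]
      have := abs_nonneg (n i)
      exact_mod_cast (show 0 < |n i| + 1 by omega)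

theorem baseChange_fst_prodMap {N N' M : Type*} [AddCommGroup N] [AddCommGroup N']
    [AddCommGroup M] (f : N →ₗ[ℤ] N') (x : ℝ ⊗[ℤ] (N × M)) :
    (LinearMap.fst ℤ N' M).baseChange ℝ
      ((f.prodMap (LinearMap.id : M →ₗ[ℤ] M)).baseChange ℝ x) =
    f.baseChange ℝ ((LinearMap.fst ℤ N M).baseChange ℝ x) := by
  rw [← LinearMap.comp_apply, ← LinearMap.baseChange_comp, ← LinearMap.comp_apply,
    ← LinearMap.baseChange_comp]
  rfl

theorem baseChange_snd_prodMap {N N' M : Type*} [AddCommGroup N] [AddCommGroup N']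
    [AddCommGroup M] (f : N →ₗ[ℤ] N') (x : ℝ ⊗[ℤ] (N × M)) :
    (LinearMap.snd ℤ N' M).baseChange ℝ
      ((f.prodMap (LinearMap.id : M →ₗ[ℤ] M)).baseChange ℝ x) =
    (LinearMap.snd ℤ N M).baseChange ℝ x := by
  rw [← LinearMap.comp_apply, ← LinearMap.baseChange_comp]
  rfl

/-- The product of a functor to poics with a fixed poic `Q`: an object `c` is mapped to `Φ c × Q`
and a morphism `f` to `Φ f × id`. -/
noncomputable def prodRight {C : Type*} [Category* C] (Φ : C ⥤ Poic.{u}) (Q : Poic.{v}) :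
    C ⥤ Poic.{max u v} where
  obj c := (Φ.obj c).prod Q
  map f := ⟨(Φ.map f).lin.prodMap LinearMap.id, fun x hx => ⟨by
    have h := baseChange_fst_prodMap (M := Q.N) (Φ.map f).lin x
    exact Set.mem_of_eq_of_mem h ((Φ.map f).mapsTo hx.1), by
    have h := baseChange_snd_prodMap (M := Q.N) (Φ.map f).lin x
    exact Set.mem_of_eq_of_mem h hx.2⟩⟩
  map_id c := by
    apply Poic.Hom.ext
    rw [CategoryTheory.Functor.map_id]
    exact LinearMap.prodMap_id
  map_comp f f' := by
    apply Poic.Hom.ext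
    rw [CategoryTheory.Functor.map_comp]
    rfl

/-- The poic `(N_ℝ, N)` of a free abelian group of finite rank. -/
def ofLattice (N : Type u) [AddCommGroup N] [Module.Free ℤ N] [Module.Finite ℤ N] : Poic.{u} where
  N := N
  cone := Set.univ
  isCone := ⟨⟨0, trivial⟩, ∅, ∅, Set.finite_empty, Set.finite_empty, by simp⟩
  full := Submodule.span_univ

end Poic

/-! ### Poic-complexes, poic-spaces and poic-fibrations -/

section Complexes

/-- A category is essentially finite if it is equivalent to a category with finitely many
objects. -/
def EssentiallyFinite (C : Type u) [Category.{v} C] : Prop :=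
  ∃ (D : Type) (_ : Category.{v} D), Finite D ∧ Nonempty (C ≌ D)

variable {C : Type v} [Category.{w} C] {D : Type v} [Category.{w} D]

/-- The two conditions on face relations that poic-complexes and poic-spaces have in common:
morphisms are mapped to face-embeddings, and every face of a cone `Φ q` is the image of a morphism
`p ⟶ q` that is unique up to isomorphism over `q`. -/
structure HasFaces (Φ : C ⥤ Poic.{u}) : Prop where
  faceEmbedding : ∀ {p q : C} (f : p ⟶ q), Poic.IsFaceEmbedding (Φ.map f)
  exists_face : ∀ (q : C) (τ : Set (ℝ ⊗[ℤ] (Φ.obj q).N)), IsFace τ (Φ.obj q).cone →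
    ∃ (p : C) (f : p ⟶ q), (Φ.map f).lin.baseChange ℝ '' (Φ.obj p).cone = τ
  unique_face : ∀ {p p' q : C} (f : p ⟶ q) (f' : p' ⟶ q),
    (Φ.map f).lin.baseChange ℝ '' (Φ.obj p).cone =
      (Φ.map f').lin.baseChange ℝ '' (Φ.obj p').cone → ∃ k : p ≅ p', k.hom ≫ f' = f

/-- A poic-complex: a functor to poics from an essentially finite thin category, with the above
conditions on face relations. -/
structure IsPoicComplex (Φ : C ⥤ Poic.{u}) : Prop extends HasFaces Φ where
  thin : Quiver.IsThin C
  essentiallyFinite : EssentiallyFinite C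

/-- A poic-space: a functor to poics from an essentially finite category with finite hom-sets, with
the above conditions on face relations. -/
structure IsPoicSpace (X : C ⥤ Poic.{u}) : Prop extends HasFaces X where
  finite_hom : ∀ x y : C, Finite (x ⟶ y)
  essentiallyFinite : EssentiallyFinite C

/-- The functor `F` and the natural transformation `η` form a morphism of poic-complexes (or of
poic-spaces): no cone is mapped into a proper face. -/
def IsPoicMorphism {C : Type*} [Category* C] {D : Type*} [Category* D] (Φ : C ⥤ Poic.{u})
    (Ψ : D ⥤ Poic.{u}) (F : C ⥤ D) (η : Φ ⟶ F ⋙ Ψ) : Prop :=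
  ∀ (p : C) (τ : Set (ℝ ⊗[ℤ] (Ψ.obj (F.obj p)).N)), IsFace τ (Ψ.obj (F.obj p)).cone →
    (η.app p).lin.baseChange ℝ '' (Φ.obj p).cone ⊆ τ → τ = (Ψ.obj (F.obj p)).cone

/-- The poic-complex with the single cone `(N_ℝ, N)`. -/
noncomputable def latticeComplex (N : Type u) [AddCommGroup N] [Module.Free ℤ N] [Module.Finite ℤ N] :
    Discrete PUnit.{1} ⥤ Poic.{u} :=
  Functor.fromPUnit (Poic.ofLattice N)

/-- `(Φ, X)` is a linear poic-complex: `Φ` is a poic-complex and `X` is a morphism from `Φ` to the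
poic-complex `(N_ℝ, N)` of a free abelian group of finite rank. -/
structure IsLinearPoicComplex (Φ : C ⥤ Poic.{u}) (N : Type u) [AddCommGroup N] [Module.Free ℤ N]
    [Module.Finite ℤ N] (X : Φ ⟶ Functor.star C ⋙ latticeComplex N) : Prop where
  isPoicComplex : IsPoicComplex Φ
  isPoicMorphism : IsPoicMorphism Φ (latticeComplex N) (Functor.star C) X

/-- `(π, η)` is a poic-fibration from the poic-complex `Φ` to the poic-space `X`. -/
structure IsPoicFibration (Φ : C ⥤ Poic.{u}) (X : D ⥤ Poic.{u}) (π : C ⥤ D) (η : Φ ⟶ π ⋙ X) :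
    Prop where
  isPoicComplex : IsPoicComplex Φ
  isPoicSpace : IsPoicSpace X
  isPoicMorphism : IsPoicMorphism Φ X π η
  essSurj : π.EssSurj
  interior : ∀ p : C, Poic.IsIsoOnInterior (η.app p)
  exists_lift : ∀ (p : C) (x : D) (f : π.obj p ⟶ x),
    ∃ (q : C) (h : p ⟶ q) (k : π.obj q ≅ x), f = π.map h ≫ k.hom
  /-- the lift is unique up to an isomorphism under `p` and over `x` -/
  unique_lift : ∀ (p : C) (x : D) (f : π.obj p ⟶ x)
    (q : C) (h : p ⟶ q) (k : π.obj q ≅ x) (q' : C) (h' : p ⟶ q') (k' : π.obj q' ≅ x),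
    f = π.map h ≫ k.hom → f = π.map h' ≫ k'.hom →
      ∃ i : q ≅ q', h ≫ i.hom = h' ∧ π.map i.hom ≫ k'.hom = k.hom

/-- `(π, η)` is a linear poic-fibration from the linear poic-complex `(Φ, L)` to the poic-space
`X`. -/
structure IsLinearPoicFibration (Φ : C ⥤ Poic.{u}) (N : Type u) [AddCommGroup N]
    [Module.Free ℤ N] [Module.Finite ℤ N] (L : Φ ⟶ Functor.star C ⋙ latticeComplex N)
    (X : D ⥤ Poic.{u}) (π : C ⥤ D) (η : Φ ⟶ π ⋙ X) : Prop where
  isLinearPoicComplex : IsLinearPoicComplex Φ N L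
  isPoicFibration : IsPoicFibration Φ X π η

end Complexes

/-! ### Discrete graphs -/

/-- A discrete graph (possibly with legs): a finite set of flags `F` with an idempotent root map
`r` and an involution `ι` such that `ι ∘ r = r`. -/
structure DiscreteGraph where
  F : Type u
  [finite : Finite F]
  r : F → F
  ι : F → F
  r_r : ∀ h, r (r h) = r h
  ι_ι : ∀ h, ι (ι h) = h
  ι_r : ∀ h, ι (r h) = r h

attribute [instance] DiscreteGraph.finite

namespace DiscreteGraph

/-- The vertices: the image of the root map. The other flags are the half-edges. -/
def V (G : DiscreteGraph.{u}) : Set G.F := Set.range G.r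

/-- The legs: the `ι`-orbits of size one among the half-edges (a leg is identified with its
unique element). -/
def legs (G : DiscreteGraph.{u}) : Set G.F := {h | h ∉ G.V ∧ G.ι h = h}

/-- The edges: the `ι`-orbits `{h, ι h}` of size two among the half-edges. -/
def edges (G : DiscreteGraph.{u}) : Set (Sym2 G.F) :=
  {e | ∃ h, h ∉ G.V ∧ G.ι h ≠ h ∧ e = s(h, G.ι h)}

/-- `G.Joined B v w`: one can walk from `v` to `w` along flags of `B`, the flag `h` leading from
`r h` to `r (ι h)`. (Only flags belonging to edges lead from a vertex to a different one.) -/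
def Joined (G : DiscreteGraph.{u}) (B : Set G.F) : G.F → G.F → Prop :=
  Relation.ReflTransGen fun v w => ∃ h ∈ B, G.r h = v ∧ G.r (G.ι h) = w

/-- Any two vertices are joined by a sequence of edges. -/
def Connected (G : DiscreteGraph.{u}) : Prop := ∀ v ∈ G.V, ∀ w ∈ G.V, G.Joined Set.univ v w

/-- The genus `#E - #V + 1`. -/
noncomputable def genus (G : DiscreteGraph.{u}) : ℤ := G.edges.ncard - G.V.ncard + 1

/-- The valency of a vertex: the number of half-edges rooted at it. -/
noncomputable def val (G : DiscreteGraph.{u}) (v : G.F) : ℕ := (G.r ⁻¹' {v}).ncard - 1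

/-- A tree is a connected graph of genus zero. -/
def IsTree (G : DiscreteGraph.{u}) : Prop := G.Connected ∧ G.genus = 0

/-- The subgraph on a set of flags that is stable under the root map and the involution. -/
abbrev sub (G : DiscreteGraph.{u}) (S : Set G.F) (hr : ∀ h ∈ S, G.r h ∈ S)
    (hι : ∀ h ∈ S, G.ι h ∈ S) : DiscreteGraph.{u} where
  F := S
  r h := ⟨G.r h, hr _ h.2⟩
  ι h := ⟨G.ι h, hι _ h.2⟩
  r_r h := Subtype.ext (G.r_r h)
  ι_ι h := Subtype.ext (G.ι_ι h)
  ι_r h := Subtype.ext (G.ι_r h)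

/-- The set of flags `S` defines a subgraph of `G`, and this subgraph is a legless tree. -/
def IsLeglessTreeSet (G : DiscreteGraph.{u}) (S : Set G.F) : Prop :=
  ∃ (hr : ∀ h ∈ S, G.r h ∈ S) (hι : ∀ h ∈ S, G.ι h ∈ S),
    (G.sub S hr hι).legs = ∅ ∧ (G.sub S hr hι).IsTree

/-- The flags of the connected component of the vertex `v` in the subgraph of `G` that consists of
all vertices and of the edges in `Z`. -/
def component (G : DiscreteGraph.{u}) (Z : Set (Sym2 G.F)) (v : G.F) : Set G.F :=
  {h | (h ∈ G.V ∨ s(h, G.ι h) ∈ Z) ∧ G.Joined {k | s(k, G.ι k) ∈ Z} v (G.r h)}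

/-- `Z` is the edge set of a legless subgraph of `G` all of whose connected components are trees
(vertices that are not incident to `Z` are components that consist of a single vertex). -/
def IsForest (G : DiscreteGraph.{u}) (Z : Set (Sym2 G.F)) : Prop :=
  Z ⊆ G.edges ∧ ∀ v ∈ G.V, G.IsLeglessTreeSet (G.component Z v)

/-! ### Basic facts -/

theorem mem_V_iff {G : DiscreteGraph.{u}} {h : G.F} : h ∈ G.V ↔ G.r h = h :=
  ⟨by rintro ⟨k, rfl⟩; exact G.r_r k, fun e => ⟨h, e⟩⟩

theorem r_mem_V (G : DiscreteGraph.{u}) (h : G.F) : G.r h ∈ G.V := ⟨h, rfl⟩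

theorem ι_of_mem_V {G : DiscreteGraph.{u}} {h : G.F} (hh : h ∈ G.V) : G.ι h = h := by
  obtain ⟨k, rfl⟩ := hh; exact G.ι_r k

theorem mk_mem_edges {G : DiscreteGraph.{u}} {h : G.F} : s(h, G.ι h) ∈ G.edges ↔ G.ι h ≠ h := by
  constructor
  · rintro ⟨k, hk, hne, e⟩
    rcases Sym2.eq_iff.1 e with ⟨rfl, _⟩ | ⟨rfl, h2⟩
    · exact hne
    · rw [G.ι_ι]; exact hne.symm
  · intro hne
    exact ⟨h, fun hV => hne (ι_of_mem_V hV), hne, rfl⟩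

theorem mem_edges_iff {G : DiscreteGraph.{u}} {e : Sym2 G.F} :
    e ∈ G.edges ↔ ∃ h, G.ι h ≠ h ∧ e = s(h, G.ι h) :=
  ⟨fun ⟨h, _, hne, e⟩ => ⟨h, hne, e⟩, fun ⟨_, hne, e⟩ => e ▸ mk_mem_edges.2 hne⟩

theorem ncard_ι_ne (G : DiscreteGraph.{u}) : {h | G.ι h ≠ h}.ncard = 2 * G.edges.ncard := by
  classical
  have := Fintype.ofFinite G.F
  rw [Set.ncard_eq_toFinset_card', Set.ncard_eq_toFinset_card']
  rw [Finset.card_eq_sum_card_fiberwise (f := fun h => s(h, G.ι h)) (t := G.edges.toFinset)]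
  · rw [Finset.sum_const_nat (m := 2), mul_comm]
    intro e he
    obtain ⟨h, hne, rfl⟩ := mem_edges_iff.1 (Set.mem_toFinset.1 he)
    have : (({h | G.ι h ≠ h} : Set G.F).toFinset.filter fun k => s(k, G.ι k) = s(h, G.ι h))
        = {h, G.ι h} := by
      ext k
      simp only [Finset.mem_filter, Set.mem_toFinset, Set.mem_ofPred_eq, Finset.mem_insert,
        Finset.mem_singleton, Sym2.eq_iff]
      constructor
      · rintro ⟨_, ⟨h1, _⟩ | ⟨h1, _⟩⟩ <;> simp [h1]
      · rintro (rfl | rfl)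
        · exact ⟨hne, Or.inl ⟨rfl, rfl⟩⟩
        · rw [G.ι_ι]; exact ⟨hne.symm, Or.inr ⟨rfl, rfl⟩⟩
    rw [this, Finset.card_pair hne.symm]
  · intro h hh
    simp only [Set.coe_toFinset, Set.mem_ofPred_eq] at hh ⊢
    exact mk_mem_edges.2 hh

theorem card_flags (G : DiscreteGraph.{u}) :
    Nat.card G.F = G.V.ncard + G.legs.ncard + 2 * G.edges.ncard := by
  rw [← ncard_ι_ne, ← Set.ncard_univ, ← Set.ncard_union_eq, ← Set.ncard_union_eq]
  · congr 1
    ext h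
    simp only [Set.mem_univ, legs, Set.mem_union, Set.mem_ofPred_eq, true_iff]
    tauto
  · rw [Set.disjoint_left]
    rintro h (hV | hL) hne
    · exact hne (ι_of_mem_V hV)
    · exact hne hL.2
  · rw [Set.disjoint_left]
    exact fun h hV hL => hL.1 hV

theorem Joined.symm {G : DiscreteGraph.{u}} {B : Set G.F} (hB : ∀ h ∈ B, G.ι h ∈ B) {v w : G.F}
    (h : G.Joined B v w) : G.Joined B w v := by
  induction h with
  | refl => exact .refl
  | tail _ h2 ih =>
    obtain ⟨k, hk, rfl, rfl⟩ := h2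
    exact .head ⟨G.ι k, hB k hk, rfl, by rw [G.ι_ι]⟩ ih

theorem Joined.mono {G : DiscreteGraph.{u}} {B C : Set G.F} (hBC : B ⊆ C) {v w : G.F}
    (h : G.Joined B v w) : G.Joined C v w :=
  Relation.ReflTransGen.mono (fun _ _ ⟨k, hk, h1⟩ => ⟨k, hBC hk, h1⟩) _ _ h

/-- Flag count characterising the sets of flags of legless subtrees. -/
theorem isLeglessTreeSet_iff {G : DiscreteGraph.{u}} {S : Set G.F} :
    G.IsLeglessTreeSet S ↔ (∀ h ∈ S, G.r h ∈ S) ∧ (∀ h ∈ S, G.ι h ∈ S) ∧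
      (∀ h ∈ S, G.ι h = h → h ∈ G.V) ∧ (∀ v ∈ S ∩ G.V, ∀ w ∈ S ∩ G.V, G.Joined S v w) ∧
      S.ncard + 2 = 3 * (S ∩ G.V).ncard := by
  have key : ∀ (hr : ∀ h ∈ S, G.r h ∈ S) (hι : ∀ h ∈ S, G.ι h ∈ S),
      (G.sub S hr hι).legs = ∅ ∧ (G.sub S hr hι).IsTree ↔
      (∀ h ∈ S, G.ι h = h → h ∈ G.V) ∧ (∀ v ∈ S ∩ G.V, ∀ w ∈ S ∩ G.V, G.Joined S v w) ∧
      S.ncard + 2 = 3 * (S ∩ G.V).ncard := by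
    intro hr hι
    have hV : ∀ x : S, x ∈ (G.sub S hr hι).V ↔ (x : G.F) ∈ G.V := fun x => by
      rw [mem_V_iff, mem_V_iff]; exact Subtype.ext_iff
    have hVc : (G.sub S hr hι).V.ncard = (S ∩ G.V).ncard := by
      rw [← Set.ncard_image_of_injective _ (Subtype.val_injective (p := (· ∈ S)))]
      congr 1
      ext x
      constructor
      · rintro ⟨y, hy, rfl⟩; exact ⟨y.2, (hV y).1 hy⟩
      · rintro ⟨h1, h2⟩; exact ⟨⟨x, h1⟩, (hV _).2 h2, rfl⟩
    have hc : (G.sub S hr hι).Connected ↔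
        ∀ v ∈ S ∩ G.V, ∀ w ∈ S ∩ G.V, G.Joined S v w := by
      constructor
      · intro h v hv w hw
        have := h ⟨v, hv.1⟩ ((hV _).2 hv.2) ⟨w, hw.1⟩ ((hV _).2 hw.2)
        exact Relation.ReflTransGen.lift (Subtype.val : S → G.F)
          (by rintro a b ⟨k, -, rfl, rfl⟩; exact ⟨k, k.2, rfl, rfl⟩) _ _ this
      · intro h v hv w hw
        have h1 := h v ⟨v.2, (hV _).1 hv⟩ w ⟨w.2, (hV _).1 hw⟩
        have h2 : ∀ b : G.F, G.Joined S v b → ∃ hb : b ∈ S,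
            (G.sub S hr hι).Joined Set.univ v ⟨b, hb⟩ := by
          intro b hb
          induction hb with
          | refl => exact ⟨v.2, .refl⟩
          | tail _ h2 ih =>
            obtain ⟨k, hk, rfl, rfl⟩ := h2
            obtain ⟨h3, h4⟩ := ih
            exact ⟨hr _ (hι _ hk), h4.tail ⟨⟨k, hk⟩, trivial, rfl, rfl⟩⟩
        exact (h2 _ h1).2
    have hl : (G.sub S hr hι).legs = ∅ ↔ ∀ h ∈ S, G.ι h = h → h ∈ G.V := by
      rw [Set.eq_empty_iff_forall_notMem]
      constructor
      · intro h x hx hxi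
        by_contra hxV
        exact h ⟨x, hx⟩ ⟨fun hx' => hxV ((hV _).1 hx'), Subtype.ext hxi⟩
      · intro h x hx
        exact hx.1 ((hV _).2 (h x x.2 (Subtype.ext_iff.1 hx.2)))
    rw [IsTree, hc, ← hl]
    refine and_congr_right fun hl' => and_congr_right fun _ => ?_
    have := card_flags (G.sub S hr hι)
    rw [hl', Set.ncard_empty, hVc] at this
    have h2 : Nat.card (G.sub S hr hι).F = S.ncard := rfl
    rw [h2] at this
    rw [genus, hVc]
    omega
  constructor
  · rintro ⟨hr, hι, h⟩
    exact ⟨hr, hι, (key hr hι).1 h⟩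
  · rintro ⟨hr, hι, h⟩
    exact ⟨hr, hι, (key hr hι).2 h⟩


/-- A contraction of discrete graphs: a map of graphs (a map of flags commuting with the root maps
and the involutions) such that the preimage of every vertex is a legless tree, and the preimage of
every edge or leg is a single edge or leg (equivalently, every half-edge has exactly one
preimage). -/
structure IsContraction {G H : DiscreteGraph.{u}} (f : G.F → H.F) : Prop where
  map_r : ∀ h, f (G.r h) = H.r (f h)
  map_ι : ∀ h, f (G.ι h) = H.ι (f h)
  fiber_tree : ∀ v ∈ H.V, G.IsLeglessTreeSet (f ⁻¹' {v})
  fiber_half : ∀ h ∉ H.V, ∃! k, f k = h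

namespace IsContraction

variable {G H K : DiscreteGraph.{u}} {f : G.F → H.F}

theorem map_V (hf : IsContraction f) {h : G.F} (hh : h ∈ G.V) : f h ∈ H.V := by
  rw [mem_V_iff] at hh ⊢; rw [← hf.map_r, hh]

theorem joined_of_fiber (hf : IsContraction f) {a b : G.F} (ha : a ∈ G.V) (hb : b ∈ G.V)
    (hab : f a = f b) : G.Joined (f ⁻¹' {f a}) a b :=
  (isLeglessTreeSet_iff.1 (hf.fiber_tree (f a) (hf.map_V ha))).2.2.2.1 a ⟨rfl, ha⟩ b
    ⟨hab.symm, hb⟩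

theorem joined_lift (hf : IsContraction f) {B W : Set H.F} {B' : Set G.F} {a : G.F}
    (ha : a ∈ G.V) (haW : f a ∈ W) (hBW : ∀ h ∈ B, H.r (H.ι h) ∈ W)
    (hB : f ⁻¹' B ⊆ B') (hW : f ⁻¹' W ⊆ B') {y : H.F} (h : H.Joined B (f a) y) :
    ∀ b ∈ G.V, f b = y → G.Joined B' a b := by
  induction h with
  | refl =>
    intro b hb hab
    refine (hf.joined_of_fiber ha hb hab.symm).mono fun k hk => hW ?_
    rw [Set.mem_preimage, show f k = f a from hk]; exact haW
  | tail _ h2 ih =>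
    obtain ⟨h, hh, rfl, rfl⟩ := h2
    intro b hb hfb
    by_cases hV : h ∈ H.V
    · rw [ι_of_mem_V hV] at hfb
      exact ih b hb hfb
    · obtain ⟨k, rfl, -⟩ := hf.fiber_half h hV
      have h1 := ih (G.r k) (G.r_mem_V k) (hf.map_r k)
      have h3 : f (G.r (G.ι k)) = f b := by rw [hf.map_r, hf.map_ι, hfb]
      refine (h1.tail ⟨k, hB hh, rfl, rfl⟩).trans
        ((hf.joined_of_fiber (G.r_mem_V _) hb h3).mono fun l hl => hW ?_)
      rw [Set.mem_preimage, show f l = _ from hl, h3, hfb]; exact hBW _ hh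

theorem joined_map (hf : IsContraction f) {B : Set G.F} {B' : Set H.F} (hB : ∀ h ∈ B, f h ∈ B')
    {v w : G.F} (h : G.Joined B v w) : H.Joined B' (f v) (f w) :=
  Relation.ReflTransGen.lift f (by
    rintro a b ⟨k, hk, rfl, rfl⟩
    exact ⟨f k, hB k hk, (hf.map_r k).symm, by rw [hf.map_r, hf.map_ι]⟩) _ _ h

theorem mem_V_of_map (hf : IsContraction f) {h : G.F} (hι : G.ι h = h) (hV : f h ∈ H.V) :
    h ∈ G.V :=
  (isLeglessTreeSet_iff.1 (hf.fiber_tree (f h) hV)).2.2.1 h rfl hι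

theorem injOn (hf : IsContraction f) {h k : G.F} (hV : f h ∉ H.V) (e : f h = f k) : h = k := by
  obtain ⟨l, _, hl⟩ := hf.fiber_half (f h) hV
  rw [hl h rfl, hl k e.symm]

/-- The preimage of a legless subtree under a contraction is a legless subtree. -/
theorem preimage_tree (hf : IsContraction f) {T : Set H.F} (hT : H.IsLeglessTreeSet T) :
    G.IsLeglessTreeSet (f ⁻¹' T) := by
  classical
  rw [isLeglessTreeSet_iff] at hT ⊢
  obtain ⟨h1, h2, h3, h4, h5⟩ := hT
  refine ⟨fun h hh => ?_, fun h hh => ?_, fun h hh hι => ?_, fun v hv w hw => ?_, ?_⟩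
  · rw [Set.mem_preimage, hf.map_r]; exact h1 _ hh
  · rw [Set.mem_preimage, hf.map_ι]; exact h2 _ hh
  · exact hf.mem_V_of_map hι (h3 _ hh (by rw [← hf.map_ι, hι]))
  · exact hf.joined_lift (B := T) (W := T) hv.2 hv.1 (fun h hh => h1 _ (h2 _ hh)) subset_rfl
      subset_rfl (h4 _ ⟨hv.1, hf.map_V hv.2⟩ _ ⟨hw.1, hf.map_V hw.2⟩) w hw.2 rfl
  · have := Fintype.ofFinite G.F
    have := Fintype.ofFinite H.F
    have e1 : (f ⁻¹' T).ncard = ∑ x ∈ T.toFinset, (f ⁻¹' {x}).ncard := by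
      rw [Set.ncard_eq_toFinset_card',
        Finset.card_eq_sum_card_fiberwise (f := f) (t := T.toFinset)]
      · refine Finset.sum_congr rfl fun x hx => ?_
        rw [Set.ncard_eq_toFinset_card']
        congr 1
        ext k
        simp only [Finset.mem_filter, Set.mem_toFinset, Set.mem_preimage, Set.mem_singleton_iff]
        exact ⟨fun h => h.2, fun h => ⟨h ▸ Set.mem_toFinset.1 hx, h⟩⟩
      · intro k hk; simpa using hk
    have e2 : (f ⁻¹' T ∩ G.V).ncard =
        ∑ x ∈ (T ∩ H.V).toFinset, (f ⁻¹' {x} ∩ G.V).ncard := by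
      rw [Set.ncard_eq_toFinset_card',
        Finset.card_eq_sum_card_fiberwise (f := f) (t := (T ∩ H.V).toFinset)]
      · refine Finset.sum_congr rfl fun x hx => ?_
        rw [Set.ncard_eq_toFinset_card']
        congr 1
        ext k
        simp only [Finset.mem_filter, Set.mem_toFinset, Set.mem_preimage, Set.mem_singleton_iff,
          Set.mem_inter_iff]
        exact ⟨fun h => ⟨h.2, h.1.2⟩, fun h => ⟨⟨h.1 ▸ (Set.mem_toFinset.1 hx).1, h.2⟩, h.1⟩⟩
      · intro k hk
        simp only [Set.coe_toFinset, Set.mem_inter_iff, Set.mem_preimage] at hk ⊢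
        exact ⟨hk.1, hf.map_V hk.2⟩
    have e3 : ∑ x ∈ T.toFinset, (f ⁻¹' {x}).ncard =
        ∑ x ∈ (T ∩ H.V).toFinset, (f ⁻¹' {x}).ncard + (T \ H.V).ncard := by
      have : T.toFinset = (T ∩ H.V).toFinset ∪ (T \ H.V).toFinset := by
        ext x; simp only [Set.mem_toFinset, Finset.mem_union, Set.mem_inter_iff, Set.mem_sdiff]
        tauto
      rw [this, Finset.sum_union, Set.ncard_eq_toFinset_card' (T \ H.V), Finset.card_eq_sum_ones]
      · congr 1
        refine Finset.sum_congr rfl fun x hx => ?_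
        obtain ⟨k, hk, hk2⟩ := hf.fiber_half x (Set.mem_toFinset.1 hx).2
        rw [Set.ncard_eq_one]
        exact ⟨k, by ext l; exact ⟨fun h => hk2 l h, fun h => by rw [show l = k from h]; exact hk⟩⟩
      · rw [Finset.disjoint_left]
        intro x hx hx'
        exact (Set.mem_toFinset.1 hx').2 (Set.mem_toFinset.1 hx).2
    have e4 : ∑ x ∈ (T ∩ H.V).toFinset, (f ⁻¹' {x}).ncard + 2 * (T ∩ H.V).ncard =
        3 * ∑ x ∈ (T ∩ H.V).toFinset, (f ⁻¹' {x} ∩ G.V).ncard := by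
      rw [Set.ncard_eq_toFinset_card' (T ∩ H.V), mul_comm 2, ← smul_eq_mul (_ : ℕ) 2,
        ← Finset.sum_const, ← Finset.sum_add_distrib, Finset.mul_sum]
      refine Finset.sum_congr rfl fun x hx => ?_
      exact (isLeglessTreeSet_iff.1 (hf.fiber_tree x (Set.mem_toFinset.1 hx).2)).2.2.2.2
    have e5 : (T ∩ H.V).ncard + (T \ H.V).ncard = T.ncard := Set.ncard_inter_add_ncard_sdiff_eq_ncard T H.V
    omega

theorem id (G : DiscreteGraph.{u}) : IsContraction (G := G) (H := G) fun h => h where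
  map_r _ := rfl
  map_ι _ := rfl
  fiber_tree v hv := by
    rw [isLeglessTreeSet_iff]
    have h0 : ((fun h : G.F => h) ⁻¹' {v}) = {v} := rfl
    have h1 : ({v} : Set G.F) ∩ G.V = {v} := by
      ext x; simp only [Set.mem_inter_iff, Set.mem_singleton_iff]
      exact ⟨fun h => h.1, fun h => ⟨h, h ▸ hv⟩⟩
    rw [h0, h1]
    refine ⟨?_, ?_, ?_, ?_, ?_⟩
    · rintro h rfl; exact mem_V_iff.1 hv
    · rintro h rfl; exact ι_of_mem_V hv
    · rintro h rfl _; exact hv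
    · rintro a rfl b rfl; exact .refl
    · simp
  fiber_half h _ := ⟨h, rfl, fun _ => fun e => e⟩

theorem comp (hf : IsContraction f) {g : H.F → K.F} (hg : IsContraction g) :
    IsContraction fun h => g (f h) where
  map_r h := by rw [hf.map_r, hg.map_r]
  map_ι h := by rw [hf.map_ι, hg.map_ι]
  fiber_tree v hv := hf.preimage_tree (hg.fiber_tree v hv)
  fiber_half h hh := by
    obtain ⟨k, rfl, hk⟩ := hg.fiber_half h hh
    obtain ⟨l, rfl, hl⟩ := hf.fiber_half k fun hV => hh (hg.map_V hV)
    exact ⟨l, rfl, fun m hm => hl m (hk _ hm)⟩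

/-- The preimage of a forest, together with the contracted edges, is a forest. -/
theorem isForest_preimage (hf : IsContraction f) {Z : Set (Sym2 H.F)} (hZ : H.IsForest Z) :
    G.IsForest {e | e ∈ G.edges ∧ (Sym2.map f e ∈ H.edges → Sym2.map f e ∈ Z)} := by
  refine ⟨fun e he => he.1, fun v hv => ?_⟩
  have hZ' : ∀ h, s(h, G.ι h) ∈ {e | e ∈ G.edges ∧ (Sym2.map f e ∈ H.edges → Sym2.map f e ∈ Z)} ↔
      G.ι h ≠ h ∧ (f h ∈ H.V ∨ s(f h, H.ι (f h)) ∈ Z) := by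
    intro h
    rw [Set.mem_ofPred_eq, mk_mem_edges, Sym2.map_mk, hf.map_ι, mk_mem_edges]
    refine and_congr_right fun hne => ?_
    constructor
    · intro h1
      by_cases hV : f h ∈ H.V
      · exact Or.inl hV
      · refine Or.inr (h1 fun h2 => hne ?_)
        rw [← hf.map_ι] at h2
        exact (hf.injOn hV h2.symm).symm
    · rintro (h1 | h1) h2
      · exact absurd (ι_of_mem_V h1) h2
      · exact h1
  convert hf.preimage_tree (hZ.2 (f v) (hf.map_V hv)) using 1
  ext h
  have hc : (h ∈ G.V ∨ s(h, G.ι h) ∈ {e | e ∈ G.edges ∧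
      (Sym2.map f e ∈ H.edges → Sym2.map f e ∈ Z)}) ↔
      (f h ∈ H.V ∨ s(f h, H.ι (f h)) ∈ Z) := by
    rw [hZ']
    constructor
    · rintro (h1 | h1)
      · exact Or.inl (hf.map_V h1)
      · exact h1.2
    · intro h1
      by_cases hι : G.ι h = h
      · rcases h1 with h1 | h1
        · exact Or.inl (hf.mem_V_of_map hι h1)
        · have := hZ.1 h1
          rw [mk_mem_edges, ← hf.map_ι, hι] at this
          exact absurd rfl this
      · exact Or.inr ⟨hι, h1⟩
  have hj : G.Joined {k | s(k, G.ι k) ∈ {e | e ∈ G.edges ∧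
      (Sym2.map f e ∈ H.edges → Sym2.map f e ∈ Z)}} v (G.r h) ↔
      H.Joined {k | s(k, H.ι k) ∈ Z} (f v) (H.r (f h)) := by
    constructor
    · intro h1
      have h2 := hf.joined_map (B' := {k | k ∈ H.V ∨ s(k, H.ι k) ∈ Z})
        (fun k hk => ((hZ' k).1 hk).2) h1
      rw [hf.map_r] at h2
      generalize H.r (f h) = w at h2
      induction h2 with
      | refl => exact .refl
      | tail _ h3 ih =>
        obtain ⟨k, hk | hk, rfl, rfl⟩ := h3
        · rwa [ι_of_mem_V hk]
        · exact ih.tail ⟨k, hk, rfl, rfl⟩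
    · intro h1
      have h2 := hf.joined_lift (W := H.V)
        (B' := {k | k ∈ G.V ∨ s(k, G.ι k) ∈ {e | e ∈ G.edges ∧
          (Sym2.map f e ∈ H.edges → Sym2.map f e ∈ Z)}}) hv (hf.map_V hv)
        (fun _ _ => H.r_mem_V _) ?_ ?_ h1 (G.r h) (G.r_mem_V h) (hf.map_r h)
      · generalize G.r h = w at h2
        induction h2 with
        | refl => exact .refl
        | tail _ h3 ih =>
          obtain ⟨k, hk | hk, rfl, rfl⟩ := h3
          · rwa [ι_of_mem_V hk]
          · exact ih.tail ⟨k, hk, rfl, rfl⟩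
      · intro k hk
        refine Or.inr ((hZ' k).2 ⟨fun hι => ?_, Or.inr hk⟩)
        have := hZ.1 hk
        rw [mk_mem_edges, ← hf.map_ι, hι] at this
        exact this rfl
      · intro k hk
        by_cases hι : G.ι k = k
        · exact Or.inl (hf.mem_V_of_map hι hk)
        · exact Or.inr ((hZ' k).2 ⟨hι, Or.inl hk⟩)
  exact and_congr hc hj

end IsContraction

theorem three_mul_ncard_le {G : DiscreteGraph.{u}} {T : Set G.F} (hr : ∀ h ∈ T, G.r h ∈ T)
    (hι : ∀ h ∈ T, G.ι h ∈ T)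
    (hc : ∀ v ∈ T ∩ G.V, ∀ w ∈ T ∩ G.V, G.Joined T v w) (n : ℕ) :
    ∀ U ⊆ T ∩ G.V, U.Nonempty → ((T ∩ G.V) \ U).ncard = n →
      3 * n ≤ {h | h ∈ T ∧ ¬ (G.r h ∈ U ∧ G.r (G.ι h) ∈ U)}.ncard := by
  induction n with
  | zero => intros; omega
  | succ n ih =>
    intro U hU hne hn
    obtain ⟨u, hu⟩ := hne
    have hex : ∃ h ∈ T, G.r h ∈ U ∧ G.r (G.ι h) ∉ U := by
      by_contra hcon
      push Not at hcon
      have h1 : (T ∩ G.V) \ U = ∅ := by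
        rw [Set.eq_empty_iff_forall_notMem]
        rintro w ⟨hw, hwU⟩
        apply hwU
        have h2 := hc u (hU hu) w hw
        clear hw hwU
        induction h2 with
        | refl => exact hu
        | tail _ h3 ih3 =>
          obtain ⟨k, hk, rfl, rfl⟩ := h3
          exact hcon k hk ih3
      rw [h1, Set.ncard_empty] at hn
      omega
    obtain ⟨h, hT, hU1, hU2⟩ := hex
    set w := G.r (G.ι h) with hw
    have hwT : w ∈ T ∩ G.V := ⟨hr _ (hι _ hT), G.r_mem_V _⟩
    have h1 := ih (insert w U) (Set.insert_subset hwT hU) ⟨u, Or.inr hu⟩ (by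
      have : (T ∩ G.V) \ insert w U = ((T ∩ G.V) \ U) \ {w} := by
        ext x; simp only [Set.mem_sdiff, Set.mem_insert_iff, Set.mem_singleton_iff]; tauto
      have h2 := Set.ncard_sdiff_singleton_of_mem (show w ∈ (T ∩ G.V) \ U from ⟨hwT, hU2⟩)
      rw [this]; omega)
    have hιh : G.ι h ≠ h := fun e => hU2 (by rw [hw, e]; exact hU1)
    have hhw : h ≠ w := fun e => hιh (ι_of_mem_V (e ▸ G.r_mem_V _))
    have hιw : G.ι h ≠ w := fun e => by
      have h2 := ι_of_mem_V (G := G) (h := G.ι h) (e ▸ G.r_mem_V _)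
      rw [G.ι_ι] at h2
      exact hιh h2.symm
    have hrw : G.r w = w := mem_V_iff.1 hwT.2
    have hιw' : G.ι w = w := ι_of_mem_V hwT.2
    have h3 : {h | h ∈ T ∧ ¬ (G.r h ∈ insert w U ∧ G.r (G.ι h) ∈ insert w U)} ∪ {h, G.ι h, w} ⊆
        {h | h ∈ T ∧ ¬ (G.r h ∈ U ∧ G.r (G.ι h) ∈ U)} := by
      rintro k (⟨hk, hk2⟩ | rfl | rfl | rfl)
      · exact ⟨hk, fun h4 => hk2 ⟨Or.inr h4.1, Or.inr h4.2⟩⟩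
      · exact ⟨hT, fun h4 => hU2 h4.2⟩
      · exact ⟨hι _ hT, fun h4 => hU2 h4.1⟩
      · exact ⟨hwT.1, fun h4 => hU2 (hrw ▸ h4.1)⟩
    have h4 : Disjoint {h | h ∈ T ∧ ¬ (G.r h ∈ insert w U ∧ G.r (G.ι h) ∈ insert w U)}
        {h, G.ι h, w} := by
      rw [Set.disjoint_left]
      rintro k ⟨_, hk⟩ (rfl | rfl | rfl)
      · exact hk ⟨Or.inr hU1, Or.inl rfl⟩
      · exact hk ⟨Or.inl rfl, Or.inr (by rw [G.ι_ι]; exact hU1)⟩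
      · exact hk ⟨Or.inl hrw, Or.inl (by rw [hιw', hrw])⟩
    have h5 := Set.ncard_le_ncard h3
    rw [Set.ncard_union_eq h4] at h5
    have h6 : ({h, G.ι h, w} : Set G.F).ncard = 3 := by
      rw [Set.ncard_eq_three]; exact ⟨h, G.ι h, w, hιh.symm, hhw, hιw, rfl⟩
    omega

/-- A connected subgraph of a legless tree is a tree. -/
theorem IsLeglessTreeSet.of_subset {G : DiscreteGraph.{u}} {S T : Set G.F}
    (hT : G.IsLeglessTreeSet T) (hST : S ⊆ T) (hne : S.Nonempty)
    (hr : ∀ h ∈ S, G.r h ∈ S) (hι : ∀ h ∈ S, G.ι h ∈ S)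
    (hc : ∀ v ∈ S ∩ G.V, ∀ w ∈ S ∩ G.V, G.Joined S v w) : G.IsLeglessTreeSet S := by
  rw [isLeglessTreeSet_iff] at hT ⊢
  obtain ⟨h1, h2, h3, h4, h5⟩ := hT
  refine ⟨hr, hι, fun h hh => h3 h (hST hh), hc, ?_⟩
  obtain ⟨s, hs⟩ := hne
  have hv : G.r s ∈ S ∩ G.V := ⟨hr s hs, G.r_mem_V s⟩
  have a1 := three_mul_ncard_le h1 h2 h4 _ (S ∩ G.V) (Set.inter_subset_inter_left _ hST)
    ⟨_, hv⟩ rfl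
  have a2 := three_mul_ncard_le hr hι hc _ {G.r s} (Set.singleton_subset_iff.2 hv)
    (Set.singleton_nonempty _) rfl
  rw [Set.ncard_sdiff_singleton_of_mem hv] at a2
  have a3 := Set.ncard_sdiff_add_ncard_of_subset (Set.inter_subset_inter_left G.V hST)
  have a4 : Disjoint {h | h ∈ T ∧ ¬ (G.r h ∈ S ∩ G.V ∧ G.r (G.ι h) ∈ S ∩ G.V)} S := by
    rw [Set.disjoint_left]
    rintro k ⟨_, hk⟩ hkS
    exact hk ⟨⟨hr _ hkS, G.r_mem_V _⟩, ⟨hr _ (hι _ hkS), G.r_mem_V _⟩⟩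
  have a5 := Set.ncard_le_ncard (Set.union_subset (fun h hh => hh.1 :
    {h | h ∈ T ∧ ¬ (G.r h ∈ S ∩ G.V ∧ G.r (G.ι h) ∈ S ∩ G.V)} ⊆ T) hST)
  rw [Set.ncard_union_eq a4] at a5
  have a6 : Disjoint {h | h ∈ S ∧ ¬ (G.r h ∈ ({G.r s} : Set G.F) ∧
      G.r (G.ι h) ∈ ({G.r s} : Set G.F))} {G.r s} := by
    rw [Set.disjoint_right]
    rintro k rfl ⟨_, hk⟩
    exact hk ⟨by rw [G.r_r]; rfl, by rw [G.ι_r, G.r_r]; rfl⟩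
  have a7 := Set.ncard_le_ncard (Set.union_subset (fun h hh => hh.1 :
    {h | h ∈ S ∧ ¬ (G.r h ∈ ({G.r s} : Set G.F) ∧ G.r (G.ι h) ∈ ({G.r s} : Set G.F))} ⊆ S)
    (Set.singleton_subset_iff.2 hv.1))
  rw [Set.ncard_union_eq a6, Set.ncard_singleton] at a7
  have a8 : 0 < (S ∩ G.V).ncard := (Set.ncard_pos).2 ⟨_, hv⟩
  omega

theorem IsForest.mono {G : DiscreteGraph.{u}} {Y Z : Set (Sym2 G.F)} (hZ : G.IsForest Z)
    (hYZ : Y ⊆ Z) : G.IsForest Y := by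
  refine ⟨hYZ.trans hZ.1, fun v hv => (hZ.2 v hv).of_subset ?_ ?_ ?_ ?_ ?_⟩
  · rintro h ⟨h1, h2⟩
    exact ⟨h1.imp_right fun h3 => hYZ h3, h2.mono fun k hk => hYZ hk⟩
  · exact ⟨v, Or.inl hv, by rw [mem_V_iff.1 hv]; exact .refl⟩
  · rintro h ⟨_, h2⟩
    exact ⟨Or.inl (G.r_mem_V h), by rwa [G.r_r]⟩
  · rintro h ⟨h1 | h1, h2⟩
    · rw [ι_of_mem_V h1]; exact ⟨Or.inl h1, h2⟩
    · exact ⟨Or.inr (by rwa [G.ι_ι, Sym2.eq_swap]), h2.tail ⟨h, h1, rfl, rfl⟩⟩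
  · have key : ∀ w, G.Joined {k | s(k, G.ι k) ∈ Y} v w → G.Joined (G.component Y v) v w := by
      intro w hw
      induction hw with
      | refl => exact .refl
      | tail h1 h2 ih =>
        obtain ⟨k, hk, rfl, rfl⟩ := h2
        exact ih.tail ⟨k, ⟨Or.inr hk, h1⟩, rfl, rfl⟩
    have hι : ∀ h ∈ G.component Y v, G.ι h ∈ G.component Y v := by
      rintro h ⟨h1 | h1, h2⟩
      · rw [ι_of_mem_V h1]; exact ⟨Or.inl h1, h2⟩
      · exact ⟨Or.inr (by rwa [G.ι_ι, Sym2.eq_swap]), h2.tail ⟨h, h1, rfl, rfl⟩⟩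
    rintro a ⟨⟨_, ha⟩, haV⟩ b ⟨⟨_, hb⟩, hbV⟩
    rw [mem_V_iff.1 haV] at ha
    rw [mem_V_iff.1 hbV] at hb
    exact ((key a ha).symm hι).trans (key b hb)

theorem isForest_empty (G : DiscreteGraph.{u}) : G.IsForest ∅ := by
  refine ⟨Set.empty_subset _, fun v hv => ?_⟩
  have h1 : G.component ∅ v = (fun h : G.F => h) ⁻¹' {v} := by
    ext h
    constructor
    · rintro ⟨h1 | h1, h2⟩
      · rcases Relation.ReflTransGen.cases_tail h2 with h3 | ⟨_, _, _, h4, _⟩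
        · exact (mem_V_iff.1 h1).symm.trans h3
        · exact h4.elim
      · exact h1.elim
    · rintro rfl
      exact ⟨Or.inl hv, by rw [mem_V_iff.1 hv]; exact .refl⟩
  rw [h1]
  exact (IsContraction.id G).fiber_tree v hv

end DiscreteGraph
/-! ### The moduli poic-space of tropical curves -/

namespace DiscreteGraph

/-- The cone of metrics of `G`: the union, over the forests `Z` of `G`, of the cones
`ℝ_{>0}^{E(G) ∖ Z}`, embedded in `ℝ^{E(G)}` through extension by zero. -/
def metricCone (G : DiscreteGraph.{u}) : Set (ℝ ⊗[ℤ] (G.edges → ℤ)) :=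
  {x | ∃ Z, G.IsForest Z ∧ ∀ e : G.edges,
    ((e : Sym2 G.F) ∈ Z → realFunctional (LinearMap.proj e) x = 0) ∧
    ((e : Sym2 G.F) ∉ Z → 0 < realFunctional (LinearMap.proj e) x)}

theorem mem_metricCone_iff {G : DiscreteGraph.{u}} {x : ℝ ⊗[ℤ] (G.edges → ℤ)} :
    x ∈ G.metricCone ↔ (∀ e, 0 ≤ realFunctional (LinearMap.proj e) x) ∧
      G.IsForest (Subtype.val '' {e : G.edges | realFunctional (LinearMap.proj e) x = 0}) := by
  constructor
  · rintro ⟨Z, hZ, h⟩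
    refine ⟨fun e => ?_, hZ.mono ?_⟩
    · by_cases he : (e : Sym2 G.F) ∈ Z
      · exact ((h e).1 he).ge
      · exact ((h e).2 he).le
    · rintro _ ⟨e, he, rfl⟩
      by_contra hn
      exact ((h e).2 hn).ne' he
  · rintro ⟨h1, h2⟩
    refine ⟨_, h2, fun e => ⟨?_, fun he => ?_⟩⟩
    · rintro ⟨e', he', h3⟩
      rw [← Subtype.ext h3]; exact he'
    · exact lt_of_le_of_ne (h1 e) fun h3 => he ⟨e, h3.symm, rfl⟩

/-- The poic `σ_G` given by the cone of metrics of `G` and the lattice `ℤ^{E(G)}`. -/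
noncomputable def metricPoic (G : DiscreteGraph.{u}) : Poic.{u} where
  N := G.edges → ℤ
  cone := G.metricCone
  isCone := by
    classical
    have := Fintype.ofFinite G.edges
    refine ⟨⟨1 ⊗ₜ 1, ∅, G.isForest_empty, fun e => ⟨fun h => h.elim, fun _ => by simp⟩⟩,
      Set.range fun e => LinearMap.proj e,
      (fun Y : Finset G.edges => ∑ e ∈ Y, LinearMap.proj e) ''
        {Y | ¬ G.IsForest (Subtype.val '' (Y : Set G.edges))},
      Set.finite_range _, (Set.toFinite _).image _, ?_⟩
    ext x
    rw [mem_metricCone_iff]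
    simp only [Set.mem_ofPred_eq, Set.forall_mem_range, Set.forall_mem_image]
    refine and_congr_right fun h1 => ⟨fun h2 Y hY => ?_, fun h2 => ?_⟩
    · rw [realFunctional_sum]
      have hnn := Finset.sum_nonneg (s := Y) fun e _ => h1 e
      refine lt_of_le_of_ne hnn fun h0 => hY (h2.mono (Set.image_mono fun e he => ?_))
      exact (Finset.sum_eq_zero_iff_of_nonneg fun e _ => h1 e).1 h0.symm e he
    · by_contra hY
      have h3 := @h2 ({e : G.edges | realFunctional (LinearMap.proj e) x = 0} : Set _).toFinset
        (by simpa using hY)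
      rw [realFunctional_sum, Finset.sum_eq_zero] at h3
      · exact h3.false
      · intro e he; simpa using he
  full := by
    refine span_eq_top_of_sub fun n => ?_
    refine ⟨fun i => |n i| + 1 + n i, fun i => |n i| + 1, by ext i; simp,
      ⟨∅, G.isForest_empty, fun i => ⟨fun h => h.elim, fun _ => ?_⟩⟩,
      ⟨∅, G.isForest_empty, fun i => ⟨fun h => h.elim, fun _ => ?_⟩⟩⟩
    · rw [realFunctional_tmul, mul_one]
      have := neg_abs_le (n i)
      exact_mod_cast (show 0 < |n i| + 1 + n i by omega)
    · rw [realFunctional_tmul, mul_one]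
      have := abs_nonneg (n i)
      exact_mod_cast (show 0 < |n i| + 1 by omega)

open Classical in
/-- The linear map `ℤ^{E(H)} → ℤ^{E(G)}` associated to a map of graphs `f : G → H`: the
`e`-coordinate of the image is the `f e`-coordinate if `f e` is an edge of `H`, and it is zero if
`f` contracts `e`. -/
noncomputable def edgeMap {G H : DiscreteGraph.{u}} (f : G.F → H.F) :
    (H.edges → ℤ) →ₗ[ℤ] (G.edges → ℤ) where
  toFun y e := if h : Sym2.map f e ∈ H.edges then y ⟨_, h⟩ else 0
  map_add' y z := by ext e; simp only [Pi.add_apply]; split_ifs <;> simp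
  map_smul' c y := by ext e; simp only [Pi.smul_apply, RingHom.id_apply]; split_ifs <;> simp

theorem proj_comp_edgeMap_of_mem {G H : DiscreteGraph.{u}} {f : G.F → H.F} {e : G.edges}
    (h : Sym2.map f e ∈ H.edges) :
    LinearMap.proj e ∘ₗ edgeMap f = LinearMap.proj (⟨_, h⟩ : H.edges) := by
  ext y; simp [edgeMap, h]

theorem proj_comp_edgeMap_of_notMem {G H : DiscreteGraph.{u}} {f : G.F → H.F} {e : G.edges}
    (h : Sym2.map f e ∉ H.edges) : LinearMap.proj e ∘ₗ edgeMap f = 0 := by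
  ext y; simp [edgeMap, h]

theorem IsContraction.mapsTo_metricCone {G H : DiscreteGraph.{u}} {f : G.F → H.F}
    (hf : IsContraction f) :
    Set.MapsTo ((edgeMap f).baseChange ℝ) H.metricCone G.metricCone := by
  rintro x ⟨Z, hZ, hx⟩
  refine ⟨_, hf.isForest_preimage hZ, fun e => ?_⟩
  rw [realFunctional_baseChange]
  by_cases he : Sym2.map f e ∈ H.edges
  · rw [proj_comp_edgeMap_of_mem he]
    exact ⟨fun h => (hx ⟨_, he⟩).1 (h.2 he), fun h => (hx ⟨_, he⟩).2 fun h2 =>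
      h ⟨e.2, fun _ => h2⟩⟩
  · rw [proj_comp_edgeMap_of_notMem he, realFunctional_zero]
    exact ⟨fun _ => rfl, fun h => (h ⟨e.2, fun h2 => absurd h2 he⟩).elim⟩

theorem IsContraction.mem_edges_of_map {G H : DiscreteGraph.{u}} {f : G.F → H.F}
    (hf : IsContraction f) {h : G.F} (he : s(f h, f (G.ι h)) ∈ H.edges) : G.ι h ≠ h := by
  rw [hf.map_ι, mk_mem_edges, ← hf.map_ι] at he
  exact fun e => he (by rw [e])

theorem edgeMap_comp {G H K : DiscreteGraph.{u}} {f : G.F → H.F} {g : H.F → K.F}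
    (hf : IsContraction f) (hg : IsContraction g) :
    edgeMap (fun h => g (f h)) = edgeMap f ∘ₗ edgeMap g := by
  ext1 y
  funext e
  obtain ⟨e, he⟩ := e
  obtain ⟨h, hne, rfl⟩ := mem_edges_iff.1 he
  simp only [edgeMap, LinearMap.coe_mk, AddHom.coe_mk, LinearMap.comp_apply, Sym2.map_mk]
  by_cases h1 : s(f h, f (G.ι h)) ∈ H.edges
  · simp [h1]; rfl
  · have : s(g (f h), g (f (G.ι h))) ∉ K.edges := by
      rw [hf.map_ι] at h1 ⊢
      intro h2
      exact h1 (mk_mem_edges.2 (hg.mem_edges_of_map h2))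
    simp [h1, this]

theorem edgeMap_id (G : DiscreteGraph.{u}) :
    edgeMap (G := G) (H := G) (fun h => h) = LinearMap.id := by
  ext1 y
  funext e
  simp [edgeMap]

end DiscreteGraph

open DiscreteGraph

/-- The objects of the category `𝔾_{g,A}`: connected discrete graphs of genus `g` with `A`-marked
legs whose vertices are at least three-valent. -/
structure StableGraph (g : ℕ) (A : Type u) where
  graph : DiscreteGraph.{u}
  mark : A ≃ graph.legs
  connected : graph.Connected
  genus_eq : graph.genus = g
  three_le_val : ∀ v ∈ graph.V, 3 ≤ graph.val v

namespace StableGraph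

variable {g : ℕ} {A : Type u}

/-- The morphisms of `𝔾_{g,A}`: contractions that commute with the markings. -/
@[ext]
structure Hom (G H : StableGraph.{u} g A) where
  toFun : G.graph.F → H.graph.F
  isContraction : IsContraction toFun
  map_mark : ∀ a, toFun (G.mark a) = H.mark a

instance : Category.{u} (StableGraph.{u} g A) where
  Hom := Hom
  id _ := ⟨fun h => h, IsContraction.id _, fun _ => rfl⟩
  comp f g := ⟨fun h => g.toFun (f.toFun h), f.isContraction.comp g.isContraction, fun a => by
    rw [f.map_mark, g.map_mark]⟩

end StableGraph

/-- The moduli poic-space of genus-`g` `A`-marked tropical curves: the functor that maps `G` to its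
cone of metrics `σ_G`, and a contraction `G' → G` to the face-embedding `σ_G → σ_{G'}`. -/
noncomputable def Mtrop (g : ℕ) (A : Type u) : (StableGraph.{u} g A)ᵒᵖ ⥤ Poic.{u} where
  obj G := G.unop.graph.metricPoic
  map f := ⟨edgeMap f.unop.toFun, f.unop.isContraction.mapsTo_metricCone⟩
  map_id _ := Poic.Hom.ext (edgeMap_id _)
  map_comp f f' := Poic.Hom.ext (edgeMap_comp f'.unop.isContraction f.unop.isContraction)

/-! ### The spanning tree functor -/

/-- The involution of the marking set `A ⊔ {1, …, g} ⊔ {1*, …, g*}` that exchanges `i` and `i*`. -/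
def swapLegs (g : ℕ) (A : Type u) : A ⊕ (Fin g ⊕ Fin g) ≃ A ⊕ (Fin g ⊕ Fin g) :=
  Equiv.sumCongr (Equiv.refl A) (Equiv.sumComm (Fin g) (Fin g))

theorem swapLegs_swapLegs {g : ℕ} {A : Type u} (a : A ⊕ (Fin g ⊕ Fin g)) :
    swapLegs g A (swapLegs g A a) = a := by
  rcases a with a | i | i <;> rfl

namespace StableGraph

variable {g : ℕ} {A : Type u}

theorem ι_mark (G : StableGraph.{u} g A) (a : A) : G.graph.ι (G.mark a) = G.mark a :=
  (G.mark a).2.2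

theorem exists_mark {G : StableGraph.{u} g A} {h : G.graph.F} (hh : h ∈ G.graph.legs) :
    ∃ a, h = G.mark a := ⟨G.mark.symm ⟨h, hh⟩, by simp⟩

theorem mark_injective (G : StableGraph.{u} g A) {a b : A}
    (h : (G.mark a : G.graph.F) = G.mark b) : a = b :=
  G.mark.injective (Subtype.ext h)

variable (T : StableGraph.{u} 0 (A ⊕ (Fin g ⊕ Fin g)))

open Classical in
/-- The involution of the flags of `T` that exchanges the `i`-leg and the `i*`-leg and agrees with
the involution of `T` on all other flags. -/
noncomputable def glueInv (h : T.graph.F) : T.graph.F :=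
  if hL : h ∈ T.graph.legs then T.mark (swapLegs g A (T.mark.symm ⟨h, hL⟩)) else T.graph.ι h

theorem glueInv_mark (a : A ⊕ (Fin g ⊕ Fin g)) :
    T.glueInv (T.mark a) = T.mark (swapLegs g A a) := by
  simp [glueInv]

theorem glueInv_of_notMem {h : T.graph.F} (hh : h ∉ T.graph.legs) :
    T.glueInv h = T.graph.ι h := dif_neg hh

/-- The graph obtained from `T` by gluing the `i`-leg and the `i*`-leg into an edge, for all `i`. -/
noncomputable abbrev glue : DiscreteGraph.{u} where
  F := T.graph.F
  r := T.graph.r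
  ι := T.glueInv
  r_r := T.graph.r_r
  ι_ι h := by
    by_cases hh : h ∈ T.graph.legs
    · obtain ⟨a, rfl⟩ := exists_mark hh
      rw [glueInv_mark, glueInv_mark, swapLegs_swapLegs]
    · rw [T.glueInv_of_notMem hh, glueInv_of_notMem, T.graph.ι_ι]
      intro h2
      apply hh
      have := h2.2
      rw [T.graph.ι_ι] at this
      rw [this]; exact h2
  ι_r h := by
    rw [glueInv_of_notMem, T.graph.ι_r]
    exact fun h2 => h2.1 (T.graph.r_mem_V h)

theorem mem_glue_legs_iff {h : T.graph.F} : h ∈ T.glue.legs ↔ ∃ a, h = T.mark (Sum.inl a) := by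
  constructor
  · rintro ⟨h1, h2⟩
    have hh : h ∈ T.graph.legs := by
      by_contra hh
      exact hh ⟨h1, by rwa [← T.glueInv_of_notMem hh]⟩
    obtain ⟨a, rfl⟩ := exists_mark hh
    have h3 : T.glueInv (T.mark a) = T.mark a := h2
    rw [glueInv_mark] at h3
    have h4 := mark_injective _ h3
    rcases a with a | i | i
    · exact ⟨a, rfl⟩
    · simp [swapLegs] at h4
    · simp [swapLegs] at h4
  · rintro ⟨a, rfl⟩
    exact ⟨(T.mark (Sum.inl a)).2.1, T.glueInv_mark _⟩

/-- The `A`-marking of the glued graph. -/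
noncomputable def glueMark : A ≃ T.glue.legs :=
  Equiv.ofBijective (fun a => ⟨T.mark (Sum.inl a), (T.mem_glue_legs_iff).2 ⟨a, rfl⟩⟩) <| by
    constructor
    · intro a b h
      have h1 : (T.mark (Sum.inl a) : T.graph.F) = T.mark (Sum.inl b) := 
        congrArg (fun x : T.glue.legs => (x : T.graph.F)) h
      exact Sum.inl_injective (mark_injective T h1)
    · rintro ⟨h, hh⟩
      obtain ⟨a, rfl⟩ := (T.mem_glue_legs_iff).1 hh
      exact ⟨a, rfl⟩

theorem glueMark_apply (a : A) : (T.glueMark a : T.graph.F) = T.mark (Sum.inl a) := rfl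

/-- The edge `e_i` of the glued graph that consists of the `i`-leg and the `i*`-leg. -/
def glueEdge (i : Fin g) : Sym2 T.graph.F :=
  s((T.mark (Sum.inr (Sum.inl i)) : T.graph.F), T.mark (Sum.inr (Sum.inr i)))

theorem glue_joined {B : Set T.graph.F} {v w : T.graph.F} (hB : ∀ h ∈ B, h ∉ T.graph.legs)
    (h : T.graph.Joined B v w) : T.glue.Joined B v w :=
  Relation.ReflTransGen.mono (by
    rintro a b ⟨k, hk, rfl, rfl⟩
    exact ⟨k, hk, rfl, congrArg T.graph.r (T.glueInv_of_notMem (hB k hk))⟩) _ _ h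

theorem glue_connected : T.glue.Connected := by
  intro v hv w hw
  refine Relation.ReflTransGen.lift' (fun h => h) ?_ _ _ (T.connected v hv w hw)
  rintro a b ⟨k, -, rfl, rfl⟩
  by_cases hk : k ∈ T.graph.legs
  · have := hk.2
    show T.glue.Joined _ _ _
    rw [this]; exact .refl
  · exact .single ⟨k, trivial, rfl, congrArg T.graph.r (T.glueInv_of_notMem hk)⟩

theorem glue_genus : T.glue.genus = g := by
  have : Finite (A ⊕ (Fin g ⊕ Fin g)) := Finite.of_equiv _ T.mark.symm
  have : Finite A := Finite.of_injective _ (Sum.inl_injective (α := A) (β := Fin g ⊕ Fin g))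
  have h1 := card_flags T.graph
  have h2 := card_flags T.glue
  have h3 : T.graph.legs.ncard = Nat.card A + (g + g) := by
    rw [← Nat.card_coe_set_eq, ← Nat.card_congr T.mark, Nat.card_sum, Nat.card_sum, Nat.card_fin]
  have h4 : T.glue.legs.ncard = Nat.card A := by
    rw [← Nat.card_coe_set_eq, ← Nat.card_congr T.glueMark]
  have h5 : T.glue.V.ncard = T.graph.V.ncard := rfl
  have h6 := T.genus_eq
  rw [genus] at h6 ⊢
  rw [h5]
  have h7 : Nat.card T.glue.F = Nat.card T.graph.F := rfl
  push_cast at h6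
  omega

theorem glue_tree {S : Set T.graph.F} (hS : T.graph.IsLeglessTreeSet S) :
    T.glue.IsLeglessTreeSet S := by
  rw [isLeglessTreeSet_iff] at hS ⊢
  obtain ⟨h1, h2, h3, h4, h5⟩ := hS
  have hl : ∀ h ∈ S, h ∉ T.graph.legs := fun h hh hL => hL.1 (h3 h hh hL.2)
  have hι : ∀ h ∈ S, T.glueInv h = T.graph.ι h := fun h hh => T.glueInv_of_notMem (hl h hh)
  refine ⟨h1, fun h hh => ?_, fun h hh hh' => ?_, fun v hv w hw => ?_, h5⟩
  · show T.glueInv h ∈ S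
    rw [hι h hh]; exact h2 h hh
  · exact h3 h hh ((hι h hh).symm.trans hh')
  · exact T.glue_joined hl (h4 v hv w hw)

theorem notMem_legs_of_mem_edges {G : DiscreteGraph.{u}} {e : Sym2 G.F} (he : e ∈ G.edges)
    {h : G.F} (hh : h ∈ e) : h ∉ G.legs := by
  obtain ⟨k, hne, rfl⟩ := mem_edges_iff.1 he
  rintro ⟨_, hι⟩
  rcases Sym2.mem_iff.1 hh with rfl | rfl
  · exact hne hι
  · rw [G.ι_ι] at hι; exact hne hι.symm

theorem edges_subset_glue : T.graph.edges ⊆ T.glue.edges := by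
  intro e he
  have h1 := fun h => notMem_legs_of_mem_edges he (h := h)
  obtain ⟨k, hne, rfl⟩ := mem_edges_iff.1 he
  have h2 : T.glueInv k = T.graph.ι k := T.glueInv_of_notMem (h1 k (Sym2.mem_mk_left _ _))
  rw [← h2] at hne ⊢
  exact mem_edges_iff.2 ⟨k, hne, rfl⟩

theorem glueEdge_mem (i : Fin g) : T.glueEdge i ∈ T.glue.edges := by
  have h1 : T.glueInv (T.mark (Sum.inr (Sum.inl i))) = T.mark (Sum.inr (Sum.inr i)) :=
    T.glueInv_mark _
  rw [glueEdge, ← h1]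
  refine mem_edges_iff.2 ⟨_, fun h2 => ?_, rfl⟩
  have h3 := mark_injective _ (h1.symm.trans h2)
  simp at h3

theorem mem_glue_edges_iff {e : Sym2 T.graph.F} :
    e ∈ T.glue.edges ↔ e ∈ T.graph.edges ∨ ∃ i, e = T.glueEdge i := by
  constructor
  · intro he
    obtain ⟨k, hne, rfl⟩ := mem_edges_iff.1 he
    by_cases hk : k ∈ T.graph.legs
    · obtain ⟨a, rfl⟩ := exists_mark hk
      right
      have h1 : T.glueInv (T.mark a) = T.mark (swapLegs g A a) := T.glueInv_mark a
      rcases a with a | i | i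
      · exact absurd h1 hne
      · exact ⟨i, by rw [glueEdge]; exact congrArg (fun x => s(_, x)) h1⟩
      · refine ⟨i, ?_⟩
        rw [glueEdge, Sym2.eq_swap]
        exact congrArg (fun x => s(x, _)) h1
    · left
      have h1 : T.glueInv k = T.graph.ι k := T.glueInv_of_notMem hk
      have h2 : T.graph.ι k ≠ k := fun h => hne (h1.trans h)
      exact mem_edges_iff.2 ⟨k, h2, congrArg (fun x => s(k, x)) h1⟩
  · rintro (h | ⟨i, rfl⟩)
    · exact T.edges_subset_glue h
    · exact T.glueEdge_mem i

theorem glueEdge_notMem (i : Fin g) : T.glueEdge i ∉ T.graph.edges := fun h =>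
  notMem_legs_of_mem_edges h (Sym2.mem_mk_left _ _) (T.mark _).2

theorem glueEdge_injective {i j : Fin g} (h : T.glueEdge i = T.glueEdge j) : i = j := by
  rcases Sym2.eq_iff.1 h with ⟨h1, _⟩ | ⟨h1, _⟩
  · simpa using mark_injective _ h1
  · have := mark_injective _ h1
    simp at this

theorem glue_isForest {Z : Set (Sym2 T.graph.F)} (hZ : T.graph.IsForest Z) :
    T.glue.IsForest Z := by
  have h0 : ∀ k, s(k, T.glueInv k) ∈ Z ↔ s(k, T.graph.ι k) ∈ Z := by
    intro k
    by_cases hk : k ∈ T.graph.legs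
    · constructor <;> intro h <;>
        exact (notMem_legs_of_mem_edges (hZ.1 h) (Sym2.mem_mk_left _ _) hk).elim
    · rw [T.glueInv_of_notMem hk]
  refine ⟨hZ.1.trans T.edges_subset_glue, fun v hv => ?_⟩
  convert T.glue_tree (hZ.2 v hv) using 1
  have hj : ∀ a b, T.glue.Joined {k | s(k, T.glueInv k) ∈ Z} a b ↔
      T.graph.Joined {k | s(k, T.graph.ι k) ∈ Z} a b := by
    intro a b
    rw [show {k | s(k, T.glueInv k) ∈ Z} = {k | s(k, T.graph.ι k) ∈ Z} from Set.ext h0]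
    have hl : ∀ k ∈ {k | s(k, T.graph.ι k) ∈ Z}, k ∉ T.graph.legs := fun k hk =>
      notMem_legs_of_mem_edges (hZ.1 hk) (Sym2.mem_mk_left _ _)
    refine ⟨fun h => ?_, T.glue_joined hl⟩
    refine Relation.ReflTransGen.mono ?_ _ _ h
    rintro a b ⟨k, hk, rfl, rfl⟩
    exact ⟨k, hk, rfl, congrArg T.graph.r (T.glueInv_of_notMem (hl k hk)).symm⟩
  ext h
  exact and_congr (or_congr Iff.rfl (h0 h)) (hj v _)

variable {T}

theorem Hom.mark_eq {G H : StableGraph.{u} g A} (f : Hom G H) {h : G.graph.F} {a : A}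
    (e : f.toFun h = H.mark a) : h = G.mark a :=
  f.isContraction.injOn (by rw [e]; exact (H.mark a).2.1) (by rw [e, f.map_mark])

theorem Hom.glueInv {T T' : StableGraph.{u} 0 (A ⊕ (Fin g ⊕ Fin g))} (f : Hom T T')
    (h : T.graph.F) : f.toFun (T.glueInv h) = T'.glueInv (f.toFun h) := by
  by_cases hh : h ∈ T.graph.legs
  · obtain ⟨a, rfl⟩ := exists_mark hh
    rw [glueInv_mark, f.map_mark, f.map_mark, glueInv_mark]
  · rw [T.glueInv_of_notMem hh, T'.glueInv_of_notMem, f.isContraction.map_ι]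
    intro h2
    obtain ⟨a, ha⟩ := exists_mark h2
    rw [f.mark_eq ha] at hh
    exact hh (T.mark a).2

theorem Hom.isContraction_glue {T T' : StableGraph.{u} 0 (A ⊕ (Fin g ⊕ Fin g))} (f : Hom T T') :
    IsContraction (G := T.glue) (H := T'.glue) f.toFun where
  map_r := f.isContraction.map_r
  map_ι := f.glueInv
  fiber_tree v hv := T.glue_tree (f.isContraction.fiber_tree v hv)
  fiber_half := f.isContraction.fiber_half

end StableGraph

open StableGraph

/-- The spanning tree functor `st_{g,A} : 𝔾_{0, A ⊔ {1,…,g,1*,…,g*}} → 𝔾_{g,A}`, which glues the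
`i`-leg and the `i*`-leg of a tree into an edge. A contraction of trees is mapped to the same map of
flags. -/
noncomputable def stFunctor (g : ℕ) (A : Type u) :
    StableGraph.{u} 0 (A ⊕ (Fin g ⊕ Fin g)) ⥤ StableGraph.{u} g A where
  obj T :=
    { graph := T.glue
      mark := T.glueMark
      connected := T.glue_connected
      genus_eq := T.glue_genus
      three_le_val := T.three_le_val }
  map f := ⟨f.toFun, f.isContraction_glue, fun a => f.map_mark (Sum.inl a)⟩
  map_id _ := rfl
  map_comp _ _ := rfl

/-- The poic-complex `ST_{g,A}`, which maps a tree `T` to the poic `σ_T × ℝ_{>0}^g`. -/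
noncomputable def stComplex (g : ℕ) (A : Type u) :
    (StableGraph.{u} 0 (A ⊕ (Fin g ⊕ Fin g)))ᵒᵖ ⥤ Poic.{u} :=
  Poic.prodRight (Mtrop 0 (A ⊕ (Fin g ⊕ Fin g))) (Poic.posOrthant (Fin g))

open Classical in
/-- The linear map `ℤ^{E(T)} × ℤ^g → ℤ^{E(st(T))}` that identifies the `e`-coordinate with the
`e`-coordinate for every edge `e` of `T`, and the `i`-th coordinate of `ℤ^g` with the
`e_i`-coordinate. -/
noncomputable def stLin {g : ℕ} {A : Type u} (T : StableGraph.{u} 0 (A ⊕ (Fin g ⊕ Fin g))) :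
    (T.graph.edges → ℤ) × (Fin g → ℤ) →ₗ[ℤ] (T.glue.edges → ℤ) where
  toFun y e := (if h : (e : Sym2 T.graph.F) ∈ T.graph.edges then y.1 ⟨e, h⟩ else 0) +
    ∑ i, if (e : Sym2 T.graph.F) = T.glueEdge i then y.2 i else 0
  map_add' y z := by
    ext e
    simp only [Prod.fst_add, Prod.snd_add, Pi.add_apply]
    have : ∀ i, (if (e : Sym2 T.graph.F) = T.glueEdge i then y.2 i + z.2 i else 0) =
        (if (e : Sym2 T.graph.F) = T.glueEdge i then y.2 i else 0) +
        (if (e : Sym2 T.graph.F) = T.glueEdge i then z.2 i else 0) := by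
      intro i; split_ifs <;> simp
    simp only [this, Finset.sum_add_distrib]
    split_ifs <;> ring
  map_smul' c y := by
    ext e
    simp only [Prod.smul_fst, Prod.smul_snd, Pi.smul_apply, smul_eq_mul, RingHom.id_apply, mul_add,
      Finset.mul_sum, mul_ite, mul_zero, mul_dite]

theorem stLin_edge {g : ℕ} {A : Type u} (T : StableGraph.{u} 0 (A ⊕ (Fin g ⊕ Fin g)))
    (y : (T.graph.edges → ℤ) × (Fin g → ℤ)) (e : T.graph.edges) :
    stLin T y ⟨e, T.edges_subset_glue e.2⟩ = y.1 e := by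
  have h2 : ∀ i, (e : Sym2 T.graph.F) ≠ T.glueEdge i := fun i h => T.glueEdge_notMem i (h ▸ e.2)
  simp [stLin, h2]

theorem stLin_glueEdge {g : ℕ} {A : Type u} (T : StableGraph.{u} 0 (A ⊕ (Fin g ⊕ Fin g)))
    (y : (T.graph.edges → ℤ) × (Fin g → ℤ)) (i : Fin g) :
    stLin T y ⟨T.glueEdge i, T.glueEdge_mem i⟩ = y.2 i := by
  have h2 : ∀ j, T.glueEdge i = T.glueEdge j ↔ i = j :=
    fun j => ⟨T.glueEdge_injective, fun h => h ▸ rfl⟩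
  simp [stLin, T.glueEdge_notMem, h2]

theorem stLin_mapsTo {g : ℕ} {A : Type u} (T : StableGraph.{u} 0 (A ⊕ (Fin g ⊕ Fin g))) :
    Set.MapsTo ((stLin T).baseChange ℝ)
      (T.graph.metricPoic.prod (Poic.posOrthant (Fin g))).cone T.glue.metricCone := by
  rintro x ⟨⟨Z, hZ, h1⟩, h2⟩
  refine ⟨Z, T.glue_isForest hZ, ?_⟩
  rintro ⟨e, he⟩
  rw [realFunctional_baseChange]
  rcases T.mem_glue_edges_iff.1 he with he' | ⟨i, rfl⟩
  · have h3 : LinearMap.proj (⟨e, he⟩ : T.glue.edges) ∘ₗ stLin T =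
        LinearMap.proj ⟨e, he'⟩ ∘ₗ LinearMap.fst ℤ _ _ :=
      LinearMap.ext fun y => stLin_edge T y ⟨e, he'⟩
    have h4 := h1 ⟨e, he'⟩
    rw [h3, ← realFunctional_baseChange]
    exact h4
  · have h3 : LinearMap.proj (⟨T.glueEdge i, he⟩ : T.glue.edges) ∘ₗ stLin T =
        LinearMap.proj i ∘ₗ LinearMap.snd ℤ _ _ :=
      LinearMap.ext fun y => stLin_glueEdge T y i
    rw [h3, ← realFunctional_baseChange]
    exact ⟨fun h => (T.glueEdge_notMem i (hZ.1 h)).elim, fun _ => h2 i⟩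

/-- The natural transformation `ST_{g,A} → M^trop_{g,A} ∘ st_{g,A}` given by the poic-morphisms
`σ_T × ℝ_{>0}^g → σ_{st(T)}`. -/
noncomputable def stEta (g : ℕ) (A : Type u) : stComplex.{u} g A ⟶ (stFunctor g A).op ⋙ Mtrop g A where
  app T := ⟨stLin T.unop, stLin_mapsTo T.unop⟩
  naturality := by
    rintro ⟨T⟩ ⟨T'⟩ ⟨f⟩
    apply Poic.Hom.ext
    apply LinearMap.ext
    rintro (y : (T.graph.edges → ℤ) × (Fin g → ℤ))
    change Hom T' T at f
    change stLin T' (edgeMap f.toFun y.1, y.2) =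
      edgeMap (G := T'.glue) (H := T.glue) f.toFun (stLin T y)
    funext ⟨e, he⟩
    rcases T'.mem_glue_edges_iff.1 he with he' | ⟨i, rfl⟩
    · rw [stLin_edge T' _ ⟨e, he'⟩]
      by_cases h1 : Sym2.map f.toFun e ∈ T.graph.edges
      · have h2 : Sym2.map f.toFun e ∈ T.glue.edges := T.edges_subset_glue h1
        have h3 := stLin_edge T y ⟨_, h1⟩
        simp only [edgeMap, LinearMap.coe_mk, AddHom.coe_mk, h1, h2, dite_true]
        exact h3.symm
      · have h2 : Sym2.map f.toFun e ∉ T.glue.edges := by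
          intro h2
          rcases T.mem_glue_edges_iff.1 h2 with h3 | ⟨i, h3⟩
          · exact h1 h3
          · have h4 : (T.mark (Sum.inr (Sum.inl i)) : T.graph.F) ∈ Sym2.map f.toFun e := by
              rw [h3]; exact Sym2.mem_mk_left _ _
            obtain ⟨k, hk, hk2⟩ := Sym2.mem_map.1 h4
            have h5 := f.mark_eq hk2
            refine notMem_legs_of_mem_edges he' hk ?_
            rw [h5]; exact (T'.mark _).2
        simp only [edgeMap, LinearMap.coe_mk, AddHom.coe_mk, h1, h2, dite_false]
    · rw [stLin_glueEdge T' _ i]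
      have h1 : Sym2.map f.toFun (T'.glueEdge i) = T.glueEdge i := by
        rw [glueEdge, glueEdge, Sym2.map_mk, f.map_mark, f.map_mark]
      have h2 : Sym2.map f.toFun (T'.glueEdge i) ∈ T.glue.edges := h1 ▸ T.glueEdge_mem i
      have h3 := stLin_glueEdge T y i
      simp only [edgeMap, LinearMap.coe_mk, AddHom.coe_mk, h2, dite_true]
      rw [← h3]
      exact congrArg (stLin T y) (Subtype.ext h1.symm)

/-! ### The distance map -/

section Distance

variable (A : Type u)

/-- The two-element subsets of `A`. -/
abbrev Pairs : Type u := {p : Sym2 A // ¬ p.IsDiag}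

/-- The linear map `ℝ^A → ℝ^{A choose 2}`, `x ↦ (x_i + x_j)_{i,j}`. -/
def pairSum : (A → ℝ) →ₗ[ℝ] (Pairs A → ℝ) where
  toFun x p := Sym2.lift ⟨fun i j => x i + x j, fun _ _ => add_comm _ _⟩ (p : Sym2 A)
  map_add' x y := by
    ext ⟨p, hp⟩
    induction p with | _ i j => simp only [Sym2.lift_mk, Pi.add_apply]; ring
  map_smul' c x := by
    ext ⟨p, hp⟩
    induction p with | _ i j => simp [Sym2.lift_mk, mul_add]

/-- The cokernel `Q_A` of the map `x ↦ (x_i + x_j)_{i,j}`. -/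
abbrev DistSpace : Type u := (Pairs A → ℝ) ⧸ LinearMap.range (pairSum A)

variable {A}

open Classical in
/-- The class in `Q_A` of the vector whose `{i, j}`-coordinate is one if exactly one of `i` and `j`
lies in `I`, and zero otherwise. This is the distance vector of a metric tree with exactly one
bounded edge, which has length one and separates the legs in `I` from those not in `I`. -/
noncomputable def splitVec (I : Set A) : DistSpace A :=
  Submodule.Quotient.mk fun p : Pairs A => if (∃ i ∈ p.1, i ∈ I) ∧ (∃ j ∈ p.1, j ∉ I) then 1 else 0

variable (A) in
/-- The lattice in `Q_A` that is generated by the vectors `v_I` with `1 < #I < #A - 1`. -/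
noncomputable def distLattice : AddSubgroup (DistSpace A) :=
  AddSubgroup.closure {v | ∃ I : Set A, 1 < I.ncard ∧ I.ncard + 1 < Nat.card A ∧ v = splitVec I}

instance [Finite A] : Module.Finite ℤ (distLattice A) := by
  rw [Module.Finite.iff_addGroup_fg, AddGroup.fg_iff_addSubgroup_fg, AddSubgroup.fg_iff]
  refine ⟨_, rfl, (Set.finite_range (splitVec (A := A))).subset ?_⟩
  rintro v ⟨I, -, -, rfl⟩
  exact ⟨I, rfl⟩

instance [Finite A] : Module.Free ℤ (distLattice A) := by
  have : IsAddTorsionFree (DistSpace A) := IsAddTorsionFree.of_module_rat _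
  infer_instance

theorem splitVec_compl (I : Set A) : splitVec Iᶜ = splitVec I := by
  unfold splitVec
  congr 1
  funext p
  congr 1
  apply propext
  constructor
  · rintro ⟨⟨i, hi, hi'⟩, j, hj, hj'⟩
    exact ⟨⟨j, hj, not_not.1 hj'⟩, i, hi, hi'⟩
  · rintro ⟨⟨i, hi, hi'⟩, j, hj, hj'⟩
    exact ⟨⟨j, hj, hj'⟩, i, hi, not_not.2 hi'⟩

theorem splitVec_mem [Finite A] (I : Set A) : splitVec I ∈ distLattice A := by
  classical
  have key : ∀ J : Set A, J.ncard ≤ 1 → splitVec J = 0 := by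
    intro J hJ
    refine (Submodule.Quotient.mk_eq_zero _).2 ?_
    rcases (Set.ncard_le_one_iff_eq (Set.toFinite J)).1 hJ with rfl | ⟨a, rfl⟩
    · convert Submodule.zero_mem _
      simp
    · refine ⟨Pi.single a 1, ?_⟩
      ext ⟨p, hp⟩
      induction p with | _ i j =>
      rw [Sym2.mk_isDiag_iff] at hp
      simp only [pairSum, LinearMap.coe_mk, AddHom.coe_mk, Sym2.lift_mk, Sym2.mem_iff,
        Set.mem_singleton_iff, Pi.single_apply]
      by_cases h1 : i = a
      · subst h1
        have h2 : ¬ j = i := fun h => hp h.symm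
        simp [h2]
      · by_cases h2 : j = a
        · subst h2; simp [h1]
        · simp [h1, h2, Ne.symm h1, Ne.symm h2]
  by_cases h1 : I.ncard ≤ 1
  · rw [key I h1]; exact AddSubgroup.zero_mem _
  by_cases h2 : Iᶜ.ncard ≤ 1
  · rw [← splitVec_compl, key _ h2]; exact AddSubgroup.zero_mem _
  · refine AddSubgroup.subset_closure ⟨I, by omega, ?_, rfl⟩
    have := Set.ncard_add_ncard_compl I
    omega

end Distance

namespace StableGraph

variable {A : Type u} {g : ℕ}

/-- The edge `e` of the tree `T` separates the legs `a` and `b` if it lies on the path between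
them, that is, if their end points are not joined in the graph without the edge `e`. -/
def Separates (T : StableGraph.{u} g A) (e : Sym2 T.graph.F) (a b : A) : Prop :=
  ¬ T.graph.Joined {h | s(h, T.graph.ι h) ≠ e} (T.graph.r (T.mark a)) (T.graph.r (T.mark b))

open Classical in
/-- The class in `Q_A` of the vector of distances between the legs of the metric tree `T` in which
the edge `e` has length one and all other edges have length zero. -/
noncomputable def edgeVec (T : StableGraph.{u} g A) (e : Sym2 T.graph.F) : DistSpace A :=
  Submodule.Quotient.mk fun p : Pairs A => if ∃ a ∈ p.1, ∃ b ∈ p.1, T.Separates e a b then 1 else 0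

theorem joined_symm_ne {G : DiscreteGraph.{u}} {e : Sym2 G.F} {v w : G.F}
    (h : G.Joined {h | s(h, G.ι h) ≠ e} v w) : G.Joined {h | s(h, G.ι h) ≠ e} w v :=
  h.symm fun k hk => by rwa [Set.mem_ofPred_eq, G.ι_ι, Sym2.eq_swap]

theorem edgeVec_eq_splitVec (T : StableGraph.{u} g A) (h : T.graph.F) :
    T.edgeVec s(h, T.graph.ι h) = splitVec {a | T.graph.Joined
      {k | s(k, T.graph.ι k) ≠ s(h, T.graph.ι h)} (T.graph.r h) (T.graph.r (T.mark a))} := by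
  classical
  set B := {k | s(k, T.graph.ι k) ≠ s(h, T.graph.ι h)} with hB
  have h2 : ∀ v ∈ T.graph.V, T.graph.Joined B (T.graph.r h) v ∨
      T.graph.Joined B (T.graph.r (T.graph.ι h)) v := by
    intro v hv
    have h3 := T.connected (T.graph.r h) (T.graph.r_mem_V h) v hv
    clear hv
    induction h3 with
    | refl => exact Or.inl .refl
    | tail _ h4 ih =>
      obtain ⟨k, -, rfl, rfl⟩ := h4
      by_cases hk : s(k, T.graph.ι k) = s(h, T.graph.ι h)
      · rcases Sym2.eq_iff.1 hk with ⟨rfl, _⟩ | ⟨_, h5⟩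
        · exact Or.inr .refl
        · rw [h5]; exact Or.inl .refl
      · exact ih.imp (fun h5 => h5.tail ⟨k, hk, rfl, rfl⟩) fun h5 => h5.tail ⟨k, hk, rfl, rfl⟩
  unfold edgeVec splitVec
  congr 1
  funext p
  congr 1
  apply propext
  constructor
  · rintro ⟨a, ha, b, hb, hab⟩
    by_cases ha' : T.graph.Joined B (T.graph.r h) (T.graph.r (T.mark a))
    · exact ⟨⟨a, ha, ha'⟩, b, hb, fun hb' => hab ((joined_symm_ne ha').trans hb')⟩
    · refine ⟨⟨b, hb, ?_⟩, a, ha, ha'⟩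
      by_contra hb'
      have h3 := (h2 _ (T.graph.r_mem_V (T.mark a))).resolve_left ha'
      have h4 := (h2 _ (T.graph.r_mem_V (T.mark b))).resolve_left hb'
      exact hab ((joined_symm_ne h3).trans h4)
  · rintro ⟨⟨a, ha, ha'⟩, b, hb, hb'⟩
    exact ⟨a, ha, b, hb, fun hab => hb' (Relation.ReflTransGen.trans ha' hab)⟩

theorem edgeVec_mem [Finite A] (T : StableGraph.{u} g A) (e : Sym2 T.graph.F)
    (he : e ∈ T.graph.edges) :
    T.edgeVec e ∈ distLattice A := by
  obtain ⟨h, -, rfl⟩ := mem_edges_iff.1 he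
  rw [T.edgeVec_eq_splitVec h]
  exact splitVec_mem _

/-- Under a contraction `f : T' → T`, the edge vector of an edge of `T` agrees with the edge vector
of the corresponding edge of `T'`. -/
theorem edgeVec_map {T' T : StableGraph.{u} g A} (f : Hom T' T) {e : Sym2 T'.graph.F}
    (he : Sym2.map f.toFun e ∈ T.graph.edges) (he' : e ∈ T'.graph.edges) :
    T'.edgeVec e = T.edgeVec (Sym2.map f.toFun e) := by
  unfold edgeVec
  congr 1
  funext p
  have hf := f.isContraction
  obtain ⟨h, hne, rfl⟩ := mem_edges_iff.1 he'
  have hV : f.toFun h ∉ T.graph.V := by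
    rw [Sym2.map_mk, hf.map_ι, mk_mem_edges] at he
    exact fun hV => he (ι_of_mem_V hV)
  have hιV : f.toFun (T'.graph.ι h) ∉ T.graph.V := by
    rw [Sym2.map_mk, hf.map_ι, mk_mem_edges] at he
    rw [hf.map_ι]
    intro hV
    have := ι_of_mem_V hV
    rw [T.graph.ι_ι] at this
    exact he this.symm
  have hB : ∀ k, s(f.toFun k, T.graph.ι (f.toFun k)) = Sym2.map f.toFun s(h, T'.graph.ι h) ↔
      s(k, T'.graph.ι k) = s(h, T'.graph.ι h) := by
    intro k
    constructor
    · intro h1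
      rw [Sym2.map_mk] at h1
      rcases Sym2.eq_iff.1 h1 with ⟨h2, _⟩ | ⟨h2, _⟩
      · rw [hf.injOn hV h2.symm]
      · rw [← hf.injOn hιV h2.symm, T'.graph.ι_ι, Sym2.eq_swap]
    · intro h1
      rw [← h1, Sym2.map_mk, hf.map_ι]
  have hsep : ∀ a b, T'.Separates s(h, T'.graph.ι h) a b ↔
      T.Separates (Sym2.map f.toFun s(h, T'.graph.ι h)) a b := by
    intro a b
    refine not_congr ⟨fun h1 => ?_, fun h1 => ?_⟩
    · have h2 := hf.joined_map (B := {k | s(k, T'.graph.ι k) ≠ s(h, T'.graph.ι h)}) (B' := {k | s(k, T.graph.ι k) ≠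
        Sym2.map f.toFun s(h, T'.graph.ι h)}) (fun k hk h3 => hk ((hB k).1 h3)) h1
      rwa [hf.map_r, hf.map_r, f.map_mark, f.map_mark] at h2
    · rw [← f.map_mark, ← f.map_mark, ← hf.map_r, ← hf.map_r] at h1
      refine hf.joined_lift (W := T.graph.V) (T'.graph.r_mem_V _)
        (hf.map_V (T'.graph.r_mem_V _)) (fun _ _ => T.graph.r_mem_V _) ?_ ?_ h1 _
        (T'.graph.r_mem_V _) rfl
      · intro k hk h2
        exact hk ((hB k).2 h2)
      · intro k hk h2
        rw [← hB] at h2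
        rw [← h2, mk_mem_edges] at he
        exact he (ι_of_mem_V hk)
  congr 1
  apply propext
  exact exists_congr fun a => and_congr_right fun _ => exists_congr fun b =>
    and_congr_right fun _ => hsep a b

noncomputable instance (T : StableGraph.{u} g A) : Fintype T.graph.edges := Fintype.ofFinite _

/-- The linear map `ℤ^{E(T)} → N_dist`, `δ ↦ ∑_e δ_e v_e`. Its real extension maps a metric `δ` on
the tree `T` to the class of the vector of distances between the legs of `T`. -/
noncomputable def distLin [Finite A] (T : StableGraph.{u} g A) :
    (T.graph.edges → ℤ) →ₗ[ℤ] distLattice A where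
  toFun y := ∑ e, y e • ⟨T.edgeVec e, T.edgeVec_mem e e.2⟩
  map_add' y z := by simp only [Pi.add_apply, add_smul, Finset.sum_add_distrib]
  map_smul' c y := by
    simp only [Pi.smul_apply, smul_eq_mul, mul_smul, Finset.smul_sum, RingHom.id_apply]

theorem distLin_edgeMap [Finite A] {T' T : StableGraph.{u} g A} (f : Hom T' T)
    (y : T.graph.edges → ℤ) : T'.distLin (edgeMap f.toFun y) = T.distLin y := by
  classical
  change ∑ e, edgeMap f.toFun y e • _ = ∑ e, y e • _
  have hf := f.isContraction
  symm
  have hex : ∀ e : T.graph.edges, ∃ e' : T'.graph.edges, Sym2.map f.toFun e' = e := by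
    rintro ⟨e, he⟩
    obtain ⟨h, hne, rfl⟩ := mem_edges_iff.1 he
    obtain ⟨k, rfl, -⟩ := hf.fiber_half h fun hV => hne (ι_of_mem_V hV)
    refine ⟨⟨s(k, T'.graph.ι k), mk_mem_edges.2 fun h1 => hne ?_⟩, ?_⟩
    · rw [← hf.map_ι, h1]
    · rw [Sym2.map_mk, hf.map_ι]
  choose c hc using hex
  refine Finset.sum_of_injOn c ?_ (fun _ _ => Finset.mem_coe.2 (Finset.mem_univ _)) ?_ ?_
  · intro a _ b _ hab
    exact Subtype.ext (by rw [← hc a, ← hc b, hab])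
  · intro e' _ he'
    have : Sym2.map f.toFun e' ∉ T.graph.edges := by
      intro h1
      apply he'
      refine ⟨⟨_, h1⟩, Finset.mem_coe.2 (Finset.mem_univ _), ?_⟩
      have h2 := hc ⟨_, h1⟩
      have h3 := (c ⟨_, h1⟩).2
      generalize ((c ⟨_, h1⟩ : T'.graph.edges)) = d at h2 h3 ⊢
      obtain ⟨d, hd⟩ := d
      obtain ⟨e', he''⟩ := e'
      apply Subtype.ext
      obtain ⟨h, hne, rfl⟩ := mem_edges_iff.1 hd
      obtain ⟨k, hne', rfl⟩ := mem_edges_iff.1 he''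
      simp only [Sym2.map_mk] at h1 h2
      have hV : f.toFun k ∉ T.graph.V := by
        rw [hf.map_ι, mk_mem_edges] at h1
        exact fun hV => h1 (ι_of_mem_V hV)
      change s(h, T'.graph.ι h) = s(k, T'.graph.ι k)
      rcases Sym2.eq_iff.1 h2 with ⟨h4, _⟩ | ⟨_, h4⟩
      · rw [hf.injOn hV h4.symm]
      · rw [hf.injOn hV h4.symm, T'.graph.ι_ι, Sym2.eq_swap]
    simp only [edgeMap, LinearMap.coe_mk, AddHom.coe_mk, this, dite_false, zero_smul]
  · intro e _
    have h1 : Sym2.map f.toFun (c e) ∈ T.graph.edges := by rw [hc]; exact e.2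
    congr 1
    · simp only [edgeMap, LinearMap.coe_mk, AddHom.coe_mk, h1, dite_true]
      exact congrArg y (Subtype.ext (hc e).symm)
    · apply Subtype.ext
      change T.edgeVec e = T'.edgeVec (c e)
      rw [edgeVec_map f h1 (c e).2, hc]

end StableGraph

/-- The morphism `ST_{g,A} → (N_dist)_ℝ` given by the projections `σ_T × ℝ_{>0}^g → σ_T` followed
by the distance maps of the trees `T`. -/
noncomputable def stDist (g : ℕ) (A : Type u) [Finite A] :
    stComplex.{u} g A ⟶ Functor.star _ ⋙ latticeComplex (distLattice (A ⊕ (Fin g ⊕ Fin g))) where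
  app T := ⟨T.unop.distLin ∘ₗ LinearMap.fst ℤ (T.unop.graph.edges → ℤ) (Fin g → ℤ), fun _ _ => trivial⟩
  naturality := by
    rintro ⟨T⟩ ⟨T'⟩ ⟨f⟩
    apply Poic.Hom.ext
    apply LinearMap.ext
    rintro (y : (T.graph.edges → ℤ) × (Fin g → ℤ))
    change StableGraph.Hom T' T at f
    exact StableGraph.distLin_edgeMap f y.1

end TropicalModuli

/-!
# Spanning trees and the moduli poic-space of tropical curves

The argument rests on how contractions of graphs interact with forests and cones of metrics.

*Faces.* The cone of metrics `σ_G` lies between the open and the closed orthant of `ℝ^{E(G)}`, so an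
integral functional that is non-positive on it has non-positive coefficients, and a face is cut out
by the vanishing of some coordinates. A face is non-empty, so these coordinates form a forest `Z`
(`exists_forest_of_isFace`), and the face is the cone of metrics of the graph `G / Z`
(`contract`, `IsContraction.image_metricCone`). A contraction is determined by its contracted edges
up to isomorphism (`exists_iso_of_edges_iff`), which gives the face relations of `Mtrop`. They pass
to `stComplex`, since an open orthant has no proper faces (`HasFaces.prodRight`). That `G / Z` is
again stable of the same genus follows from one count, `IsContraction.ncard_preimage`: a legless
tree with `n` vertices has `3 n - 2` flags. A stable graph has a bounded number of flags, which
gives essential finiteness.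

*Thinness.* Two contractions `f`, `f'` of stable trees coincide (`Hom.eq_of_tree`). If they differed
at a vertex `v`, an edge would separate `f v` from `f' v`. Its preimages under `f` and `f'` split
the legs in the same way, so the vertices between them, among which is `v`, carry no legs; as at
most two edges leave this set of vertices, three-valency contradicts the fact that a set of `n`
vertices of a tree spans at most `n - 1` edges (`ncard_span_le`). As every edge of a tree is a
bridge, the images of the half-edges agree as well.

*Lifts.* Cutting `g` edges of a stable graph of genus `g` into marked legs gives a stable tree as
soon as the result is connected, and gluing undoes the cutting (`cut`, `stCutIso`). Cutting the
complement of a spanning tree gives essential surjectivity (`essSurj_stFunctor`); cutting the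
preimages of the glued edges lifts a contraction onto `st(T)` (`exists_lift_stFunctor`).

*Interiors.* The linear map `stLin` is an isomorphism of lattices, and both cones have the open
orthant as relative interior (`relInterior_eq_orthant`).
-/

namespace TropicalModuli

open CategoryTheory TensorProduct
open DiscreteGraph StableGraph

/-! ### Contractions of discrete graphs -/

namespace DiscreteGraph

variable {G H : DiscreteGraph.{u}} {f : G.F → H.F}

namespace IsContraction

theorem surjective (hf : IsContraction f) : Function.Surjective f := by
  intro h
  by_cases hV : h ∈ H.V
  · have h1 := (isLeglessTreeSet_iff.1 (hf.fiber_tree h hV)).2.2.2.2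
    by_contra hne
    have h2 : f ⁻¹' {h} = ∅ := Set.eq_empty_of_forall_notMem fun k hk => hne ⟨k, hk⟩
    rw [h2] at h1
    simp at h1
  · exact (hf.fiber_half h hV).exists

theorem exists_vertex (hf : IsContraction f) {v : H.F} (hv : v ∈ H.V) : ∃ u ∈ G.V, f u = v := by
  obtain ⟨k, rfl⟩ := hf.surjective v
  exact ⟨G.r k, G.r_mem_V k, by rw [hf.map_r, mem_V_iff.1 hv]⟩

/-- The number of flags minus three times the number of vertices does not change under taking
preimages: a legless tree with `n` vertices has `3 n - 2` flags. -/
theorem ncard_preimage (hf : IsContraction f) (T : Set H.F) :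
    (f ⁻¹' T).ncard + 3 * (T ∩ H.V).ncard = T.ncard + 3 * (f ⁻¹' T ∩ G.V).ncard := by
  induction T, T.toFinite using Set.Finite.induction_on with
  | empty => simp
  | @insert a T ha hT ih =>
    have key : (f ⁻¹' {a}).ncard + 3 * ({a} ∩ H.V).ncard = 1 + 3 * (f ⁻¹' {a} ∩ G.V).ncard := by
      by_cases hV : a ∈ H.V
      · have h1 := (isLeglessTreeSet_iff.1 (hf.fiber_tree a hV)).2.2.2.2
        rw [Set.inter_eq_left.2 (Set.singleton_subset_iff.2 hV), Set.ncard_singleton]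
        omega
      · obtain ⟨k, rfl, hk⟩ := hf.fiber_half a hV
        have h1 : f ⁻¹' {f k} = {k} := by
          ext l; exact ⟨fun h => hk l h, fun h => by rw [show l = k from h]; rfl⟩
        rw [h1, Set.singleton_inter_eq_empty.2 hV,
          Set.singleton_inter_eq_empty.2 fun h => hV (hf.map_V h)]
        simp
    have hd : Disjoint (f ⁻¹' {a}) (f ⁻¹' T) :=
      Disjoint.preimage _ (Set.disjoint_singleton_left.2 ha)
    rw [← Set.singleton_union, Set.preimage_union, Set.union_inter_distrib_right,
      Set.union_inter_distrib_right, Set.ncard_union_eq hd,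
      Set.ncard_union_eq (Set.disjoint_singleton_left.2 ha), Set.ncard_singleton,
      Set.ncard_union_eq ((Set.disjoint_singleton_left.2 ha).mono Set.inter_subset_left
        Set.inter_subset_left),
      Set.ncard_union_eq (hd.mono Set.inter_subset_left Set.inter_subset_left)]
    omega

theorem isLeglessTreeSet_of_preimage (hf : IsContraction f) {T : Set H.F}
    (hT : G.IsLeglessTreeSet (f ⁻¹' T)) : H.IsLeglessTreeSet T := by
  rw [isLeglessTreeSet_iff] at hT ⊢
  obtain ⟨h1, h2, h3, h4, h5⟩ := hT
  refine ⟨fun h hh => ?_, fun h hh => ?_, fun h hh hι => ?_, fun v hv w hw => ?_, ?_⟩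
  · obtain ⟨k, rfl⟩ := hf.surjective h
    rw [← hf.map_r]; exact h1 k hh
  · obtain ⟨k, rfl⟩ := hf.surjective h
    rw [← hf.map_ι]; exact h2 k hh
  · obtain ⟨k, rfl⟩ := hf.surjective h
    by_contra hV
    rw [← hf.map_ι] at hι
    exact hV (hf.map_V (h3 k hh (hf.injOn hV hι.symm).symm))
  · obtain ⟨a, ha, rfl⟩ := hf.exists_vertex hv.2
    obtain ⟨b, hb, rfl⟩ := hf.exists_vertex hw.2
    exact hf.joined_map (fun _ h => h) (h4 a ⟨hv.1, ha⟩ b ⟨hw.1, hb⟩)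
  · have := hf.ncard_preimage T
    omega

theorem mk_map_mem_edges (hf : IsContraction f) {h : G.F} :
    Sym2.map f s(h, G.ι h) ∈ H.edges ↔ G.ι h ≠ h ∧ f h ∉ H.V := by
  rw [Sym2.map_mk, hf.map_ι, mk_mem_edges]
  constructor
  · intro h1
    exact ⟨fun h2 => h1 (by rw [← hf.map_ι, h2]), fun h2 => h1 (ι_of_mem_V h2)⟩
  · rintro ⟨h1, h2⟩ h3
    rw [← hf.map_ι] at h3
    exact h1 (hf.injOn h2 h3.symm).symm

theorem preimage_component (hf : IsContraction f) {Z : Set (Sym2 H.F)} (hZ : Z ⊆ H.edges)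
    {v : G.F} (hv : v ∈ G.V) :
    G.component {e | e ∈ G.edges ∧ (Sym2.map f e ∈ H.edges → Sym2.map f e ∈ Z)} v =
      f ⁻¹' H.component Z (f v) := by
  set Y := {e | e ∈ G.edges ∧ (Sym2.map f e ∈ H.edges → Sym2.map f e ∈ Z)} with hY
  have hZ' : ∀ h, s(h, G.ι h) ∈ Y ↔ G.ι h ≠ h ∧ (f h ∈ H.V ∨ s(f h, H.ι (f h)) ∈ Z) := by
    intro h
    rw [hY, Set.mem_ofPred_eq, mk_mem_edges, hf.mk_map_mem_edges, Sym2.map_mk, hf.map_ι]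
    tauto
  have hne : ∀ k, s(f k, H.ι (f k)) ∈ Z → G.ι k ≠ k := by
    intro k hk hι
    have := hZ hk
    rw [mk_mem_edges, ← hf.map_ι, hι] at this
    exact this rfl
  have hc : ∀ k, (k ∈ G.V ∨ s(k, G.ι k) ∈ Y) ↔ (f k ∈ H.V ∨ s(f k, H.ι (f k)) ∈ Z) := by
    intro k
    rw [hZ']
    constructor
    · rintro (h1 | h1)
      · exact Or.inl (hf.map_V h1)
      · exact h1.2
    · intro h1
      by_cases hι : G.ι k = k
      · exact Or.inl (h1.elim (hf.mem_V_of_map hι) fun h2 => (hne k h2 hι).elim)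
      · exact Or.inr ⟨hι, h1⟩
  -- Adding the vertices to the flags along which one walks changes nothing.
  have hV : ∀ (K : DiscreteGraph.{u}) (W : Set (Sym2 K.F)) (a b : K.F),
      K.Joined {k | k ∈ K.V ∨ s(k, K.ι k) ∈ W} a b → K.Joined {k | s(k, K.ι k) ∈ W} a b := by
    intro K W a b h
    induction h with
    | refl => exact .refl
    | tail _ h3 ih =>
      obtain ⟨k, hk | hk, rfl, rfl⟩ := h3
      · rwa [ι_of_mem_V hk]
      · exact ih.tail ⟨k, hk, rfl, rfl⟩
  ext h
  refine and_congr (hc h) ⟨fun h1 => ?_, fun h1 => ?_⟩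
  · have h2 := hf.joined_map (B' := {k | k ∈ H.V ∨ s(k, H.ι k) ∈ Z})
      (fun k hk => ((hZ' k).1 hk).2) h1
    rw [hf.map_r] at h2
    exact hV _ _ _ _ h2
  · exact hV _ _ _ _ (hf.joined_lift (W := H.V) (B := {k | s(k, H.ι k) ∈ Z})
      (B' := {k | k ∈ G.V ∨ s(k, G.ι k) ∈ Y}) hv
      (hf.map_V hv) (fun _ _ => H.r_mem_V _) (fun k hk => (hc k).2 (Or.inr hk))
      (fun k hk => (hc k).2 (Or.inl hk)) h1 (G.r h) (G.r_mem_V h) (hf.map_r h))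

/-- The image of a forest that contains all contracted edges is a forest. -/
theorem isForest_of_preimage (hf : IsContraction f) {Z : Set (Sym2 H.F)} (hZ : Z ⊆ H.edges)
    (h : G.IsForest {e | e ∈ G.edges ∧ (Sym2.map f e ∈ H.edges → Sym2.map f e ∈ Z)}) :
    H.IsForest Z := by
  refine ⟨hZ, fun w hw => ?_⟩
  obtain ⟨v, hv, rfl⟩ := hf.exists_vertex hw
  exact hf.isLeglessTreeSet_of_preimage (hf.preimage_component hZ hv ▸ h.2 v hv)

theorem of_bijective (hb : Function.Bijective f) (hr : ∀ h, f (G.r h) = H.r (f h))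
    (hι : ∀ h, f (G.ι h) = H.ι (f h)) : IsContraction f where
  map_r := hr
  map_ι := hι
  fiber_tree v hv := by
    obtain ⟨k, rfl⟩ := hb.2 v
    have h1 : f ⁻¹' {f k} = (fun h : G.F => h) ⁻¹' {k} := by
      ext l; exact ⟨fun h => hb.1 h, fun h => congrArg f h⟩
    rw [h1]
    refine (IsContraction.id G).fiber_tree k ?_
    rw [mem_V_iff] at hv ⊢
    exact hb.1 (by rw [hr, hv])
  fiber_half h _ := hb.existsUnique h

theorem exists_edge (hf : IsContraction f) (e : H.edges) :
    ∃ e' : G.edges, Sym2.map f e' = e := by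
  obtain ⟨e, he⟩ := e
  obtain ⟨h, hne, rfl⟩ := mem_edges_iff.1 he
  obtain ⟨k, rfl⟩ := hf.surjective h
  rw [← hf.map_ι] at hne
  exact ⟨⟨s(k, G.ι k), mk_mem_edges.2 fun h1 => hne (by rw [h1])⟩, by
    rw [Sym2.map_mk, hf.map_ι]⟩

theorem edge_injective (hf : IsContraction f) {e e' : Sym2 G.F} (he : e ∈ G.edges)
    (he' : e' ∈ G.edges) (h : Sym2.map f e ∈ H.edges) (hee : Sym2.map f e = Sym2.map f e') :
    e = e' := by
  obtain ⟨k, hk, rfl⟩ := mem_edges_iff.1 he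
  obtain ⟨l, hl, rfl⟩ := mem_edges_iff.1 he'
  have hV := (hf.mk_map_mem_edges.1 h).2
  rw [Sym2.map_mk, Sym2.map_mk] at hee
  rcases Sym2.eq_iff.1 hee with ⟨h1, _⟩ | ⟨h1, _⟩
  · rw [hf.injOn hV h1]
  · rw [hf.injOn hV h1, G.ι_ι, Sym2.eq_swap]

end IsContraction

/-- If `f'` contracts every edge that `f` contracts, it is constant on the fibres of `f`. -/
theorem IsContraction.eq_of_eq {K : DiscreteGraph.{u}} {f : G.F → H.F} {f' : G.F → K.F}
    (hf : IsContraction f) (hf' : IsContraction f')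
    (hff : ∀ e ∈ G.edges, Sym2.map f' e ∈ K.edges → Sym2.map f e ∈ H.edges) {a b : G.F}
    (hab : f a = f b) : f' a = f' b := by
  by_cases hV : f a ∈ H.V
  · -- A flag that `f` maps to a vertex has the same image under `f'` as its root.
    have h1 : ∀ c, f c ∈ H.V → f' c = f' (G.r c) := by
      intro c hc
      by_cases hι : G.ι c = c
      · rw [mem_V_iff.1 (hf.mem_V_of_map hι hc)]
      · have h2 : f' c ∈ K.V := by
          by_contra h2
          exact (hf.mk_map_mem_edges.1 (hff _ (mk_mem_edges.2 hι)
            (hf'.mk_map_mem_edges.2 ⟨hι, h2⟩))).2 hc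
        rw [hf'.map_r, mem_V_iff.1 h2]
    have h2 := hf.joined_of_fiber (G.r_mem_V a) (G.r_mem_V b) (by rw [hf.map_r, hf.map_r, hab])
    rw [h1 a hV, h1 b (hab ▸ hV)]
    have h3 : f (G.r a) ∈ H.V := hf.map_V (G.r_mem_V a)
    generalize G.r a = x at h2 h3
    generalize G.r b = y at h2
    induction h2 with
    | refl => rfl
    | tail _ h4 ih =>
      obtain ⟨k, hk, rfl, rfl⟩ := h4
      have hk : f k = f x := hk
      rw [ih, ← h1 k (hk ▸ h3), ← h1 (G.ι k) (by rw [hf.map_ι, ι_of_mem_V (hk ▸ h3), hk]; exact h3)]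
      by_cases hι : G.ι k = k
      · rw [hι]
      · rw [hf'.map_ι]
        refine (ι_of_mem_V ?_).symm
        by_contra h5
        exact (hf.mk_map_mem_edges.1 (hff _ (mk_mem_edges.2 hι)
            (hf'.mk_map_mem_edges.2 ⟨hι, h5⟩))).2 (hk ▸ h3)
  · rw [hf.injOn hV hab]

/-! ### The contraction of a forest -/

section Contract

variable (G) (Z : Set (Sym2 G.F))

/-- The relation of being joined by edges of `Z`. -/
def joinSetoid : Setoid G.F where
  r := G.Joined {k | s(k, G.ι k) ∈ Z}
  iseqv := ⟨fun _ => .refl, fun h => h.symm fun k hk => by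
    rwa [Set.mem_ofPred_eq, G.ι_ι, Sym2.eq_swap], fun h h' => h.trans h'⟩

open Classical in
/-- The map of flags that sends every vertex, and every flag of an edge in `Z`, to a chosen vertex
of its component with respect to `Z`, and that fixes all other flags. -/
noncomputable def collapse (h : G.F) : G.F :=
  if h ∈ G.V ∨ s(h, G.ι h) ∈ Z then (Quotient.mk (G.joinSetoid Z) (G.r h)).out else h

variable {G Z}

theorem collapse_of_not {h : G.F} (hh : ¬ (h ∈ G.V ∨ s(h, G.ι h) ∈ Z)) : G.collapse Z h = h :=
  if_neg hh

theorem collapse_eq_r {h : G.F} (hh : h ∈ G.V ∨ s(h, G.ι h) ∈ Z) :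
    G.collapse Z h = G.collapse Z (G.r h) := by
  rw [collapse, if_pos hh, collapse, if_pos (Or.inl (G.r_mem_V h)), G.r_r]

theorem joined_collapse {v : G.F} (hv : v ∈ G.V) :
    G.Joined {k | s(k, G.ι k) ∈ Z} v (G.collapse Z v) := by
  rw [collapse, if_pos (Or.inl hv), mem_V_iff.1 hv]
  exact (G.joinSetoid Z).symm (Quotient.mk_out (s := G.joinSetoid Z) v)

theorem Joined.mem_V {B : Set G.F} {v w : G.F} (h : G.Joined B v w) (hv : v ∈ G.V) :
    w ∈ G.V := by
  induction h with
  | refl => exact hv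
  | tail _ h2 _ => obtain ⟨k, _, _, rfl⟩ := h2; exact G.r_mem_V _

theorem collapse_mem_V {h : G.F} (hh : h ∈ G.V ∨ s(h, G.ι h) ∈ Z) : G.collapse Z h ∈ G.V := by
  rw [collapse_eq_r hh]
  exact (joined_collapse (G.r_mem_V h)).mem_V (G.r_mem_V h)

theorem collapse_eq_collapse_iff {v w : G.F} (hv : v ∈ G.V) (hw : w ∈ G.V) :
    G.collapse Z v = G.collapse Z w ↔ G.Joined {k | s(k, G.ι k) ∈ Z} v w := by
  rw [collapse, if_pos (Or.inl hv), collapse, if_pos (Or.inl hw), mem_V_iff.1 hv,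
    mem_V_iff.1 hw, Quotient.out_inj, Quotient.eq]
  rfl

theorem collapse_collapse (h : G.F) : G.collapse Z (G.collapse Z h) = G.collapse Z h := by
  by_cases hh : h ∈ G.V ∨ s(h, G.ι h) ∈ Z
  · rw [collapse_eq_r hh, collapse_eq_collapse_iff (collapse_mem_V (Or.inl (G.r_mem_V h)))
      (G.r_mem_V h)]
    exact (G.joinSetoid Z).symm (joined_collapse (G.r_mem_V h))
  · rw [collapse_of_not hh, collapse_of_not hh]

theorem collapse_r_collapse (h : G.F) :
    G.collapse Z (G.r (G.collapse Z h)) = G.collapse Z (G.r h) := by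
  by_cases hh : h ∈ G.V ∨ s(h, G.ι h) ∈ Z
  · rw [mem_V_iff.1 (collapse_mem_V hh), collapse_collapse, collapse_eq_r hh]
  · rw [collapse_of_not hh]

theorem collapse_ι (h : G.F) : G.collapse Z (G.ι h) = G.ι (G.collapse Z h) := by
  by_cases hh : h ∈ G.V ∨ s(h, G.ι h) ∈ Z
  · rw [ι_of_mem_V (collapse_mem_V hh)]
    rcases hh with hh | hh
    · rw [ι_of_mem_V hh]
    · have h1 : s(G.ι h, G.ι (G.ι h)) ∈ Z := by rwa [G.ι_ι, Sym2.eq_swap]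
      rw [collapse_eq_r (Or.inr h1), collapse_eq_r (Or.inr hh),
        collapse_eq_collapse_iff (G.r_mem_V _) (G.r_mem_V _)]
      exact .single ⟨G.ι h, h1, rfl, by rw [G.ι_ι]⟩
  · rw [collapse_of_not hh, collapse_of_not]
    rintro (h1 | h1)
    · have h2 := ι_of_mem_V h1
      rw [G.ι_ι] at h2
      exact hh (Or.inl (h2 ▸ h1))
    · rw [G.ι_ι, Sym2.eq_swap] at h1
      exact hh (Or.inr h1)

variable (G Z)

/-- The graph `G / Z` in which every component of `Z` is contracted to a vertex. Its flags are the
fixed points of `collapse`. -/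
noncomputable abbrev contract : DiscreteGraph.{u} where
  F := {h : G.F // G.collapse Z h = h}
  r h := ⟨G.collapse Z (G.r h), collapse_collapse _⟩
  ι h := ⟨G.ι h, by rw [collapse_ι, h.2]⟩
  r_r h := Subtype.ext (by
    show G.collapse Z (G.r (G.collapse Z (G.r h))) = _
    rw [collapse_r_collapse, G.r_r])
  ι_ι h := Subtype.ext (G.ι_ι h)
  ι_r h := Subtype.ext (by
    show G.ι (G.collapse Z (G.r h)) = G.collapse Z (G.r h)
    rw [← collapse_ι, G.ι_r])

/-- The projection `G → G / Z`. -/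
noncomputable def contractMap (h : G.F) : (G.contract Z).F := ⟨G.collapse Z h, collapse_collapse _⟩

variable {G Z}

theorem contractMap_mem_V {h : G.F} (hh : h ∈ G.V ∨ s(h, G.ι h) ∈ Z) :
    G.contractMap Z h ∈ (G.contract Z).V := by
  refine mem_V_iff.2 (Subtype.ext ?_)
  show G.collapse Z (G.r (G.collapse Z h)) = G.collapse Z h
  rw [collapse_r_collapse, collapse_eq_r hh]

theorem collapsed_of_contractMap_mem_V {h : G.F} (hh : G.contractMap Z h ∈ (G.contract Z).V) :
    h ∈ G.V ∨ s(h, G.ι h) ∈ Z := by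
  by_contra h1
  have h2 : G.collapse Z (G.r (G.collapse Z h)) = G.collapse Z h :=
    congrArg Subtype.val (mem_V_iff.1 hh)
  rw [collapse_of_not h1] at h2
  exact h1 (Or.inl (h2 ▸ collapse_mem_V (Or.inl (G.r_mem_V h))))

theorem isContraction_contractMap (hZ : G.IsForest Z) : IsContraction (G.contractMap Z) where
  map_r h := Subtype.ext (collapse_r_collapse h).symm
  map_ι h := Subtype.ext (collapse_ι h)
  fiber_tree v hv := by
    have hfix : v = G.contractMap Z v := Subtype.ext v.2.symm
    have h1 : (v : G.F) ∈ G.V ∨ s((v : G.F), G.ι v) ∈ Z :=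
      collapsed_of_contractMap_mem_V (hfix ▸ hv)
    have hV : (v : G.F) ∈ G.V := v.2 ▸ collapse_mem_V h1
    convert hZ.2 v hV using 1
    ext h
    have h2 : h ∈ G.contractMap Z ⁻¹' {v} ↔ G.collapse Z h = v := Subtype.ext_iff
    rw [h2]
    constructor
    · intro h3
      have h4 : h ∈ G.V ∨ s(h, G.ι h) ∈ Z := by
        by_contra h4
        rw [collapse_of_not h4] at h3
        exact h4 (h3 ▸ h1)
      refine ⟨h4, (collapse_eq_collapse_iff hV (G.r_mem_V h)).1 ?_⟩
      rw [v.2, ← collapse_eq_r h4, h3]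
    · rintro ⟨h3, h4⟩
      rw [collapse_eq_r h3, ← (collapse_eq_collapse_iff hV (G.r_mem_V h)).2 h4, v.2]
  fiber_half h hh := by
    refine ⟨h, Subtype.ext h.2, fun k hk => ?_⟩
    have h1 : ¬ (k ∈ G.V ∨ s(k, G.ι k) ∈ Z) := fun h1 => hh (hk ▸ contractMap_mem_V h1)
    rw [← hk]
    exact (collapse_of_not h1).symm

theorem map_contractMap_mem_edges (hZ : G.IsForest Z) {e : Sym2 G.F} (he : e ∈ G.edges) :
    Sym2.map (G.contractMap Z) e ∈ (G.contract Z).edges ↔ e ∉ Z := by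
  obtain ⟨h, hne, rfl⟩ := mem_edges_iff.1 he
  rw [(isContraction_contractMap hZ).mk_map_mem_edges]
  constructor
  · exact fun h1 h2 => h1.2 (contractMap_mem_V (Or.inr h2))
  · exact fun h1 => ⟨hne, fun h2 => (collapsed_of_contractMap_mem_V h2).elim
      (fun h3 => hne (ι_of_mem_V h3)) h1⟩

end Contract

/-! ### Contractions of stable graphs -/

theorem four_mul_ncard_le (hG : ∀ v ∈ G.V, 3 ≤ G.val v) {U : Set G.F} (hU : U ⊆ G.V) :
    4 * U.ncard ≤ (G.r ⁻¹' U).ncard := by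
  induction U, U.toFinite using Set.Finite.induction_on with
  | empty => simp
  | @insert a U ha _ ih =>
    have hd : Disjoint (G.r ⁻¹' {a}) (G.r ⁻¹' U) :=
      Disjoint.preimage _ (Set.disjoint_singleton_left.2 ha)
    have h1 := hG a (hU (Set.mem_insert _ _))
    have h2 := ih ((Set.subset_insert _ _).trans hU)
    rw [val] at h1
    rw [Set.ncard_insert_of_notMem ha, ← Set.singleton_union, Set.preimage_union,
      Set.ncard_union_eq hd]
    omega

end DiscreteGraph

namespace StableGraph

variable {g : ℕ} {A : Type u}

/-- The markings of the legs of a contraction of `G`. -/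
noncomputable def contractionMark (G : StableGraph.{u} g A) {H : DiscreteGraph.{u}}
    {f : G.graph.F → H.F} (hf : IsContraction f) : A ≃ H.legs :=
  Equiv.ofBijective (fun a => ⟨f (G.mark a), fun hV =>
      (G.mark a).2.1 (hf.mem_V_of_map (G.ι_mark a) hV), by rw [← hf.map_ι, G.ι_mark]⟩) <| by
    constructor
    · intro a b hab
      have h1 : f (G.mark a) = f (G.mark b) := congrArg Subtype.val hab
      exact G.mark_injective (hf.injOn
        (fun hV => (G.mark a).2.1 (hf.mem_V_of_map (G.ι_mark a) hV)) h1)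
    · rintro ⟨h, hV, hι⟩
      obtain ⟨k, rfl⟩ := hf.surjective h
      rw [← hf.map_ι] at hι
      obtain ⟨a, rfl⟩ := exists_mark (G := G) (h := k)
        ⟨fun h1 => hV (hf.map_V h1), (hf.injOn hV hι.symm).symm⟩
      exact ⟨a, rfl⟩

/-- A contraction of a stable graph is stable of the same genus. -/
noncomputable abbrev ofContraction (G : StableGraph.{u} g A) {H : DiscreteGraph.{u}}
    {f : G.graph.F → H.F} (hf : IsContraction f) : StableGraph.{u} g A where
  graph := H
  mark := G.contractionMark hf
  connected v hv w hw := by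
    obtain ⟨a, ha, rfl⟩ := hf.exists_vertex hv
    obtain ⟨b, hb, rfl⟩ := hf.exists_vertex hw
    exact hf.joined_map (fun _ h => h) (G.connected a ha b hb)
  genus_eq := by
    have h1 := hf.ncard_preimage Set.univ
    rw [Set.preimage_univ, Set.univ_inter, Set.univ_inter, Set.ncard_univ, Set.ncard_univ,
      card_flags, card_flags] at h1
    have h2 : H.legs.ncard = G.graph.legs.ncard := by
      rw [← Nat.card_coe_set_eq, ← Nat.card_coe_set_eq, ← Nat.card_congr G.mark,
        ← Nat.card_congr (G.contractionMark hf)]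
    have h3 := G.genus_eq
    rw [genus] at h3 ⊢
    omega
  three_le_val v hv := by
    -- If `n` vertices are contracted to `v`, at least `4 n` flags of `G` are rooted at them.
    have h1 := hf.ncard_preimage (H.r ⁻¹' {v})
    have h2 : H.r ⁻¹' {v} ∩ H.V = {v} := by
      ext x
      constructor
      · rintro ⟨h3, h4⟩; exact (mem_V_iff.1 h4).symm.trans h3
      · rintro rfl; exact ⟨mem_V_iff.1 hv, hv⟩
    have h3 : f ⁻¹' (H.r ⁻¹' {v}) = G.graph.r ⁻¹' (f ⁻¹' (H.r ⁻¹' {v}) ∩ G.graph.V) := by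
      ext x
      simp only [Set.mem_preimage, Set.mem_inter_iff, hf.map_r, H.r_r, G.graph.r_mem_V, and_true]
    have h4 := four_mul_ncard_le G.three_le_val
      (Set.inter_subset_right (s := f ⁻¹' (H.r ⁻¹' {v})) (t := G.graph.V))
    rw [← h3] at h4
    obtain ⟨a, ha, rfl⟩ := hf.exists_vertex hv
    have h5 : 0 < (f ⁻¹' (H.r ⁻¹' {f a}) ∩ G.graph.V).ncard :=
      (Set.ncard_pos).2 ⟨a, mem_V_iff.1 hv, ha⟩
    rw [h2, Set.ncard_singleton] at h1
    rw [val]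
    omega

/-- A bijection of flags that respects root maps, involutions and markings is an isomorphism. -/
noncomputable def isoOfEquiv {G H : StableGraph.{u} g A} (e : G.graph.F ≃ H.graph.F)
    (hr : ∀ h, e (G.graph.r h) = H.graph.r (e h)) (hι : ∀ h, e (G.graph.ι h) = H.graph.ι (e h))
    (hm : ∀ a, e (G.mark a) = H.mark a) : G ≅ H where
  hom := (⟨e, .of_bijective e.bijective hr hι, hm⟩ : Hom G H)
  inv := (⟨e.symm, .of_bijective e.symm.bijective
    (fun h => by rw [Equiv.symm_apply_eq, hr, Equiv.apply_symm_apply])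
    (fun h => by rw [Equiv.symm_apply_eq, hι, Equiv.apply_symm_apply]),
    fun a => by rw [Equiv.symm_apply_eq, hm]⟩ : Hom H G)
  hom_inv_id := Hom.ext (funext fun h => e.symm_apply_apply h)
  inv_hom_id := Hom.ext (funext fun h => e.apply_symm_apply h)

/-- Two contractions of `G` with the same contracted edges differ by an isomorphism. -/
theorem exists_iso_of_edges_iff {G H K : StableGraph.{u} g A} (f : Hom G H) (f' : Hom G K)
    (hff : ∀ e ∈ G.graph.edges,
      Sym2.map f.toFun e ∈ H.graph.edges ↔ Sym2.map f'.toFun e ∈ K.graph.edges) :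
    ∃ k : H ≅ K, ∀ h, k.hom.toFun (f.toFun h) = f'.toFun h := by
  have hf := f.isContraction
  have hf' := f'.isContraction
  have key : ∀ a b, f.toFun a = f.toFun b ↔ f'.toFun a = f'.toFun b := fun a b =>
    ⟨hf.eq_of_eq hf' fun e he => (hff e he).2, hf'.eq_of_eq hf fun e he => (hff e he).1⟩
  have hs : ∀ h, f'.toFun (Function.surjInv hf.surjective (f.toFun h)) = f'.toFun h :=
    fun h => (key _ _).1 (Function.surjInv_eq _ _)
  have hb : Function.Bijective fun x => f'.toFun (Function.surjInv hf.surjective x) := by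
    constructor
    · intro x y hxy
      obtain ⟨a, rfl⟩ := hf.surjective x
      obtain ⟨b, rfl⟩ := hf.surjective y
      simp only [hs] at hxy
      exact (key a b).2 hxy
    · intro y
      obtain ⟨a, rfl⟩ := hf'.surjective y
      exact ⟨f.toFun a, hs a⟩
  refine ⟨isoOfEquiv (Equiv.ofBijective _ hb) ?_ ?_ ?_, fun h => hs h⟩
  · intro x
    obtain ⟨a, rfl⟩ := hf.surjective x
    simp only [Equiv.ofBijective_apply]
    rw [← hf.map_r, hs, hs, hf'.map_r]
  · intro x
    obtain ⟨a, rfl⟩ := hf.surjective x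
    simp only [Equiv.ofBijective_apply]
    rw [← hf.map_ι, hs, hs, hf'.map_ι]
  · intro a
    simp only [Equiv.ofBijective_apply]
    rw [← f.map_mark, hs, f'.map_mark]

end StableGraph

/-! ### Cones between the open and the closed orthant -/

section Orthant

variable {N : Type u} [AddCommGroup N] {M : Type v} [AddCommGroup M]

theorem IsPartiallyOpenCone.smul_mem {σ : Set (ℝ ⊗[ℤ] N)} (hσ : IsPartiallyOpenCone σ) {x}
    (hx : x ∈ σ) {c : ℝ} (hc : 0 < c) : c • x ∈ σ := by
  obtain ⟨-, s, t, -, -, rfl⟩ := hσ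
  refine ⟨fun f hf => ?_, fun f hf => ?_⟩
  · rw [map_smul, smul_eq_mul]; exact mul_nonneg hc.le (hx.1 f hf)
  · rw [map_smul, smul_eq_mul]; exact mul_pos hc (hx.2 f hf)

theorem realFunctional_neg (φ : N →ₗ[ℤ] ℤ) (x : ℝ ⊗[ℤ] N) :
    realFunctional (-φ) x = -realFunctional φ x := by
  rw [eq_neg_iff_add_eq_zero, ← realFunctional_add, neg_add_cancel, realFunctional_zero]

theorem baseChange_surjective {φ : N →ₗ[ℤ] M} (h : Function.Surjective φ) :
    Function.Surjective (φ.baseChange ℝ) :=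
  LinearMap.lTensor_surjective ℝ h

theorem relInterior_image {φ : N →ₗ[ℤ] M} (hφ : Function.Bijective φ) (σ : Set (ℝ ⊗[ℤ] N)) :
    φ.baseChange ℝ '' relInterior σ = relInterior (φ.baseChange ℝ '' σ) := by
  set e := LinearEquiv.ofBijective φ hφ
  have he : ∀ f : N →ₗ[ℤ] ℤ, (f ∘ₗ e.symm.toLinearMap) ∘ₗ φ = f := fun f =>
    LinearMap.ext fun n => congrArg f (e.symm_apply_apply n)
  ext y
  constructor
  · rintro ⟨x, ⟨hx, h1⟩, rfl⟩
    refine ⟨⟨x, hx, rfl⟩, fun f h2 h3 => ?_⟩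
    rw [realFunctional_baseChange]
    refine h1 _ (fun z hz => ?_) ?_
    · rw [← realFunctional_baseChange]; exact h2 _ ⟨z, hz, rfl⟩
    · obtain ⟨_, ⟨z, hz, rfl⟩, h4⟩ := h3
      exact ⟨z, hz, by rwa [← realFunctional_baseChange]⟩
  · rintro ⟨⟨x, hx, rfl⟩, h1⟩
    refine ⟨x, ⟨hx, fun f h2 h3 => ?_⟩, rfl⟩
    have h4 := h1 (f ∘ₗ e.symm.toLinearMap)
    simp only [Set.forall_mem_image, Set.exists_mem_image, realFunctional_baseChange, he] at h4
    exact h4 (fun z hz => h2 z hz) h3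

variable {E : Type u} [Fintype E]

theorem realFunctional_eq_sum [DecidableEq E] (f : (E → ℤ) →ₗ[ℤ] ℤ) (x : ℝ ⊗[ℤ] (E → ℤ)) :
    realFunctional f x = ∑ e, f (Pi.single e 1) * realFunctional (LinearMap.proj e) x := by
  induction x using TensorProduct.induction_on with
  | zero => simp
  | tmul a n =>
    rw [realFunctional_tmul, LinearMap.pi_apply_eq_sum_univ f n]
    simp only [realFunctional_tmul, LinearMap.proj_apply, smul_eq_mul]
    push_cast
    rw [Finset.sum_mul]
    refine Finset.sum_congr rfl fun e _ => ?_
    rw [show (fun j => if e = j then (1 : ℤ) else 0) = Pi.single e 1 by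
      ext j; simp [Pi.single_apply, eq_comm]]
    ring
  | add x y hx hy =>
    simp only [map_add, hx, hy, mul_add, Finset.sum_add_distrib]

theorem exists_coordinates (y : E → ℝ) :
    ∃ x : ℝ ⊗[ℤ] (E → ℤ), ∀ e, realFunctional (LinearMap.proj e) x = y e := by
  classical
  refine ⟨∑ e, y e ⊗ₜ Pi.single e 1, fun e => ?_⟩
  simp [map_sum, Pi.single_apply]

theorem eq_of_coordinates {x y : ℝ ⊗[ℤ] (E → ℤ)}
    (h : ∀ e, realFunctional (LinearMap.proj e) x = realFunctional (LinearMap.proj e) y) :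
    x = y := by
  classical
  have key : ∀ x : ℝ ⊗[ℤ] (E → ℤ),
      x = ∑ e, realFunctional (LinearMap.proj e) x ⊗ₜ Pi.single e 1 := by
    intro x
    induction x using TensorProduct.induction_on with
    | zero => simp
    | tmul a n =>
      conv_lhs => rw [← Finset.univ_sum_single n, TensorProduct.tmul_sum]
      refine Finset.sum_congr rfl fun e _ => ?_
      rw [realFunctional_tmul, LinearMap.proj_apply, ← zsmul_eq_mul, TensorProduct.smul_tmul,
        ← Pi.single_smul, smul_eq_mul, mul_one]
    | add x y hx hy =>
      simp only [map_add, TensorProduct.add_tmul, Finset.sum_add_distrib]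
      rw [← hx, ← hy]
  rw [key x, key y]
  simp only [h]

/-- If an integral functional is non-positive on the open orthant, so are its coefficients. -/
theorem coeff_nonpos [DecidableEq E] {σ : Set (ℝ ⊗[ℤ] (E → ℤ))}
    (hσ : ∀ x, (∀ e, 0 < realFunctional (LinearMap.proj e) x) → x ∈ σ) {f : (E → ℤ) →ₗ[ℤ] ℤ}
    (hf : ∀ x ∈ σ, realFunctional f x ≤ 0) (e : E) : f (Pi.single e 1) ≤ 0 := by
  by_contra hcon
  push Not at hcon
  have hc : (1 : ℝ) ≤ f (Pi.single e 1) := by exact_mod_cast hcon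
  set C : ℝ := ∑ e', (f (Pi.single e' 1) : ℝ) with hC
  -- The point with coordinate `|C| + 2` at `e` and all other coordinates one.
  obtain ⟨x, hx⟩ := exists_coordinates fun e' : E => if e' = e then |C| + 2 else (1 : ℝ)
  have h1 := hf x (hσ x fun e' => by rw [hx]; split_ifs <;> positivity)
  rw [realFunctional_eq_sum] at h1
  have h2 : ∑ e', (f (Pi.single e' 1) : ℝ) * realFunctional (LinearMap.proj e') x =
      C + f (Pi.single e 1) * (|C| + 1) := by
    have h3 : ∀ e', (f (Pi.single e' 1) : ℝ) * realFunctional (LinearMap.proj e') x =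
        f (Pi.single e' 1) + if e' = e then f (Pi.single e 1) * (|C| + 1) else 0 := by
      intro e'
      rw [hx]
      split_ifs with h
      · subst h; ring
      · ring
    simp only [h3, Finset.sum_add_distrib, Finset.sum_ite_eq', Finset.mem_univ, if_true]
    rfl
  rw [h2] at h1
  nlinarith [neg_abs_le C, abs_nonneg C]

/-- The faces of a cone between the open and the closed orthant are cut out by coordinates. -/
theorem IsFace.exists_coordinates {σ τ : Set (ℝ ⊗[ℤ] (E → ℤ))}
    (hσ : ∀ x, (∀ e, 0 < realFunctional (LinearMap.proj e) x) → x ∈ σ)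
    (hσ' : ∀ x ∈ σ, ∀ e, 0 ≤ realFunctional (LinearMap.proj e) x) (hτ : IsFace τ σ) :
    ∃ Y : Set E, τ = {x | x ∈ σ ∧ ∀ e ∈ Y, realFunctional (LinearMap.proj e) x = 0} := by
  classical
  obtain ⟨-, f, hf, rfl⟩ := hτ
  have hc : ∀ e, (f (Pi.single e 1) : ℝ) ≤ 0 := fun e => by exact_mod_cast coeff_nonpos hσ hf e
  refine ⟨{e | f (Pi.single e 1) ≠ 0}, ?_⟩
  ext x
  refine and_congr_right fun hx => ?_
  have hle : ∀ e ∈ Finset.univ,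
      (f (Pi.single e 1) : ℝ) * realFunctional (LinearMap.proj e) x ≤ 0 := fun e _ =>
    mul_nonpos_of_nonpos_of_nonneg (hc e) (hσ' x hx e)
  rw [realFunctional_eq_sum]
  constructor
  · intro h e he
    have h1 := (Finset.sum_eq_zero_iff_of_nonpos hle).1
      (le_antisymm (Finset.sum_nonpos hle) h) e (Finset.mem_univ e)
    exact (mul_eq_zero.1 h1).resolve_left fun h2 => he (by exact_mod_cast h2)
  · intro h
    refine (Finset.sum_eq_zero fun e _ => ?_).ge
    by_cases he : f (Pi.single e 1) = 0
    · rw [he]; simp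
    · rw [h e he, mul_zero]

theorem isFace_of_coordinates {σ : Set (ℝ ⊗[ℤ] (E → ℤ))}
    (hσ' : ∀ x ∈ σ, ∀ e, 0 ≤ realFunctional (LinearMap.proj e) x) (Y : Set E)
    (hne : ∃ x ∈ σ, ∀ e ∈ Y, realFunctional (LinearMap.proj e) x = 0) :
    IsFace {x | x ∈ σ ∧ ∀ e ∈ Y, realFunctional (LinearMap.proj e) x = 0} σ := by
  classical
  have hnn : ∀ x ∈ σ, ∀ e ∈ Y.toFinset, 0 ≤ realFunctional (LinearMap.proj e) x :=
    fun x hx e _ => hσ' x hx e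
  refine ⟨hne, -∑ e ∈ Y.toFinset, LinearMap.proj e, fun x hx => ?_, ?_⟩
  · rw [realFunctional_neg, realFunctional_sum, neg_nonpos]
    exact Finset.sum_nonneg (hnn x hx)
  · ext x
    refine and_congr_right fun hx => ?_
    rw [realFunctional_neg, realFunctional_sum, neg_nonneg]
    constructor
    · intro h
      exact (Finset.sum_eq_zero fun e he => h e (Set.mem_toFinset.1 he)).le
    · intro h e he
      exact (Finset.sum_eq_zero_iff_of_nonneg (hnn x hx)).1
        (le_antisymm h (Finset.sum_nonneg (hnn x hx))) e (Set.mem_toFinset.2 he)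

theorem relInterior_eq_orthant {σ : Set (ℝ ⊗[ℤ] (E → ℤ))}
    (hσ : ∀ x, (∀ e, 0 < realFunctional (LinearMap.proj e) x) → x ∈ σ)
    (hσ' : ∀ x ∈ σ, ∀ e, 0 ≤ realFunctional (LinearMap.proj e) x) :
    relInterior σ = {x | ∀ e, 0 < realFunctional (LinearMap.proj e) x} := by
  classical
  ext x
  constructor
  · rintro ⟨-, h⟩ e
    refine h _ (fun y hy => hσ' y hy e) ?_
    obtain ⟨y, hy⟩ := exists_coordinates fun _ : E => (1 : ℝ)
    exact ⟨y, hσ y fun e' => by rw [hy]; exact one_pos, by rw [hy]; exact one_ne_zero⟩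
  · intro hx
    refine ⟨hσ x hx, fun f hf hne => ?_⟩
    have hc : ∀ e, (0 : ℝ) ≤ f (Pi.single e 1) := fun e => by
      have h1 := coeff_nonpos hσ (f := -f)
        (fun y hy => by rw [realFunctional_neg]; exact neg_nonpos.2 (hf y hy)) e
      rw [LinearMap.neg_apply, neg_nonpos] at h1
      exact_mod_cast h1
    have hnn : ∀ e ∈ Finset.univ,
        0 ≤ (f (Pi.single e 1) : ℝ) * realFunctional (LinearMap.proj e) x := fun e _ =>
      mul_nonneg (hc e) (hx e).le
    rw [realFunctional_eq_sum]
    refine lt_of_le_of_ne (Finset.sum_nonneg hnn) fun h0 => ?_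
    obtain ⟨y, -, hy⟩ := hne
    refine hy ?_
    rw [realFunctional_eq_sum]
    refine Finset.sum_eq_zero fun e he => ?_
    rw [(mul_eq_zero.1 ((Finset.sum_eq_zero_iff_of_nonneg hnn).1 h0.symm e he)).resolve_right
      (hx e).ne', zero_mul]

end Orthant

/-! ### Faces of cones of metrics -/

namespace DiscreteGraph

variable {G H : DiscreteGraph.{u}} {f : G.F → H.F}

theorem mem_metricCone_of_pos {x : ℝ ⊗[ℤ] (G.edges → ℤ)}
    (h : ∀ e, 0 < realFunctional (LinearMap.proj e) x) : x ∈ G.metricCone :=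
  ⟨∅, G.isForest_empty, fun e => ⟨fun h => h.elim, fun _ => h e⟩⟩

theorem realFunctional_edgeMap_of_mem {e : G.edges} (h : Sym2.map f e ∈ H.edges)
    (x : ℝ ⊗[ℤ] (H.edges → ℤ)) :
    realFunctional (LinearMap.proj e) ((edgeMap f).baseChange ℝ x) =
      realFunctional (LinearMap.proj (⟨_, h⟩ : H.edges)) x := by
  rw [realFunctional_baseChange, proj_comp_edgeMap_of_mem h]

theorem realFunctional_edgeMap_of_notMem {e : G.edges} (h : Sym2.map f e ∉ H.edges)
    (x : ℝ ⊗[ℤ] (H.edges → ℤ)) :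
    realFunctional (LinearMap.proj e) ((edgeMap f).baseChange ℝ x) = 0 := by
  rw [realFunctional_baseChange, proj_comp_edgeMap_of_notMem h, realFunctional_zero]

theorem IsContraction.exists_edgeMap_eq (hf : IsContraction f) {x : ℝ ⊗[ℤ] (G.edges → ℤ)}
    (hx : ∀ e : G.edges, Sym2.map f e ∉ H.edges → realFunctional (LinearMap.proj e) x = 0) :
    ∃ y, (edgeMap f).baseChange ℝ y = x := by
  have := Fintype.ofFinite G.edges
  have := Fintype.ofFinite H.edges
  choose c hc using hf.exists_edge
  obtain ⟨y, hy⟩ := exists_coordinates fun e => realFunctional (LinearMap.proj (c e)) x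
  refine ⟨y, eq_of_coordinates fun e => ?_⟩
  by_cases he : Sym2.map f e ∈ H.edges
  · rw [realFunctional_edgeMap_of_mem he, hy]
    have h1 : c ⟨_, he⟩ = e := Subtype.ext
      (hf.edge_injective e.2 (c _).2 he (hc ⟨_, he⟩).symm).symm
    rw [h1]
  · rw [realFunctional_edgeMap_of_notMem he, hx e he]

/-- The cone of metrics of a contraction of `G` is the face of the cone of metrics of `G` on which
the contracted edges have length zero. -/
theorem IsContraction.image_metricCone (hf : IsContraction f) :
    (edgeMap f).baseChange ℝ '' H.metricCone = {x | x ∈ G.metricCone ∧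
      ∀ e ∈ {e : G.edges | Sym2.map f e ∉ H.edges}, realFunctional (LinearMap.proj e) x = 0} := by
  ext x
  constructor
  · rintro ⟨y, hy, rfl⟩
    exact ⟨hf.mapsTo_metricCone hy, fun e he => realFunctional_edgeMap_of_notMem he y⟩
  · rintro ⟨hx, hx'⟩
    obtain ⟨y, rfl⟩ := hf.exists_edgeMap_eq hx'
    refine ⟨y, mem_metricCone_iff.2 ?_, rfl⟩
    rw [mem_metricCone_iff] at hx
    refine ⟨fun e => ?_, hf.isForest_of_preimage (by rintro _ ⟨e, -, rfl⟩; exact e.2) ?_⟩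
    · obtain ⟨e', he'⟩ := hf.exists_edge e
      have h1 : Sym2.map f e' ∈ H.edges := he' ▸ e.2
      have h2 := hx.1 e'
      rw [realFunctional_edgeMap_of_mem h1] at h2
      rwa [show e = ⟨_, h1⟩ from Subtype.ext he'.symm]
    · convert hx.2 using 1
      ext e
      constructor
      · rintro ⟨he, h1⟩
        refine ⟨⟨e, he⟩, ?_, rfl⟩
        by_cases h2 : Sym2.map f e ∈ H.edges
        · obtain ⟨e', h3, h4⟩ := h1 h2
          rw [Set.mem_ofPred_eq, realFunctional_edgeMap_of_mem h2]
          rw [← show e' = ⟨_, h2⟩ from Subtype.ext h4]; exact h3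
        · exact realFunctional_edgeMap_of_notMem h2 y
      · rintro ⟨e, h1, rfl⟩
        refine ⟨e.2, fun h2 => ⟨⟨_, h2⟩, ?_, rfl⟩⟩
        rwa [Set.mem_ofPred_eq, realFunctional_edgeMap_of_mem h2] at h1

theorem metricCone_nonneg {x : ℝ ⊗[ℤ] (G.edges → ℤ)} (hx : x ∈ G.metricCone) (e : G.edges) :
    0 ≤ realFunctional (LinearMap.proj e) x := (mem_metricCone_iff.1 hx).1 e

theorem IsContraction.edgeMap_injective (hf : IsContraction f) :
    Function.Injective ((edgeMap f).baseChange ℝ) := by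
  have := Fintype.ofFinite H.edges
  intro x y hxy
  refine eq_of_coordinates fun e => ?_
  obtain ⟨e', he'⟩ := hf.exists_edge e
  have h1 : Sym2.map f e' ∈ H.edges := he' ▸ e.2
  rw [show e = ⟨_, h1⟩ from Subtype.ext he'.symm, ← realFunctional_edgeMap_of_mem h1,
    ← realFunctional_edgeMap_of_mem h1, hxy]

theorem IsContraction.mem_range_edgeMap (hf : IsContraction f) {n : G.edges → ℤ}
    (hn : ∀ e : G.edges, Sym2.map f e ∉ H.edges → n e = 0) :
    n ∈ LinearMap.range (edgeMap (H := H) f) := by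
  choose c hc using hf.exists_edge
  refine ⟨fun e => n (c e), ?_⟩
  funext e
  by_cases he : Sym2.map f e ∈ H.edges
  · simp only [edgeMap, LinearMap.coe_mk, AddHom.coe_mk, he, dite_true]
    exact congrArg n (Subtype.ext (hf.edge_injective e.2 (c _).2 he (hc ⟨_, he⟩).symm).symm)
  · simp only [edgeMap, LinearMap.coe_mk, AddHom.coe_mk, he, dite_false]
    exact (hn e he).symm

/-- The faces of the cone of metrics of `G` correspond to the forests in `G`. -/
theorem exists_forest_of_isFace {τ : Set (ℝ ⊗[ℤ] (G.edges → ℤ))} (hτ : IsFace τ G.metricCone) :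
    ∃ Z, G.IsForest Z ∧ τ = {x | x ∈ G.metricCone ∧
      ∀ e ∈ {e : G.edges | (e : Sym2 G.F) ∈ Z}, realFunctional (LinearMap.proj e) x = 0} := by
  have := Fintype.ofFinite G.edges
  obtain ⟨Y, rfl⟩ := hτ.exists_coordinates (fun _ => mem_metricCone_of_pos)
    fun _ => metricCone_nonneg
  obtain ⟨x, hx, hxY⟩ := hτ.1
  refine ⟨Subtype.val '' Y, (mem_metricCone_iff.1 hx).2.mono (Set.image_mono hxY), ?_⟩
  ext x
  simp

end DiscreteGraph

/-! ### Products of poics -/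

section Prod

variable {N : Type u} [AddCommGroup N] {M : Type v} [AddCommGroup M]

theorem exists_of_fst_snd (x : ℝ ⊗[ℤ] N) (y : ℝ ⊗[ℤ] M) : ∃ z : ℝ ⊗[ℤ] (N × M),
    (LinearMap.fst ℤ N M).baseChange ℝ z = x ∧ (LinearMap.snd ℤ N M).baseChange ℝ z = y := by
  refine ⟨(LinearMap.inl ℤ N M).baseChange ℝ x + (LinearMap.inr ℤ N M).baseChange ℝ y, ?_, ?_⟩
  · rw [map_add, ← LinearMap.comp_apply, ← LinearMap.comp_apply, ← LinearMap.baseChange_comp,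
      ← LinearMap.baseChange_comp, LinearMap.fst_comp_inl, LinearMap.fst_comp_inr]
    simp
  · rw [map_add, ← LinearMap.comp_apply, ← LinearMap.comp_apply, ← LinearMap.baseChange_comp,
      ← LinearMap.baseChange_comp, LinearMap.snd_comp_inl, LinearMap.snd_comp_inr]
    simp

theorem eq_inl_add_inr (z : ℝ ⊗[ℤ] (N × M)) :
    (LinearMap.inl ℤ N M).baseChange ℝ ((LinearMap.fst ℤ N M).baseChange ℝ z) +
      (LinearMap.inr ℤ N M).baseChange ℝ ((LinearMap.snd ℤ N M).baseChange ℝ z) = z := by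
  rw [← LinearMap.comp_apply, ← LinearMap.comp_apply,
    ← LinearMap.baseChange_comp, ← LinearMap.baseChange_comp, ← LinearMap.add_apply,
    ← LinearMap.baseChange_add]
  have : LinearMap.inl ℤ N M ∘ₗ LinearMap.fst ℤ N M +
      LinearMap.inr ℤ N M ∘ₗ LinearMap.snd ℤ N M = LinearMap.id := by
    ext <;> simp
  rw [this]; simp

theorem eq_of_fst_snd {z z' : ℝ ⊗[ℤ] (N × M)}
    (h1 : (LinearMap.fst ℤ N M).baseChange ℝ z = (LinearMap.fst ℤ N M).baseChange ℝ z')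
    (h2 : (LinearMap.snd ℤ N M).baseChange ℝ z = (LinearMap.snd ℤ N M).baseChange ℝ z') :
    z = z' := by
  rw [← eq_inl_add_inr z, h1, h2, eq_inl_add_inr]

theorem realFunctional_prod (f : N × M →ₗ[ℤ] ℤ) (z : ℝ ⊗[ℤ] (N × M)) :
    realFunctional f z =
      realFunctional (f ∘ₗ LinearMap.inl ℤ N M) ((LinearMap.fst ℤ N M).baseChange ℝ z) +
      realFunctional (f ∘ₗ LinearMap.inr ℤ N M) ((LinearMap.snd ℤ N M).baseChange ℝ z) := by
  conv_lhs => rw [← eq_inl_add_inr z]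
  rw [map_add, realFunctional_baseChange (f := LinearMap.inl ℤ N M),
    realFunctional_baseChange (f := LinearMap.inr ℤ N M)]

/-- If `t a + b ≤ 0` for all `t > 0`, then `a ≤ 0`. -/
theorem nonpos_of_forall_mul_add_nonpos {a b : ℝ} (h : ∀ t : ℝ, 0 < t → t * a + b ≤ 0) :
    a ≤ 0 := by
  by_contra hcon
  push Not at hcon
  have h1 := h ((|b| + 1) / a) (by positivity)
  rw [div_mul_cancel₀ _ hcon.ne'] at h1
  linarith [neg_abs_le b]

/-- The product of two subsets of `N_ℝ` and `M_ℝ`. -/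
def prodCone (σ : Set (ℝ ⊗[ℤ] N)) (ρ : Set (ℝ ⊗[ℤ] M)) : Set (ℝ ⊗[ℤ] (N × M)) :=
  {z | (LinearMap.fst ℤ N M).baseChange ℝ z ∈ σ ∧ (LinearMap.snd ℤ N M).baseChange ℝ z ∈ ρ}

variable {N' : Type u} [AddCommGroup N'] {σ : Set (ℝ ⊗[ℤ] N)} {ρ : Set (ℝ ⊗[ℤ] M)}

/-- Every face of a product is a product of faces. -/
theorem exists_face_of_prodCone (hσ : IsPartiallyOpenCone σ) (hρ : IsPartiallyOpenCone ρ)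
    {τ : Set (ℝ ⊗[ℤ] (N × M))} (hτ : IsFace τ (prodCone σ ρ)) :
    ∃ τ₁ τ₂, IsFace τ₁ σ ∧ IsFace τ₂ ρ ∧ τ = prodCone τ₁ τ₂ := by
  obtain ⟨hne, f, hf, rfl⟩ := hτ
  have hf' : ∀ p ∈ σ, ∀ q ∈ ρ, realFunctional (f ∘ₗ LinearMap.inl ℤ N M) p +
      realFunctional (f ∘ₗ LinearMap.inr ℤ N M) q ≤ 0 := by
    intro p hp q hq
    obtain ⟨z, rfl, rfl⟩ := exists_of_fst_snd p q
    rw [← realFunctional_prod]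
    exact hf z ⟨hp, hq⟩
  -- Scaling one of the two coordinates shows that `f` is non-positive on each factor.
  have h1 : ∀ p ∈ σ, realFunctional (f ∘ₗ LinearMap.inl ℤ N M) p ≤ 0 := by
    intro p hp
    obtain ⟨q, hq⟩ := hρ.1
    refine nonpos_of_forall_mul_add_nonpos
      (b := realFunctional (f ∘ₗ LinearMap.inr ℤ N M) q) fun t ht => ?_
    have h2 := hf' _ (hσ.smul_mem hp ht) q hq
    rwa [map_smul, smul_eq_mul] at h2
  have h2 : ∀ q ∈ ρ, realFunctional (f ∘ₗ LinearMap.inr ℤ N M) q ≤ 0 := by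
    intro q hq
    obtain ⟨p, hp⟩ := hσ.1
    refine nonpos_of_forall_mul_add_nonpos
      (b := realFunctional (f ∘ₗ LinearMap.inl ℤ N M) p) fun t ht => ?_
    have h3 := hf' p hp _ (hρ.smul_mem hq ht)
    rwa [map_smul, smul_eq_mul, add_comm] at h3
  have h3 : ∀ z ∈ prodCone σ ρ, 0 ≤ realFunctional f z ↔
      0 ≤ realFunctional (f ∘ₗ LinearMap.inl ℤ N M) ((LinearMap.fst ℤ N M).baseChange ℝ z) ∧
      0 ≤ realFunctional (f ∘ₗ LinearMap.inr ℤ N M) ((LinearMap.snd ℤ N M).baseChange ℝ z) := by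
    intro z hz
    rw [realFunctional_prod]
    have h4 := h1 _ hz.1
    have h5 := h2 _ hz.2
    constructor
    · intro h6; constructor <;> linarith
    · rintro ⟨h6, h7⟩; exact add_nonneg h6 h7
  obtain ⟨z, hz, hz'⟩ := hne
  refine ⟨{p | p ∈ σ ∧ 0 ≤ realFunctional (f ∘ₗ LinearMap.inl ℤ N M) p},
    {q | q ∈ ρ ∧ 0 ≤ realFunctional (f ∘ₗ LinearMap.inr ℤ N M) q},
    ⟨⟨_, hz.1, ((h3 z hz).1 hz').1⟩, _, h1, rfl⟩,
    ⟨⟨_, hz.2, ((h3 z hz).1 hz').2⟩, _, h2, rfl⟩, ?_⟩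
  ext y
  constructor
  · rintro ⟨hy, hy'⟩
    have h4 := (h3 y hy).1 hy'
    exact ⟨⟨hy.1, h4.1⟩, hy.2, h4.2⟩
  · rintro ⟨⟨h4, h5⟩, h6, h7⟩
    exact ⟨⟨h4, h6⟩, (h3 y ⟨h4, h6⟩).2 ⟨h5, h7⟩⟩

theorem prodCone_nonempty (hσ : σ.Nonempty) (hρ : ρ.Nonempty) : (prodCone σ ρ).Nonempty := by
  obtain ⟨p, hp⟩ := hσ
  obtain ⟨q, hq⟩ := hρ
  obtain ⟨z, rfl, rfl⟩ := exists_of_fst_snd p q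
  exact ⟨z, hp, hq⟩

theorem IsFace.prodCone {τ : Set (ℝ ⊗[ℤ] N)} (hτ : IsFace τ σ) (hρ : ρ.Nonempty) :
    IsFace (prodCone τ ρ) (prodCone σ ρ) := by
  refine ⟨prodCone_nonempty hτ.1 hρ, ?_⟩
  obtain ⟨-, φ, h2, rfl⟩ := hτ
  refine ⟨φ ∘ₗ LinearMap.fst ℤ N M, fun z hz => ?_, ?_⟩
  · rw [← realFunctional_baseChange]
    exact h2 _ hz.1
  · ext z
    rw [Set.mem_ofPred_eq, ← realFunctional_baseChange]
    exact and_right_comm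

theorem image_prodMap (f : N →ₗ[ℤ] N') :
    (f.prodMap (LinearMap.id : M →ₗ[ℤ] M)).baseChange ℝ '' prodCone σ ρ =
      prodCone (f.baseChange ℝ '' σ) ρ := by
  ext z
  constructor
  · rintro ⟨y, ⟨h1, h2⟩, rfl⟩
    exact ⟨⟨_, h1, (Poic.baseChange_fst_prodMap f y).symm⟩,
      Set.mem_of_eq_of_mem (Poic.baseChange_snd_prodMap f y) h2⟩
  · rintro ⟨⟨p, hp, h1⟩, h2⟩
    obtain ⟨y, h3, h4⟩ := exists_of_fst_snd p ((LinearMap.snd ℤ N' M).baseChange ℝ z)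
    refine ⟨y, ⟨Set.mem_of_eq_of_mem h3 hp, Set.mem_of_eq_of_mem h4 h2⟩, eq_of_fst_snd ?_ ?_⟩
    · rw [Poic.baseChange_fst_prodMap, h3, h1]
    · rw [Poic.baseChange_snd_prodMap, h4]

theorem prodMap_injective {f : N →ₗ[ℤ] N'} (hf : Function.Injective (f.baseChange ℝ)) :
    Function.Injective ((f.prodMap (LinearMap.id : M →ₗ[ℤ] M)).baseChange ℝ) := by
  intro x y hxy
  refine eq_of_fst_snd (hf ?_) ?_
  · rw [← Poic.baseChange_fst_prodMap, hxy, Poic.baseChange_fst_prodMap]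
  · rw [← Poic.baseChange_snd_prodMap f x, hxy, Poic.baseChange_snd_prodMap]

theorem image_fst_prodCone (hρ : ρ.Nonempty) :
    (LinearMap.fst ℤ N M).baseChange ℝ '' prodCone σ ρ = σ := by
  obtain ⟨q, hq⟩ := hρ
  ext p
  constructor
  · rintro ⟨z, hz, rfl⟩; exact hz.1
  · intro hp
    obtain ⟨z, rfl, rfl⟩ := exists_of_fst_snd p q
    exact ⟨z, ⟨hp, hq⟩, rfl⟩

theorem mem_range_prodMap (hρ : ρ.Nonempty) {f : N →ₗ[ℤ] N'}
    (hf : ∀ n : N', (1 : ℝ) ⊗ₜ[ℤ] n ∈ Submodule.span ℝ (f.baseChange ℝ '' σ) →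
      n ∈ LinearMap.range f) (n : N' × M) (hn : (1 : ℝ) ⊗ₜ[ℤ] n ∈ Submodule.span ℝ
        ((f.prodMap (LinearMap.id : M →ₗ[ℤ] M)).baseChange ℝ '' prodCone σ ρ)) :
    n ∈ LinearMap.range (f.prodMap (LinearMap.id : M →ₗ[ℤ] M)) := by
  have h5 : (1 : ℝ) ⊗ₜ[ℤ] n.1 ∈ Submodule.span ℝ (f.baseChange ℝ '' σ) := by
    rw [← image_fst_prodCone (σ := f.baseChange ℝ '' σ) hρ, ← image_prodMap,
      Submodule.span_image]
    exact ⟨_, hn, by simp⟩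
  obtain ⟨k, hk⟩ := hf n.1 h5
  exact ⟨(k, n.2), Prod.ext hk rfl⟩

theorem Poic.IsFaceEmbedding.prodMap {P P' : Poic.{u}} {f : P ⟶ P'} (hf : IsFaceEmbedding f)
    {Q : Poic.{v}} {F : P.prod Q ⟶ P'.prod Q} (hF : F.lin = f.lin.prodMap LinearMap.id) :
    IsFaceEmbedding F := by
  unfold IsFaceEmbedding
  rw [hF]
  exact ⟨prodMap_injective hf.1, Set.mem_of_eq_of_mem (s := {τ | IsFace τ (P'.prod Q).cone})
    (image_prodMap f.lin) (hf.2.1.prodCone Q.isCone.1), mem_range_prodMap Q.isCone.1 hf.2.2⟩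

/-- Multiplying all cones by a poic without proper faces does not change the face relations. -/
theorem HasFaces.prodRight {C : Type v} [Category.{w} C] {Φ : C ⥤ Poic.{u}} (hΦ : HasFaces Φ)
    {Q : Poic.{0}} (hQ : ∀ τ, IsFace τ Q.cone → τ = Q.cone) :
    HasFaces (Poic.prodRight Φ Q) where
  faceEmbedding f := (hΦ.faceEmbedding f).prodMap rfl
  exists_face q τ hτ := by
    obtain ⟨τ₁, τ₂, h1, h2, rfl⟩ := exists_face_of_prodCone (Φ.obj q).isCone Q.isCone hτ
    obtain ⟨p, f, rfl⟩ := hΦ.exists_face q τ₁ h1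
    obtain rfl := hQ τ₂ h2
    exact ⟨p, f, image_prodMap _⟩
  unique_face {p p' q} f f' h := by
    refine hΦ.unique_face f f' ?_
    have h1 := (image_prodMap (ρ := Q.cone) (Φ.map f).lin).symm.trans
      (h.trans (image_prodMap (ρ := Q.cone) (Φ.map f').lin))
    rw [← image_fst_prodCone (σ := (Φ.map f).lin.baseChange ℝ '' _) Q.isCone.1, h1,
      image_fst_prodCone Q.isCone.1]

theorem face_posOrthant {I : Type u} [Finite I] {τ} (hτ : IsFace τ (Poic.posOrthant I).cone) :
    τ = (Poic.posOrthant I).cone := by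
  have := Fintype.ofFinite I
  obtain ⟨Y, rfl⟩ := IsFace.exists_coordinates (E := I) (fun x hx => hx)
    (fun x hx e => (hx e).le) hτ
  obtain ⟨x, hx, hxY⟩ := hτ.1
  ext y
  exact ⟨fun h => h.1, fun h => ⟨h, fun e he => ((hx e).ne' (hxY e he)).elim⟩⟩

end Prod

/-! ### The face relations of the moduli poic-space -/

theorem DiscreteGraph.IsContraction.isFace_image {G H : DiscreteGraph.{u}} {f : G.F → H.F}
    (hf : IsContraction f) :
    IsFace ((edgeMap f).baseChange ℝ '' H.metricCone) G.metricCone := by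
  have := Fintype.ofFinite G.edges
  obtain ⟨x, hx⟩ := H.metricPoic.isCone.1
  have h1 : (edgeMap f).baseChange ℝ x ∈ (edgeMap f).baseChange ℝ '' H.metricCone := ⟨x, hx, rfl⟩
  rw [hf.image_metricCone] at h1 ⊢
  exact isFace_of_coordinates (fun _ => metricCone_nonneg) _ ⟨_, h1⟩

theorem DiscreteGraph.IsContraction.mem_range_of_mem_span {G H : DiscreteGraph.{u}}
    {f : G.F → H.F} (hf : IsContraction f) (n : G.edges → ℤ)
    (hn : (1 : ℝ) ⊗ₜ[ℤ] n ∈ Submodule.span ℝ ((edgeMap f).baseChange ℝ '' H.metricCone)) :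
    n ∈ LinearMap.range (edgeMap (H := H) f) := by
  refine hf.mem_range_edgeMap fun e he => ?_
  have h1 : Submodule.span ℝ ((edgeMap f).baseChange ℝ '' H.metricCone) ≤
      LinearMap.ker (realFunctional (LinearMap.proj e)) := by
    rw [Submodule.span_le, hf.image_metricCone]
    exact fun x hx => hx.2 e he
  have h2 := h1 hn
  rw [LinearMap.mem_ker, realFunctional_tmul, mul_one] at h2
  exact_mod_cast h2

theorem hasFaces_Mtrop (g : ℕ) (A : Type u) : HasFaces (Mtrop.{u} g A) where
  faceEmbedding f := ⟨f.unop.isContraction.edgeMap_injective, f.unop.isContraction.isFace_image,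
    f.unop.isContraction.mem_range_of_mem_span⟩
  exists_face q τ hτ := by
    obtain ⟨Z, hZ, rfl⟩ := exists_forest_of_isFace hτ
    have hf := isContraction_contractMap hZ
    refine ⟨Opposite.op (q.unop.ofContraction hf),
      Quiver.Hom.op (⟨_, hf, fun _ => rfl⟩ : StableGraph.Hom q.unop (q.unop.ofContraction hf)),
      hf.image_metricCone.trans ?_⟩
    congr! 5 with x e
    rw [Set.mem_ofPred_eq, Set.mem_ofPred_eq, map_contractMap_mem_edges hZ e.2, not_not]
  unique_face {p p' q} f f' h := by
    -- The image of a point with positive coordinates tells which edges are contracted.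
    have key : ∀ {p p' : (StableGraph.{u} g A)ᵒᵖ} (f : p ⟶ q) (f' : p' ⟶ q),
        (edgeMap f.unop.toFun).baseChange ℝ '' p.unop.graph.metricCone =
        (edgeMap f'.unop.toFun).baseChange ℝ '' p'.unop.graph.metricCone →
        ∀ e ∈ q.unop.graph.edges, Sym2.map f.unop.toFun e ∈ p.unop.graph.edges →
          Sym2.map f'.unop.toFun e ∈ p'.unop.graph.edges := by
      intro p p' f f' h e he h1
      have := Fintype.ofFinite p.unop.graph.edges
      by_contra h2
      obtain ⟨x, hx⟩ := exists_coordinates fun _ : p.unop.graph.edges => (1 : ℝ)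
      have h3 : (edgeMap f.unop.toFun).baseChange ℝ x ∈
          (edgeMap f'.unop.toFun).baseChange ℝ '' p'.unop.graph.metricCone :=
        h ▸ ⟨x, mem_metricCone_of_pos fun e => by rw [hx]; exact one_pos, rfl⟩
      obtain ⟨y, -, hy⟩ := h3
      have h4 := realFunctional_edgeMap_of_notMem (e := ⟨e, he⟩) h2 y
      rw [hy, realFunctional_edgeMap_of_mem (e := ⟨e, he⟩) h1, hx] at h4
      exact one_ne_zero h4
    obtain ⟨k, hk⟩ := exists_iso_of_edges_iff f.unop f'.unop fun e he =>
      ⟨key f f' h e he, key f' f h.symm e he⟩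
    refine ⟨k.symm.op, Quiver.Hom.unop_inj (StableGraph.Hom.ext (funext fun x => ?_))⟩
    show k.inv.toFun (f'.unop.toFun x) = f.unop.toFun x
    rw [← hk]
    exact congrFun (congrArg StableGraph.Hom.toFun k.hom_inv_id) _

/-! ### Finiteness -/

theorem StableGraph.card_flags_le {g : ℕ} {A : Type u} (G : StableGraph.{u} g A) :
    Nat.card G.graph.F ≤ 8 * g + 4 * Nat.card A := by
  have h1 := four_mul_ncard_le G.three_le_val subset_rfl
  rw [Set.eq_univ_of_forall (s := G.graph.r ⁻¹' G.graph.V) G.graph.r_mem_V, Set.ncard_univ,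
    card_flags] at h1
  have h2 := G.genus_eq
  have h3 : G.graph.legs.ncard = Nat.card A := by
    rw [← Nat.card_coe_set_eq, ← Nat.card_congr G.mark]
  rw [genus] at h2
  rw [card_flags]
  omega

theorem essentiallyFinite_of_code {C : Type v} [Category.{w} C] {K : Type*} [Finite K]
    (code : C → K) (h : ∀ X Y, code X = code Y → Nonempty (X ≅ Y)) : EssentiallyFinite C := by
  obtain ⟨n, ⟨e⟩⟩ := Finite.exists_equiv_fin (Set.range code)
  choose c hc using fun i => (e.symm i).2
  refine ⟨InducedCategory C c, inferInstance, inferInstanceAs (Finite (Fin n)), ?_⟩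
  have : (inducedFunctor c).EssSurj := ⟨fun X => ⟨e ⟨_, X, rfl⟩, h _ _ (by
    show code (c (e ⟨_, X, rfl⟩)) = _
    rw [hc, Equiv.symm_apply_apply])⟩⟩
  have : (inducedFunctor c).IsEquivalence := {}
  exact ⟨(inducedFunctor c).asEquivalence.symm⟩

theorem essentiallyFinite_stableGraph (g : ℕ) (A : Type u) [Finite A] :
    EssentiallyFinite (StableGraph.{u} g A)ᵒᵖ := by
  -- A stable graph is encoded by the flags, root map, involution and marking on a standard set.
  have hemb : ∀ G : StableGraph.{u} g A,
      ∃ c : G.graph.F → Fin (8 * g + 4 * Nat.card A), Function.Injective c := by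
    intro G
    have h1 := G.card_flags_le
    have := Fintype.ofFinite G.graph.F
    rw [Nat.card_eq_fintype_card] at h1
    exact ⟨_, ((Fintype.equivFin G.graph.F).toEmbedding.trans
      (Fin.castLEEmb (show Fintype.card G.graph.F ≤ _ by omega))).injective⟩
  choose c hc using hemb
  refine essentiallyFinite_of_code (fun G =>
    ((Set.range (c G.unop), Set.range fun h => (c G.unop h, c G.unop (G.unop.graph.r h)),
      Set.range fun h => (c G.unop h, c G.unop (G.unop.graph.ι h))),
      fun a => c G.unop (G.unop.mark a))) ?_
  rintro ⟨G⟩ ⟨H⟩ h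
  obtain ⟨⟨h1, h2, h3⟩, h4⟩ : (Set.range (c G) = Set.range (c H) ∧
      (Set.range fun h => (c G h, c G (G.graph.r h))) =
        (Set.range fun h => (c H h, c H (H.graph.r h))) ∧
      (Set.range fun h => (c G h, c G (G.graph.ι h))) =
        (Set.range fun h => (c H h, c H (H.graph.ι h)))) ∧
      (fun a => c G (G.mark a)) = fun a => c H (H.mark a) := by
    simpa only [Prod.mk.injEq] using h
  choose e he using fun x : G.graph.F => (h1 ▸ ⟨x, rfl⟩ : c G x ∈ Set.range (c H))
  have hb : Function.Bijective e := by
    constructor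
    · intro x y hxy
      exact hc G (by rw [← he x, hxy, he])
    · intro y
      obtain ⟨x, hx⟩ : c H y ∈ Set.range (c G) := h1 ▸ ⟨y, rfl⟩
      exact ⟨x, hc H (by rw [he, hx])⟩
  have key : ∀ (s : G.graph.F → G.graph.F) (t : H.graph.F → H.graph.F),
      (Set.range fun h => (c G h, c G (s h))) = (Set.range fun h => (c H h, c H (t h))) →
      ∀ x, e (s x) = t (e x) := by
    intro s t hst x
    obtain ⟨y, hy⟩ : (c G x, c G (s x)) ∈ Set.range fun h => (c H h, c H (t h)) := hst ▸ ⟨x, rfl⟩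
    obtain ⟨hy1, hy2⟩ := Prod.mk.inj hy
    have h5 : y = e x := hc H (by rw [he, hy1])
    exact hc H (by rw [he, ← hy2, h5])
  refine ⟨(isoOfEquiv (G := H) (H := G) (Equiv.ofBijective e hb).symm ?_ ?_ ?_).op⟩
  · intro x
    rw [Equiv.symm_apply_eq, Equiv.ofBijective_apply, key _ _ h2]
    exact congrArg _ ((Equiv.ofBijective e hb).apply_symm_apply x).symm
  · intro x
    rw [Equiv.symm_apply_eq, Equiv.ofBijective_apply, key _ _ h3]
    exact congrArg _ ((Equiv.ofBijective e hb).apply_symm_apply x).symm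
  · intro a
    rw [Equiv.symm_apply_eq, Equiv.ofBijective_apply]
    exact hc H (by rw [he]; exact (congrFun h4 a).symm)

theorem isPoicSpace_Mtrop (g : ℕ) (A : Type u) [Finite A] : IsPoicSpace (Mtrop.{u} g A) where
  toHasFaces := hasFaces_Mtrop g A
  finite_hom x y := by
    have h1 : Function.Injective fun f : x ⟶ y => f.unop.toFun := fun f f' h =>
      Quiver.Hom.unop_inj (StableGraph.Hom.ext h)
    exact Finite.of_injective _ h1
  essentiallyFinite := essentiallyFinite_stableGraph g A

/-! ### Contractions of stable trees are unique -/

namespace DiscreteGraph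

variable {G H : DiscreteGraph.{u}} {f : G.F → H.F}

/-- The vertices of `G` and the flags of its edges. -/
def core (G : DiscreteGraph.{u}) : Set G.F := {h | h ∈ G.V ∨ G.ι h ≠ h}

theorem r_mem_core (h : G.F) : G.r h ∈ G.core := Or.inl (G.r_mem_V h)

theorem ι_mem_core {h : G.F} (hh : h ∈ G.core) : G.ι h ∈ G.core := by
  rcases hh with hh | hh
  · rw [ι_of_mem_V hh]; exact Or.inl hh
  · exact Or.inr (by rw [G.ι_ι]; exact hh.symm)

theorem ncard_core (hg : G.genus = 0) : G.core.ncard + 2 = 3 * G.V.ncard := by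
  have h1 : G.core = G.V ∪ {h | G.ι h ≠ h} := rfl
  have h2 : Disjoint G.V {h | G.ι h ≠ h} :=
    Set.disjoint_left.2 fun h hV hne => hne (ι_of_mem_V hV)
  rw [h1, Set.ncard_union_eq h2, ncard_ι_ne]
  rw [genus] at hg
  omega

/-- Flags that belong neither to a vertex nor to an edge lead nowhere. -/
theorem Joined.inter_core {B : Set G.F} {v w : G.F} (h : G.Joined B v w) :
    G.Joined {k | k ∈ B ∧ G.ι k ≠ k} v w := by
  induction h with
  | refl => exact .refl
  | tail _ h2 ih =>
    obtain ⟨k, hk, rfl, rfl⟩ := h2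
    by_cases hι : G.ι k = k
    · rwa [hι]
    · exact ih.tail ⟨k, ⟨hk, hι⟩, rfl, rfl⟩

/-- A non-empty set `U` of vertices of a tree spans at most `#U - 1` edges. -/
theorem ncard_span_le (hc : G.Connected) (hg : G.genus = 0) {U : Set G.F} (hU : U ⊆ G.V)
    (hne : U.Nonempty) :
    {h | h ∈ G.core ∧ G.r h ∈ U ∧ G.r (G.ι h) ∈ U}.ncard + 2 ≤ 3 * U.ncard := by
  have hV : G.core ∩ G.V = G.V := Set.inter_eq_right.2 fun h hh => Or.inl hh
  have h1 := three_mul_ncard_le (G := G) (T := G.core) (fun h _ => r_mem_core h)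
    (fun h hh => ι_mem_core hh)
    (fun v hv w hw => (hc v hv.2 w hw.2).inter_core.mono fun k hk => Or.inr hk.2) _ U
    (hU.trans hV.symm.subset) hne rfl
  rw [hV] at h1
  have h2 := Set.ncard_sdiff_add_ncard_of_subset hU
  have h3 := ncard_core hg
  have h4 : {h | h ∈ G.core ∧ ¬ (G.r h ∈ U ∧ G.r (G.ι h) ∈ U)}.ncard +
      {h | h ∈ G.core ∧ G.r h ∈ U ∧ G.r (G.ι h) ∈ U}.ncard = G.core.ncard := by
    rw [← Set.ncard_union_eq]
    · congr 1
      ext h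
      exact and_or_left.symm.trans (and_iff_left (em _).symm)
    · exact Set.disjoint_left.2 fun h hh hh' => hh.2 hh'.2
  omega

/-- Every edge of a tree is a bridge. -/
theorem not_joined_of_genus_eq_zero (hc : G.Connected) (hg : G.genus = 0) {h : G.F}
    (hh : G.ι h ≠ h) : ¬ G.Joined {k | s(k, G.ι k) ≠ s(h, G.ι h)} (G.r h) (G.r (G.ι h)) := by
  intro hj
  set T := G.core \ {h, G.ι h} with hT
  have hTV : T ∩ G.V = G.V := by
    refine Set.inter_eq_right.2 fun k hk => ⟨Or.inl hk, ?_⟩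
    rintro (rfl | rfl)
    · exact hh (ι_of_mem_V hk)
    · have h1 := ι_of_mem_V hk
      rw [G.ι_ι] at h1
      exact hh h1.symm
  have hB : ∀ k, G.ι k ≠ k → s(k, G.ι k) ≠ s(h, G.ι h) → k ∈ T := by
    refine fun k hk hne => ⟨Or.inr hk, ?_⟩
    rintro (rfl | rfl)
    · exact hne rfl
    · rw [G.ι_ι] at hne; exact hne Sym2.eq_swap
  have hιT : ∀ k ∈ T, G.ι k ∈ T := by
    rintro k ⟨hk, hk'⟩
    refine ⟨ι_mem_core hk, ?_⟩
    rintro (h1 | h1)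
    · exact hk' (Or.inr (by rw [← h1, G.ι_ι]; rfl))
    · exact hk' (Or.inl (by rw [← G.ι_ι k, h1, G.ι_ι]))
  have hj' : G.Joined T (G.r h) (G.r (G.ι h)) :=
    hj.inter_core.mono fun k hk => hB k hk.2 hk.1
  have hTc : ∀ v ∈ T ∩ G.V, ∀ w ∈ T ∩ G.V, G.Joined T v w := by
    intro v hv w hw
    have h1 := (hc v hv.2 w hw.2).inter_core
    clear hw
    induction h1 with
    | refl => exact .refl
    | tail _ h2 ih =>
      obtain ⟨k, ⟨-, hk⟩, rfl, rfl⟩ := h2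
      refine Relation.ReflTransGen.trans ih ?_
      by_cases hkh : s(k, G.ι k) = s(h, G.ι h)
      · rcases Sym2.eq_iff.1 hkh with ⟨rfl, _⟩ | ⟨rfl, _⟩
        · exact hj'
        · rw [G.ι_ι]; exact hj'.symm hιT
      · exact .single ⟨k, hB k hk hkh, rfl, rfl⟩
  have hrT : G.r h ∈ T ∩ G.V := by rw [hTV]; exact G.r_mem_V h
  have h1 := three_mul_ncard_le (G := G) (T := T)
    (fun k _ => (hTV.symm.subset (G.r_mem_V k)).1) hιT hTc _ {G.r h}
    (Set.singleton_subset_iff.2 hrT) (Set.singleton_nonempty _) rfl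
  rw [hTV, Set.ncard_sdiff_singleton_of_mem (G.r_mem_V h)] at h1
  have h2 : {k | k ∈ T ∧ ¬ (G.r k ∈ ({G.r h} : Set G.F) ∧ G.r (G.ι k) ∈ ({G.r h} : Set G.F))} ⊆
      T \ {G.r h} := by
    rintro k ⟨hk, hk'⟩
    refine ⟨hk, ?_⟩
    rintro rfl
    exact hk' ⟨by rw [G.r_r]; rfl, by rw [G.ι_r, G.r_r]; rfl⟩
  have h3 := Set.ncard_le_ncard h2
  rw [Set.ncard_sdiff_singleton_of_mem hrT.1] at h3
  have h4 : ({h, G.ι h} : Set G.F) ⊆ G.core := by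
    rintro k (rfl | rfl)
    · exact Or.inr hh
    · exact ι_mem_core (Or.inr hh)
  have h5 := Set.ncard_sdiff_add_ncard_of_subset h4
  rw [Set.ncard_pair hh.symm] at h5
  have h6 := ncard_core hg
  have h7 : 0 < G.V.ncard := (Set.ncard_pos).2 ⟨_, G.r_mem_V h⟩
  rw [← hT] at h5
  omega

/-- Two different vertices of a tree are separated by an edge at the first one. -/
theorem exists_separating_edge (hc : G.Connected) (hg : G.genus = 0) {x y : G.F} (hx : x ∈ G.V)
    (hy : y ∈ G.V) (hxy : y ≠ x) :
    ∃ h, G.r h = x ∧ G.ι h ≠ h ∧ ¬ G.Joined {k | s(k, G.ι k) ≠ s(h, G.ι h)} x y := by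
  suffices key : ∀ z, G.Joined Set.univ x z → z = x ∨
      ∃ h, G.r h = x ∧ G.ι h ≠ h ∧ ¬ G.Joined {k | s(k, G.ι k) ≠ s(h, G.ι h)} x z from
    (key y (hc x hx y hy)).resolve_left hxy
  intro z hz
  induction hz.inter_core with
  | refl => exact Or.inl rfl
  | tail h1 h2 ih =>
    obtain ⟨k, ⟨-, hk⟩, rfl, rfl⟩ := h2
    by_cases hkx : G.r (G.ι k) = x
    · exact Or.inl hkx
    right
    rcases ih (Joined.mono (Set.subset_univ _) h1) with h3 | ⟨h, h3, h4, h5⟩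
    · exact ⟨k, h3, hk, h3 ▸ not_joined_of_genus_eq_zero hc hg hk⟩
    · refine ⟨h, h3, h4, fun h6 => h5 ?_⟩
      -- The last step could only cross `h` towards `x`, but it does not end at `x`.
      by_cases hkh : s(k, G.ι k) = s(h, G.ι h)
      · rcases Sym2.eq_iff.1 hkh with ⟨rfl, _⟩ | ⟨_, h7⟩
        · rw [h3]; exact .refl
        · rw [h7] at hkx; exact (hkx h3).elim
      · exact h6.tail ⟨G.ι k, by rwa [Set.mem_ofPred_eq, G.ι_ι, Sym2.eq_swap], rfl, by rw [G.ι_ι]⟩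

/-- A contraction respects the sides of an edge that it does not contract. -/
theorem IsContraction.joined_iff (hf : IsContraction f) {h : G.F} (hV : f h ∉ H.V) {w : G.F}
    (hw : w ∈ G.V) : G.Joined {k | s(k, G.ι k) ≠ s(h, G.ι h)} (G.r h) w ↔
      H.Joined {k | s(k, H.ι k) ≠ s(f h, H.ι (f h))} (H.r (f h)) (f w) := by
  have hιV : f (G.ι h) ∉ H.V := by
    rw [hf.map_ι]
    intro h1
    have h2 := ι_of_mem_V h1
    rw [H.ι_ι] at h2
    exact hV (h2 ▸ h1)
  have hB : ∀ k, s(f k, H.ι (f k)) = s(f h, H.ι (f h)) ↔ s(k, G.ι k) = s(h, G.ι h) := by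
    intro k
    constructor
    · intro h1
      rcases Sym2.eq_iff.1 h1 with ⟨h2, _⟩ | ⟨h2, _⟩
      · rw [hf.injOn hV h2.symm]
      · rw [← hf.map_ι] at h2
        rw [← hf.injOn hιV h2.symm, G.ι_ι, Sym2.eq_swap]
    · intro h1
      rcases Sym2.eq_iff.1 h1 with ⟨rfl, _⟩ | ⟨rfl, _⟩
      · rfl
      · rw [hf.map_ι, H.ι_ι, Sym2.eq_swap]
  constructor
  · intro h1
    rw [← hf.map_r]
    exact hf.joined_map (B := {k | s(k, G.ι k) ≠ s(h, G.ι h)})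
      (B' := {k | s(k, H.ι k) ≠ s(f h, H.ι (f h))}) (fun k hk h3 => hk ((hB k).1 h3)) h1
  · intro h1
    rw [← hf.map_r] at h1
    refine hf.joined_lift (B := {k | s(k, H.ι k) ≠ s(f h, H.ι (f h))})
      (B' := {k | s(k, G.ι k) ≠ s(h, G.ι h)}) (W := H.V) (G.r_mem_V _) (hf.map_V (G.r_mem_V _))
      (fun _ _ => H.r_mem_V _) (fun k hk h2 => hk ((hB k).2 h2)) (fun k hk h2 => ?_) h1 w hw rfl
    rcases Sym2.eq_iff.1 h2 with ⟨rfl, _⟩ | ⟨rfl, _⟩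
    · exact hV hk
    · exact hιV hk

end DiscreteGraph

namespace StableGraph

variable {A : Type u} {T T' : StableGraph.{u} 0 A}

/-- Two contractions between stable trees agree on the vertices. If they did not agree at `v`, some
edge `h` of the target would separate the two images. The vertices on the near side of the first
preimage of `h` and on the far side of the second one would form a non-empty set `U` without legs
that at most two edges leave, whereas `U` spans at most `#U - 1` edges and has at least `3 #U`
half-edges. -/
theorem Hom.eq_on_vertices (f f' : Hom T' T) {v : T'.graph.F} (hv : v ∈ T'.graph.V) :
    f.toFun v = f'.toFun v := by
  have hf := f.isContraction
  have hf' := f'.isContraction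
  by_contra hne
  obtain ⟨h, hr, hι, hsep⟩ := exists_separating_edge T.connected (by simpa using T.genus_eq)
    (hf.map_V hv) (hf'.map_V hv) (Ne.symm hne)
  have hV : h ∉ T.graph.V := fun h1 => hι (ι_of_mem_V h1)
  obtain ⟨k, hk⟩ := hf.surjective h
  obtain ⟨k', hk'⟩ := hf'.surjective h
  have hkV : f.toFun k ∉ T.graph.V := hk ▸ hV
  have hkV' : f'.toFun k' ∉ T.graph.V := hk' ▸ hV
  set U := {w | w ∈ T'.graph.V ∧
    T'.graph.Joined {l | s(l, T'.graph.ι l) ≠ s(k, T'.graph.ι k)} (T'.graph.r k) w ∧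
    ¬ T'.graph.Joined {l | s(l, T'.graph.ι l) ≠ s(k', T'.graph.ι k')} (T'.graph.r k') w}
  have hvU : v ∈ U := by
    refine ⟨hv, (hf.joined_iff hkV hv).2 ?_, fun h1 => hsep ?_⟩
    · rw [hk, hr]; exact .refl
    · have h2 := (hf'.joined_iff hkV' hv).1 h1
      rwa [hk', hr] at h2
  have hcover : T'.graph.r ⁻¹' U ⊆
      {l | l ∈ T'.graph.core ∧ T'.graph.r l ∈ U ∧ T'.graph.r (T'.graph.ι l) ∈ U} ∪
        {k, T'.graph.ι k'} := by
    intro l hl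
    have hl' : T'.graph.r l ∈ U := hl
    have hcore : l ∈ T'.graph.core := by
      by_contra hl1
      rw [core, Set.mem_ofPred_eq, not_or, not_not] at hl1
      obtain ⟨a, rfl⟩ := exists_mark (G := T') hl1
      obtain ⟨h1, h2, h3⟩ := hl'
      rw [hf.joined_iff hkV h1, hk, hf.map_r, f.map_mark] at h2
      rw [hf'.joined_iff hkV' h1, hk', hf'.map_r, f'.map_mark] at h3
      exact h3 h2
    by_contra hl2
    rw [Set.mem_union, not_or] at hl2
    obtain ⟨h1, h2⟩ := hl2
    refine h1 ⟨hcore, hl', T'.graph.r_mem_V _, ?_, fun h3 => ?_⟩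
    · by_cases hlk : s(l, T'.graph.ι l) = s(k, T'.graph.ι k)
      · rcases Sym2.eq_iff.1 hlk with ⟨rfl, _⟩ | ⟨rfl, _⟩
        · exact (h2 (Or.inl rfl)).elim
        · rw [T'.graph.ι_ι]; exact .refl
      · exact hl'.2.1.tail ⟨l, hlk, rfl, rfl⟩
    · apply hl'.2.2
      by_cases hlk : s(l, T'.graph.ι l) = s(k', T'.graph.ι k')
      · rcases Sym2.eq_iff.1 hlk with ⟨rfl, _⟩ | ⟨rfl, _⟩
        · exact .refl
        · exact (h2 (Or.inr rfl)).elim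
      · exact h3.tail ⟨T'.graph.ι l, by rwa [Set.mem_ofPred_eq, T'.graph.ι_ι, Sym2.eq_swap], rfl,
          by rw [T'.graph.ι_ι]⟩
  have h1 := Set.ncard_le_ncard hcover
  have h2 := Set.ncard_union_le
    {l | l ∈ T'.graph.core ∧ T'.graph.r l ∈ U ∧ T'.graph.r (T'.graph.ι l) ∈ U} {k, T'.graph.ι k'}
  have h3 := Set.ncard_insert_le k {T'.graph.ι k'}
  rw [Set.ncard_singleton] at h3
  have h4 := ncard_span_le T'.connected (by simpa using T'.genus_eq)
    (U := U) (fun w hw => hw.1) ⟨v, hvU⟩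
  have h5 := four_mul_ncard_le T'.three_le_val (U := U) fun w hw => hw.1
  have h6 : 0 < U.ncard := (Set.ncard_pos).2 ⟨v, hvU⟩
  omega

theorem Hom.eq_of_notMem_V (f f' : Hom T' T) {h : T'.graph.F} (hι : T'.graph.ι h ≠ h)
    (hV : f.toFun h ∉ T.graph.V) : f'.toFun h = f.toFun h := by
  have hf := f.isContraction
  have hf' := f'.isContraction
  have h1 : T.graph.ι (f.toFun h) ≠ f.toFun h := fun h1 =>
    hι (hf.injOn hV (by rw [hf.map_ι, h1])).symm
  have h2 := not_joined_of_genus_eq_zero T.connected (by simpa using T.genus_eq) h1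
  have h3 : T.graph.r (f'.toFun h) = T.graph.r (f.toFun h) := by
    rw [← hf'.map_r, ← hf.map_r, f.eq_on_vertices f' (T'.graph.r_mem_V h)]
  have h4 : T.graph.r (T.graph.ι (f'.toFun h)) = T.graph.r (T.graph.ι (f.toFun h)) := by
    rw [← hf'.map_ι, ← hf.map_ι, ← hf'.map_r, ← hf.map_r,
      f.eq_on_vertices f' (T'.graph.r_mem_V _)]
  -- Otherwise `f' h` would be a second way to cross the bridge `f h`.
  by_contra hne
  refine h2 ?_
  rw [← h3, ← h4]
  by_cases h5 : s(f'.toFun h, T.graph.ι (f'.toFun h)) = s(f.toFun h, T.graph.ι (f.toFun h))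
  · rcases Sym2.eq_iff.1 h5 with ⟨h6, _⟩ | ⟨h6, h7⟩
    · exact (hne h6).elim
    · rw [h4, ← h6]; exact .refl
  · exact .single ⟨_, h5, rfl, rfl⟩

theorem Hom.eq_of_tree (f f' : Hom T' T) : f = f' := by
  refine Hom.ext (funext fun h => ?_)
  by_cases hV : h ∈ T'.graph.V
  · exact f.eq_on_vertices f' hV
  by_cases hι : T'.graph.ι h = h
  · obtain ⟨a, rfl⟩ := exists_mark (G := T') ⟨hV, hι⟩
    rw [f.map_mark, f'.map_mark]
  by_cases h1 : f.toFun h ∈ T.graph.V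
  · by_cases h2 : f'.toFun h ∈ T.graph.V
    · rw [← mem_V_iff.1 h1, ← mem_V_iff.1 h2, ← f.isContraction.map_r, ← f'.isContraction.map_r,
        f.eq_on_vertices f' (T'.graph.r_mem_V h)]
    · exact f'.eq_of_notMem_V f hι h2
  · exact (f.eq_of_notMem_V f' hι h1).symm

end StableGraph

theorem isPoicComplex_stComplex (g : ℕ) (A : Type u) [Finite A] :
    IsPoicComplex (stComplex.{u} g A) where
  toHasFaces := (hasFaces_Mtrop 0 _).prodRight fun _ => face_posOrthant
  thin _ _ := ⟨fun f f' => Quiver.Hom.unop_inj (Hom.eq_of_tree f.unop f'.unop)⟩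
  essentiallyFinite := essentiallyFinite_stableGraph 0 _

/-! ### Cutting edges into legs -/

namespace DiscreteGraph

open Classical in
/-- The graph obtained from `G` by cutting every edge with flags in `R` into two legs. -/
noncomputable abbrev cut (G : DiscreteGraph.{u}) (R : Set G.F) (hR : ∀ h ∈ R, G.ι h ∈ R) :
    DiscreteGraph.{u} where
  F := G.F
  r := G.r
  ι h := if h ∈ R then h else G.ι h
  r_r := G.r_r
  ι_ι h := by
    by_cases hh : h ∈ R
    · simp only [if_pos hh]
    · have h1 : G.ι h ∉ R := fun h1 => hh (G.ι_ι h ▸ hR _ h1)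
      simp only [if_neg hh, if_neg h1, G.ι_ι]
  ι_r h := by
    split_ifs
    · rfl
    · exact G.ι_r h

variable {G : DiscreteGraph.{u}} {R : Set G.F} (hR : ∀ h ∈ R, G.ι h ∈ R)

theorem cut_ι_of_mem {h : G.F} (hh : h ∈ R) : (G.cut R hR).ι h = h := if_pos hh

theorem cut_ι_of_notMem {h : G.F} (hh : h ∉ R) : (G.cut R hR).ι h = G.ι h := if_neg hh

theorem cut_joined {B : Set G.F} (hB : ∀ h ∈ B, h ∉ R) {v w : G.F} (h : G.Joined B v w) :
    (G.cut R hR).Joined B v w :=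
  Relation.ReflTransGen.mono (by
    rintro a b ⟨k, hk, rfl, rfl⟩
    exact ⟨k, hk, rfl, congrArg G.r (cut_ι_of_notMem hR (hB k hk))⟩) _ _ h

theorem cut_tree {S : Set G.F} (hS : G.IsLeglessTreeSet S) (hSR : ∀ h ∈ S, h ∉ R) :
    (G.cut R hR).IsLeglessTreeSet S := by
  rw [isLeglessTreeSet_iff] at hS ⊢
  obtain ⟨h1, h2, h3, h4, h5⟩ := hS
  have hι : ∀ h ∈ S, (G.cut R hR).ι h = G.ι h := fun h hh => cut_ι_of_notMem hR (hSR h hh)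
  refine ⟨h1, fun h hh => ?_, fun h hh hh' => ?_, fun v hv w hw => ?_, h5⟩
  · exact Set.mem_of_eq_of_mem (hι h hh) (h2 h hh)
  · exact h3 h hh ((hι h hh).symm.trans hh')
  · exact cut_joined hR hSR (h4 v hv w hw)

/-- A connected graph has a spanning tree: `n` vertices can be joined by `n - 1` edges. -/
theorem exists_spanning_edges (hc : G.Connected) {v₀ : G.F} (hv₀ : v₀ ∈ G.V) (n : ℕ)
    (hn : n + 1 ≤ G.V.ncard) : ∃ (U : Set G.F) (Y : Set (Sym2 G.F)), U ⊆ G.V ∧ v₀ ∈ U ∧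
      U.ncard = n + 1 ∧ Y ⊆ G.edges ∧ Y.ncard = n ∧ (∀ h, s(h, G.ι h) ∈ Y → G.r h ∈ U) ∧
      ∀ u ∈ U, G.Joined {k | s(k, G.ι k) ∈ Y} v₀ u := by
  induction n with
  | zero =>
    refine ⟨{v₀}, ∅, Set.singleton_subset_iff.2 hv₀, rfl, Set.ncard_singleton _,
      Set.empty_subset _, Set.ncard_empty _, fun h hh => hh.elim, ?_⟩
    rintro u rfl
    exact .refl
  | succ n ih =>
    obtain ⟨U, Y, hU, hvU, hUn, hY, hYn, hYU, hj⟩ := ih (by omega)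
    have hex : ∃ h, G.r h ∈ U ∧ G.r (G.ι h) ∉ U := by
      by_contra hcon
      push Not at hcon
      have h1 : G.V ⊆ U := by
        intro w hw
        have h2 := hc v₀ hv₀ w hw
        clear hw
        induction h2 with
        | refl => exact hvU
        | tail _ h3 ih3 =>
          obtain ⟨k, -, rfl, rfl⟩ := h3
          exact hcon k ih3
      have := Set.ncard_le_ncard h1
      omega
    obtain ⟨h, hh, hh'⟩ := hex
    have hnew : s(h, G.ι h) ∉ Y := fun h1 => hh' (hYU (G.ι h) (by rwa [G.ι_ι, Sym2.eq_swap]))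
    have hmono : ∀ u, G.Joined {k | s(k, G.ι k) ∈ Y} v₀ u →
        G.Joined {k | s(k, G.ι k) ∈ insert s(h, G.ι h) Y} v₀ u :=
      fun u hu => hu.mono fun k hk => Or.inr hk
    refine ⟨insert (G.r (G.ι h)) U, insert s(h, G.ι h) Y,
      Set.insert_subset (G.r_mem_V _) hU, Or.inr hvU, ?_, Set.insert_subset ?_ hY, ?_, ?_, ?_⟩
    · rw [Set.ncard_insert_of_notMem hh', hUn]
    · exact mk_mem_edges.2 fun h1 => hh' (h1.symm ▸ hh)
    · rw [Set.ncard_insert_of_notMem hnew, hYn]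
    · rintro k (hk | hk)
      · rcases Sym2.eq_iff.1 hk with ⟨rfl, _⟩ | ⟨rfl, _⟩
        · exact Or.inr hh
        · exact Or.inl rfl
      · exact Or.inr (hYU k hk)
    · rintro u (rfl | hu)
      · exact (hmono _ (hj _ hh)).tail ⟨h, Or.inl rfl, rfl, rfl⟩
      · exact hmono u (hj u hu)

end DiscreteGraph

namespace StableGraph

variable {g : ℕ} {A : Type u} {G : StableGraph.{u} g A}

theorem ι_mem_range {m : Fin g ⊕ Fin g → G.graph.F}
    (hι : ∀ i, G.graph.ι (m (Sum.inl i)) = m (Sum.inr i)) :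
    ∀ h ∈ Set.range m, G.graph.ι h ∈ Set.range m := by
  rintro _ ⟨i | i, rfl⟩
  · exact ⟨_, (hι i).symm⟩
  · exact ⟨Sum.inl i, by rw [← hι i, G.graph.ι_ι]⟩

theorem ι_eq_swap {m : Fin g ⊕ Fin g → G.graph.F}
    (hι : ∀ i, G.graph.ι (m (Sum.inl i)) = m (Sum.inr i)) (x : Fin g ⊕ Fin g) :
    G.graph.ι (m x) = m x.swap := by
  rcases x with i | i
  · exact hι i
  · rw [← hι i, G.graph.ι_ι]; rfl

/-- The marking of the graph in which the edges `{m i, m i*}` of `G` are cut into legs. -/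
noncomputable def cutMark {m : Fin g ⊕ Fin g → G.graph.F} (hm : Function.Injective m)
    (hι : ∀ i, G.graph.ι (m (Sum.inl i)) = m (Sum.inr i)) :
    A ⊕ (Fin g ⊕ Fin g) ≃ (G.graph.cut (Set.range m) (ι_mem_range hι)).legs :=
  have hne : ∀ x, G.graph.ι (m x) ≠ m x := fun x h => by
    have h1 := hm ((ι_eq_swap hι x).symm.trans h)
    rcases x with i | i <;> simp at h1
  have hmark : ∀ a, (G.mark a : G.graph.F) ∉ Set.range m := by
    rintro a ⟨x, hx⟩
    exact hne x (hx ▸ G.ι_mark a)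
  Equiv.ofBijective (Sum.elim
    (fun a => ⟨G.mark a, (G.mark a).2.1, (cut_ι_of_notMem _ (hmark a)).trans (G.ι_mark a)⟩)
    (fun x => ⟨m x, fun hV => hne x (ι_of_mem_V hV), cut_ι_of_mem _ ⟨x, rfl⟩⟩)) <| by
    constructor
    · rintro (a | x) (b | y) h
      · have h1 : (G.mark a : G.graph.F) = G.mark b :=
          congrArg (fun y : (G.graph.cut (Set.range m) (ι_mem_range hι)).legs => y.1) h
        exact congrArg Sum.inl (G.mark_injective h1)
      · exact (hmark a ⟨y, (Subtype.ext_iff.1 h).symm⟩).elim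
      · exact (hmark b ⟨x, Subtype.ext_iff.1 h⟩).elim
      · exact congrArg Sum.inr (hm (Subtype.ext_iff.1 h))
    · rintro ⟨h, hV, hh⟩
      by_cases hr : h ∈ Set.range m
      · obtain ⟨x, rfl⟩ := hr
        exact ⟨Sum.inr x, rfl⟩
      · obtain ⟨a, rfl⟩ := exists_mark (G := G) (h := h)
          ⟨hV, (cut_ι_of_notMem (ι_mem_range hι) hr).symm.trans hh⟩
        exact ⟨Sum.inl a, rfl⟩

/-- The tree obtained from `G` by cutting the edges `{m i, m i*}` into legs, provided that the
result is connected. -/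
noncomputable abbrev cut [Finite A] {m : Fin g ⊕ Fin g → G.graph.F} (hm : Function.Injective m)
    (hι : ∀ i, G.graph.ι (m (Sum.inl i)) = m (Sum.inr i))
    (hc : (G.graph.cut (Set.range m) (ι_mem_range hι)).Connected) :
    StableGraph.{u} 0 (A ⊕ (Fin g ⊕ Fin g)) where
  graph := G.graph.cut (Set.range m) (ι_mem_range hι)
  mark := cutMark hm hι
  connected := hc
  genus_eq := by
    have h1 := card_flags G.graph
    have h2 := card_flags (G.graph.cut (Set.range m) (ι_mem_range hι))
    have h3 : (G.graph.cut (Set.range m) (ι_mem_range hι)).legs.ncard = Nat.card A + (g + g) := by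
      rw [← Nat.card_coe_set_eq, ← Nat.card_congr (cutMark hm hι), Nat.card_sum, Nat.card_sum,
        Nat.card_fin]
    have h4 : G.graph.legs.ncard = Nat.card A := by
      rw [← Nat.card_coe_set_eq, ← Nat.card_congr G.mark]
    have h5 : (G.graph.cut (Set.range m) (ι_mem_range hι)).V.ncard = G.graph.V.ncard := rfl
    have h6 := G.genus_eq
    rw [genus] at h6 ⊢
    rw [h5]
    have h7 : Nat.card (G.graph.cut (Set.range m) (ι_mem_range hι)).F = Nat.card G.graph.F := rfl
    omega
  three_le_val := G.three_le_val

theorem cut_glueInv [Finite A] {m : Fin g ⊕ Fin g → G.graph.F} (hm : Function.Injective m)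
    (hι : ∀ i, G.graph.ι (m (Sum.inl i)) = m (Sum.inr i))
    (hc : (G.graph.cut (Set.range m) (ι_mem_range hι)).Connected) (h : G.graph.F) :
    (cut hm hι hc).glueInv h = G.graph.ι h := by
  by_cases hh : h ∈ (cut hm hι hc).graph.legs
  · obtain ⟨a | x, rfl⟩ := exists_mark (G := cut hm hι hc) hh
    · exact ((cut hm hι hc).glueInv_mark _).trans (G.ι_mark a).symm
    · exact ((cut hm hι hc).glueInv_mark _).trans (ι_eq_swap hι x).symm
  · refine ((cut hm hι hc).glueInv_of_notMem hh).trans (cut_ι_of_notMem (ι_mem_range hι) ?_)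
    rintro ⟨x, rfl⟩
    exact hh ((cutMark hm hι (Sum.inr x)).2)

/-- Gluing the legs of the cut graph gives back the graph `G`. -/
noncomputable def stCutIso [Finite A] {m : Fin g ⊕ Fin g → G.graph.F} (hm : Function.Injective m)
    (hι : ∀ i, G.graph.ι (m (Sum.inl i)) = m (Sum.inr i))
    (hc : (G.graph.cut (Set.range m) (ι_mem_range hι)).Connected) :
    G ≅ (stFunctor g A).obj (cut hm hι hc) :=
  isoOfEquiv (H := (stFunctor g A).obj (cut hm hι hc)) (Equiv.refl G.graph.F) (fun _ => rfl)
    (fun h => (cut_glueInv hm hι hc h).symm) (fun _ => rfl)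

theorem V_nonempty [Finite A] (hgA : 2 < 2 * g + Nat.card A) (G : StableGraph.{u} g A) :
    G.graph.V.Nonempty := by
  rw [Set.nonempty_iff_ne_empty]
  intro hV
  have : IsEmpty G.graph.F := ⟨fun h => by
    have h1 := G.graph.r_mem_V h
    rw [hV] at h1
    exact h1⟩
  have h1 := card_flags G.graph
  have h2 := G.genus_eq
  have h3 : G.graph.legs.ncard = Nat.card A := by
    rw [← Nat.card_coe_set_eq, ← Nat.card_congr G.mark]
  rw [Nat.card_of_isEmpty] at h1
  rw [genus] at h2
  omega

end StableGraph

/-- Every stable graph is obtained by gluing legs of a stable tree: cut the edges outside a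
spanning tree. -/
theorem essSurj_stFunctor {g : ℕ} {A : Type u} [Finite A] (hgA : 2 < 2 * g + Nat.card A) :
    (stFunctor.{u} g A).EssSurj where
  mem_essImage G := by
    obtain ⟨v₀, hv₀⟩ := G.V_nonempty hgA
    have hpos : 0 < G.graph.V.ncard := (Set.ncard_pos).2 ⟨v₀, hv₀⟩
    obtain ⟨U, Y, hU, -, hUn, hY, hYn, -, hj⟩ :=
      exists_spanning_edges G.connected hv₀ (G.graph.V.ncard - 1) (by omega)
    have hUV : U = G.graph.V := Set.eq_of_subset_of_ncard_le hU (by omega)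
    have hcard : Nat.card ↥(G.graph.edges \ Y) = g := by
      have h1 := Set.ncard_sdiff_add_ncard_of_subset hY
      have h2 := G.genus_eq
      rw [genus] at h2
      rw [Nat.card_coe_set_eq]
      omega
    let φ : ↥(G.graph.edges \ Y) ≃ Fin g := Finite.equivFinOfCardEq hcard
    have hflag : ∀ i, ∃ h, G.graph.ι h ≠ h ∧ (φ.symm i : Sym2 G.graph.F) = s(h, G.graph.ι h) :=
      fun i => mem_edges_iff.1 (φ.symm i).2.1
    choose a ha ha' using hflag
    let m : Fin g ⊕ Fin g → G.graph.F := Sum.elim a fun i => G.graph.ι (a i)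
    have hedge : ∀ i j, (φ.symm i : Sym2 G.graph.F) = φ.symm j → i = j := fun i j h =>
      φ.symm.injective (Subtype.ext h)
    have hm : Function.Injective m := by
      have h1 : ∀ i j, a i ≠ G.graph.ι (a j) := by
        intro i j h
        have h2 := hedge i j (by rw [ha', ha', h, G.graph.ι_ι, Sym2.eq_swap])
        exact ha j (by rw [← h, h2])
      rintro (i | i) (j | j) h
      · exact congrArg Sum.inl (hedge i j (by rw [ha', ha', show a i = a j from h]))
      · exact (h1 i j h).elim
      · exact (h1 j i h.symm).elim
      · have h2 : a i = a j := by
          rw [← G.graph.ι_ι (a i), show G.graph.ι (a i) = G.graph.ι (a j) from h, G.graph.ι_ι]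
        exact congrArg Sum.inr (hedge i j (by rw [ha', ha', h2]))
    have hι : ∀ i, G.graph.ι (m (Sum.inl i)) = m (Sum.inr i) := fun i => rfl
    have hB : ∀ k ∈ {k | s(k, G.graph.ι k) ∈ Y}, k ∉ Set.range m := by
      rintro k hk ⟨i | i, rfl⟩
      · exact (φ.symm i).2.2 (by rw [ha']; exact hk)
      · refine (φ.symm i).2.2 ?_
        have hk' : s(G.graph.ι (a i), G.graph.ι (G.graph.ι (a i))) ∈ Y := hk
        rwa [G.graph.ι_ι, Sym2.eq_swap, ← ha'] at hk'
    have hsymm : ∀ k ∈ {k | s(k, G.graph.ι k) ∈ Y}, G.graph.ι k ∈ {k | s(k, G.graph.ι k) ∈ Y} := by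
      intro k hk
      rwa [Set.mem_ofPred_eq, G.graph.ι_ι, Sym2.eq_swap]
    have hc : (G.graph.cut (Set.range m) (ι_mem_range hι)).Connected := fun v hv w hw =>
      (cut_joined (ι_mem_range hι) hB (((hj v (by rw [hUV]; exact hv)).symm hsymm).trans
        (hj w (by rw [hUV]; exact hw)))).mono (Set.subset_univ _)
    exact ⟨cut hm hι hc, ⟨(stCutIso hm hι hc).symm⟩⟩

/-! ### The lifting property of the spanning tree functor -/

/-- A contraction `c` of a stable graph `X` onto `st(T)` lifts to a contraction of trees: cut the
edges of `X` that are mapped to the glued edges of `st(T)`. -/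
theorem exists_lift_stFunctor {g : ℕ} {A : Type u} [Finite A]
    (T : StableGraph.{u} 0 (A ⊕ (Fin g ⊕ Fin g))) (X : StableGraph.{u} g A)
    (c : X ⟶ (stFunctor g A).obj T) : ∃ (T' : StableGraph.{u} 0 (A ⊕ (Fin g ⊕ Fin g)))
      (h : T' ⟶ T) (k : X ≅ (stFunctor g A).obj T'), c = k.hom ≫ (stFunctor g A).map h := by
  let φ : X.graph.F → T.graph.F := c.toFun
  have hf : IsContraction (G := X.graph) (H := T.glue) φ := c.isContraction
  have hlift : ∀ x : Fin g ⊕ Fin g, ∃ h, φ h = T.mark (Sum.inr x) := fun x => hf.surjective _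
  choose m hm using hlift
  have hmV : ∀ x, φ (m x) ∉ T.glue.V := fun x => hm x ▸ (T.mark (Sum.inr x)).2.1
  have hinj : Function.Injective m := fun x y hxy =>
    Sum.inr_injective (T.mark_injective (by rw [← hm, ← hm, hxy]))
  have hmem : ∀ h x, φ h = T.mark (Sum.inr x) → h = m x := fun h x hh =>
    (hf.injOn (hmV x) ((hm x).trans hh.symm)).symm
  have hι : ∀ i, X.graph.ι (m (Sum.inl i)) = m (Sum.inr i) := by
    intro i
    refine hmem _ _ ?_
    rw [hf.map_ι, hm]
    exact T.glueInv_mark _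
  have hcut : IsContraction (G := X.graph.cut (Set.range m) (ι_mem_range hι)) (H := T.graph)
      φ :=
    { map_r := hf.map_r
      map_ι := fun h => by
        by_cases hr : h ∈ Set.range m
        · obtain ⟨x, rfl⟩ := hr
          rw [cut_ι_of_mem (ι_mem_range hι) ⟨x, rfl⟩, hm, T.ι_mark]
        · rw [cut_ι_of_notMem _ hr, hf.map_ι]
          show T.glueInv _ = _
          by_cases hl : φ h ∈ T.graph.legs
          · obtain ⟨a | x, ha⟩ := exists_mark (G := T) hl
            · rw [ha, T.ι_mark, T.glueInv_mark]; rfl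
            · exact (hr ⟨x, (hmem h x ha).symm⟩).elim
          · exact T.glueInv_of_notMem hl
      fiber_tree := fun v hv => cut_tree _ (hf.fiber_tree v hv) (by
        rintro _ h1 ⟨x, rfl⟩
        exact hmV x (Set.mem_of_eq_of_mem h1 hv))
      fiber_half := hf.fiber_half }
  have hc : (X.graph.cut (Set.range m) (ι_mem_range hι)).Connected := fun v hv w hw =>
    hcut.joined_lift (W := Set.univ) hv trivial (fun _ _ => trivial) (Set.subset_univ _)
      (Set.subset_univ _) (T.connected _ (hcut.map_V hv) _ (hcut.map_V hw)) w hw rfl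
  have hmark : ∀ a, φ ((cut hinj hι hc).mark a) = T.mark a := by
    rintro (a | x)
    · exact c.map_mark a
    · exact hm x
  exact ⟨cut hinj hι hc, ⟨c.toFun, hcut, hmark⟩, stCutIso hinj hι hc, rfl⟩

/-- Two lifts of a contraction onto `st(T)` are isomorphic: the isomorphism between their gluings
respects the marked legs that are glued, as these are determined by their images in `T`. -/
theorem unique_lift_stFunctor {g : ℕ} {A : Type u}
    {T T₁ T₂ : StableGraph.{u} 0 (A ⊕ (Fin g ⊕ Fin g))} (h₁ : T₁ ⟶ T) (h₂ : T₂ ⟶ T)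
    (j : (stFunctor g A).obj T₁ ≅ (stFunctor g A).obj T₂)
    (hj : j.hom ≫ (stFunctor g A).map h₂ = (stFunctor g A).map h₁) :
    ∃ i : T₁ ≅ T₂, i.hom ≫ h₂ = h₁ ∧ (stFunctor g A).map i.hom = j.hom := by
  let e : T₁.graph.F ≃ T₂.graph.F :=
    ⟨j.hom.toFun, j.inv.toFun, congrFun (congrArg StableGraph.Hom.toFun j.hom_inv_id),
      congrFun (congrArg StableGraph.Hom.toFun j.inv_hom_id)⟩
  have he : ∀ h, h₂.toFun (e h) = h₁.toFun h := fun h =>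
    congrFun (congrArg StableGraph.Hom.toFun hj) h
  have hmark : ∀ a, e (T₁.mark a) = T₂.mark a := by
    rintro (a | x)
    · exact j.hom.map_mark a
    · exact StableGraph.Hom.mark_eq h₂ ((he _).trans (StableGraph.Hom.map_mark h₁ _))
  have hinv : ∀ h, e (T₁.glueInv h) = T₂.glueInv (e h) := j.hom.isContraction.map_ι
  refine ⟨isoOfEquiv e j.hom.isContraction.map_r (fun h => ?_) hmark,
    StableGraph.Hom.ext (funext he), rfl⟩
  by_cases hl : h ∈ T₁.graph.legs
  · obtain ⟨a, rfl⟩ := exists_mark (G := T₁) hl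
    rw [T₁.ι_mark, hmark, T₂.ι_mark]
  · rw [← T₁.glueInv_of_notMem hl, hinv, T₂.glueInv_of_notMem]
    intro h2
    obtain ⟨a, ha⟩ := exists_mark (G := T₂) h2
    exact hl (e.injective (ha.trans (hmark a).symm) ▸ (T₁.mark a).2)

/-! ### The relative interiors -/

section Interior

variable {g : ℕ} {A : Type u} (T : StableGraph.{u} 0 (A ⊕ (Fin g ⊕ Fin g)))

theorem stLin_bijective : Function.Bijective (stLin T) := by
  constructor
  · intro y z h
    refine Prod.ext (funext fun e => ?_) (funext fun i => ?_)
    · rw [← stLin_edge T y, ← stLin_edge T z, h]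
    · rw [← stLin_glueEdge T y, ← stLin_glueEdge T z, h]
  · intro n
    refine ⟨(fun e => n ⟨e, T.edges_subset_glue e.2⟩, fun i => n ⟨_, T.glueEdge_mem i⟩), ?_⟩
    funext ⟨e, he⟩
    rcases T.mem_glue_edges_iff.1 he with he' | ⟨i, rfl⟩
    · exact stLin_edge T _ ⟨e, he'⟩
    · exact stLin_glueEdge T _ i

/-- Every metric on the glued graph with positive lengths comes from a metric on the tree. -/
theorem orthant_subset_image (x : ℝ ⊗[ℤ] (T.glue.edges → ℤ))
    (hx : ∀ e, 0 < realFunctional (LinearMap.proj e) x) :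
    x ∈ (stLin T).baseChange ℝ '' prodCone T.graph.metricCone (Poic.posOrthant (Fin g)).cone := by
  obtain ⟨y, rfl⟩ := baseChange_surjective (stLin_bijective T).2 x
  refine ⟨y, ⟨mem_metricCone_of_pos fun e => ?_, fun i => ?_⟩, rfl⟩
  · have h1 := hx ⟨e, T.edges_subset_glue e.2⟩
    rw [realFunctional_baseChange] at h1 ⊢
    rwa [show LinearMap.proj e ∘ₗ LinearMap.fst ℤ _ _ =
      LinearMap.proj ⟨e, T.edges_subset_glue e.2⟩ ∘ₗ stLin T from
        LinearMap.ext fun z => (stLin_edge T z e).symm]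
  · have h1 := hx ⟨_, T.glueEdge_mem i⟩
    have h2 : (LinearMap.proj i : (Fin g → ℤ) →ₗ[ℤ] ℤ) ∘ₗ
        LinearMap.snd ℤ (T.graph.edges → ℤ) (Fin g → ℤ) =
        LinearMap.proj ⟨_, T.glueEdge_mem i⟩ ∘ₗ stLin T :=
      LinearMap.ext fun z => (stLin_glueEdge T z i).symm
    rw [realFunctional_baseChange, ← h2] at h1
    exact h1.trans_eq (realFunctional_baseChange _ _ _).symm

theorem isIsoOnInterior_stEta :
    Poic.IsIsoOnInterior ((stEta.{u} g A).app (Opposite.op T)) := by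
  have := Fintype.ofFinite T.glue.edges
  refine ⟨stLin_bijective T, (relInterior_image (stLin_bijective T) _).trans ?_⟩
  refine (relInterior_eq_orthant (orthant_subset_image T) ?_).trans
    (relInterior_eq_orthant (fun _ => mem_metricCone_of_pos) fun _ => metricCone_nonneg).symm
  rintro _ ⟨y, hy, rfl⟩
  exact metricCone_nonneg (stLin_mapsTo T hy)

end Interior

/-! ### The spanning tree fibration -/

theorem isPoicMorphism_stEta (g : ℕ) (A : Type u) :
    IsPoicMorphism (stComplex.{u} g A) (Mtrop g A) (stFunctor g A).op (stEta g A) := by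
  rintro ⟨T⟩ τ hτ hsub
  have := Fintype.ofFinite T.glue.edges
  obtain ⟨Y, rfl⟩ := IsFace.exists_coordinates (E := T.glue.edges)
    (σ := T.glue.metricCone) (fun _ => mem_metricCone_of_pos) (fun _ => metricCone_nonneg) hτ
  obtain ⟨x, hx⟩ := exists_coordinates fun _ : T.glue.edges => (1 : ℝ)
  have h1 := hsub (orthant_subset_image T x fun e => by rw [hx]; exact one_pos)
  ext y
  exact ⟨fun h => h.1, fun h => ⟨h, fun e he => (one_ne_zero ((hx e).symm.trans (h1.2 e he))).elim⟩⟩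

theorem isPoicMorphism_lattice {C : Type v} [Category.{w} C] {Φ : C ⥤ Poic.{u}} {N : Type u}
    [AddCommGroup N] [Module.Free ℤ N] [Module.Finite ℤ N]
    (X : Φ ⟶ Functor.star C ⋙ latticeComplex N) :
    IsPoicMorphism Φ (latticeComplex N) (Functor.star C) X := by
  rintro p τ ⟨-, f, hf, rfl⟩ -
  -- A functional that is non-positive on a vector space vanishes.
  refine Set.eq_univ_of_forall fun x => ⟨trivial, ?_⟩
  have h1 := hf (-x) trivial
  rw [map_neg] at h1
  exact neg_nonpos.1 h1

theorem isLinearPoicFibration_stEta (g : ℕ) (A : Type u) [Finite A]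
    (hgA : 2 < 2 * g + Nat.card A) :
    IsLinearPoicFibration (stComplex g A) (distLattice (A ⊕ (Fin g ⊕ Fin g))) (stDist g A)
      (Mtrop g A) (stFunctor g A).op (stEta g A) := by
  have := essSurj_stFunctor hgA
  refine ⟨⟨isPoicComplex_stComplex g A, isPoicMorphism_lattice _⟩,
    { isPoicComplex := isPoicComplex_stComplex g A
      isPoicSpace := isPoicSpace_Mtrop g A
      isPoicMorphism := isPoicMorphism_stEta g A
      essSurj := inferInstance
      interior := fun T => isIsoOnInterior_stEta T.unop
      exists_lift := ?_
      unique_lift := ?_ }⟩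
  · rintro ⟨T⟩ ⟨X⟩ f
    obtain ⟨T', h, k, hk⟩ := exists_lift_stFunctor T X f.unop
    exact ⟨Opposite.op T', h.op, k.op, Quiver.Hom.unop_inj hk⟩
  · rintro ⟨T⟩ ⟨X⟩ f ⟨T₁⟩ h₁ k₁ ⟨T₂⟩ h₂ k₂ e₁ e₂
    have e₁' : f.unop = k₁.unop.hom ≫ (stFunctor g A).map h₁.unop := congrArg Quiver.Hom.unop e₁
    have e₂' : f.unop = k₂.unop.hom ≫ (stFunctor g A).map h₂.unop := congrArg Quiver.Hom.unop e₂
    obtain ⟨i, hi, hi'⟩ := unique_lift_stFunctor h₂.unop h₁.unop (k₂.unop.symm ≪≫ k₁.unop) (by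
      rw [Iso.trans_hom, Category.assoc, ← e₁', e₂', Iso.symm_hom, Iso.inv_hom_id_assoc])
    refine ⟨i.op, Quiver.Hom.unop_inj hi, Quiver.Hom.unop_inj ?_⟩
    show k₂.unop.hom ≫ (stFunctor g A).map i.hom = k₁.unop.hom
    rw [hi', Iso.trans_hom, Iso.symm_hom, Iso.hom_inv_id_assoc]

end TropicalModuli

theorem mainTheorem5 (g : ℕ) (A : Type u) [Finite A] (hgA : 2 < 2 * g + Nat.card A) :
    (TropicalModuli.stFunctor g A).EssSurj ∧
      TropicalModuli.IsLinearPoicFibration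
        (TropicalModuli.stComplex g A)
        (TropicalModuli.distLattice (A ⊕ (Fin g ⊕ Fin g)))
        (TropicalModuli.stDist g A)
        (TropicalModuli.Mtrop g A)
        (TropicalModuli.stFunctor g A).op
        (TropicalModuli.stEta g A) :=
  ⟨TropicalModuli.essSurj_stFunctor hgA, TropicalModuli.isLinearPoicFibration_stEta g A hgA⟩
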